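/- Let $M$ be a (connected) Riemann surface, $n,r\ge 1$, and let $\phi_0\in \mathrm U(n)$. For a subspace (or subbundle) $\alpha$ of $\mathbb C^n$ let $\pi_\alpha,\pi_\alpha^\perp$ be the orthogonal projections onto $\alpha$ and $\alpha^\perp$. Write elements of $\mathbb C^{rn}$ as $H=(H_0,\dots,H_{r-1})$ with $H_i\in\mathbb C^n$. Let $\underline B$ be a holomorphic subbundle of the trivial bundle $M\times\mathbb C^{rn}$, and let $\underline X$ be the holomorphic subbundle that is the image of $\underline B$ under the linear isomorphism $H\mapsto L$, $$L_i=\sum_{\ell=0}^{i}\binom{i}{\ell}H_\ell\qquad(0\le i\le r-1).$$ *The map given by $\underline B$.* Derivatives $(\cdot)^{(k)}$ are taken with respect to local complex coordinates, and subbundles that are first defined only away from a closed discrete set by spans are extended continuously over that set. For $i=0,\dots,r-1$ define inductively subbundles of $M\times\mathbb C^n$ by $$\alpha_{i+1}^{(k)}=\Bigl\{\sum_{s=k}^{i}C^i_s\,H^{(k)}_{s-k}: H \text{ a meromorphic section of } \underline B\Bigr\},\qquad \alpha_{i+1}=\sum_{k=0}^{i}\alpha_{i+1}^{(k)},$$ where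 $C^i_s=\sum_{1\le i_1<\cdots<i_s\le i}\pi_{i_s}^\perp\cdots\pi_{i_1}^\perp$ and $\pi_j=\pi_{\alpha_j}$, $\pi_j^\perp=\pi_{\alpha_j}^\perp$. Put $$\phi=\phi_0(\pi_1-\pi_1^\perp)\cdots(\pi_r-\pi_r^\perp),\qquad \Phi_\lambda=(\pi_1+\lambda\pi_1^\perp)\cdots(\pi_r+\lambda\pi_r^\perp)\quad(\lambda\in S^1).$$ *Extended solutions.* For a smooth map $\phi:M\to \mathrm U(n)$ and a local complex coordinate $z$ put $A_z=\tfrac12\phi^{-1}\partial_z\phi$, $A_{\bar z}=\tfrac12\phi^{-1}\partial_{\bar z}\phi$. An extended solution for a harmonic map $\phi$ is a family of smooth maps $\Psi_\lambda:M\to \mathrm U(n)$ $(\lambda\in S^1)$ with $\Psi_1=I$, $\partial_z\Psi_\lambda=(1-\lambda^{-1})\Psi_\lambda A_z$ and $\partial_{\bar z}\Psi_\lambda=(1-\lambda)\Psi_\lambda A_{\bar z}$. A subbundle or family of subspaces of $\mathbb C^n$ over $M$ is full if it is not contained in a proper constant subspace; a polynomial extended solution $\Psi=T_0+\lambda T_1+\dots+\lambda^dT_d$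 is of type one if the image of $T_0$ is full. *The subbundle $\underline W$.* Let $\mathcal H=L^2(S^1,\mathbb C^n)$ and $\mathcal H_+=\{\sum_{k\ge0}\lambda^ka_k\}\subset\mathcal H$, and identify $\mathcal H_+/\lambda^r\mathcal H_+$ with $\mathbb C^{rn}$ by $(L_0,\dots,L_{r-1})\mapsto L_0+\lambda L_1+\dots+\lambda^{r-1}L_{r-1}+\lambda^r\mathcal H_+$. Let $\underline X_{(i)}$ be the subbundle spanned by the meromorphic sections of $\underline X$ and their first $i$ derivatives, and let $$\underline W=\underline X+\lambda \underline X_{(1)}+\dots+\lambda^{r-1}\underline X_{(r-1)}+\lambda^r\mathcal H_+ .$$ **Theorem.** The $\alpha_i$ are smooth subbundles, $\underline W$ is a holomorphic subbundle of $M\times\mathbb C^{rn}$, the map $\phi$ is harmonic, $\Phi$ is a (polynomial) extended solution for $\phi$, and $$\Phi(\mathcal H_+)=\underline W$$ at every point of $M$. The extended solution $\Phi$ is of type one if and only if $\alpha_1$ is full. In that case $\underline W$ is the Grassmannian model of $\phi$, i.e. $\phi$ has exactly one polynomial extended solution of type one, and this extended solution $\Psi$ satisfies $\Psi(\mathcal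 H_+)=\underline W$. -/

import Mathlib

open Filter Topology
open scoped Manifold ContDiff

noncomputable section

namespace GrassModel

/-- The Hermitian space `ℂⁿ`. -/
abbrev Cn (n : ℕ) := EuclideanSpace ℂ (Fin n)

/-- Endomorphisms of `ℂⁿ`; `U(n)` is the group `unitary (EndCn n)`. -/
abbrev EndCn (n : ℕ) := Cn n →L[ℂ] Cn n

/-- `ℂʳⁿ` as the direct sum of `r` copies of `ℂⁿ`. -/
abbrev Crn (r n : ℕ) := Fin r → Cn n

/-- The component `H_j` of `H = (H_0, …, H_{r-1})`, extended by zero to all indices. -/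
def coord {r n : ℕ} (v : Crn r n) (j : ℕ) : Cn n :=
  if h : j < r then v ⟨j, h⟩ else 0

/-! ### Subbundles of trivial bundles over a Riemann surface -/

section Bundles

variable {M : Type*} [TopologicalSpace M] [ChartedSpace ℂ M]
variable {V : Type*} [NormedAddCommGroup V] [NormedSpace ℂ V]

/-- A family of subspaces of `V` is a holomorphic subbundle of `M × V` if it has a holomorphic
frame near each point. -/
def IsHolomorphicSubbundle (B : M → Submodule ℂ V) : Prop :=
  ∀ p : M, ∃ U : Set M, IsOpen U ∧ p ∈ U ∧ ∃ (d : ℕ) (b : Fin d → M → V),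
    (∀ j, MDifferentiableOn 𝓘(ℂ) 𝓘(ℂ, V) (b j) U) ∧
    ∀ q ∈ U, LinearIndependent ℂ (fun j => b j q) ∧
      B q = Submodule.span ℂ (Set.range fun j => b j q)

/-- `f` written in the preferred complex coordinate around `p`. -/
def inCoord (p : M) (f : M → V) : ℂ → V := f ∘ (chartAt ℂ p).symm

/-- `V`-valued meromorphic functions on `M`. -/
def IsMeromorphic (H : M → V) : Prop :=
  ∀ p : M, MeromorphicAt (inCoord p H) (chartAt ℂ p p)

/-- Meromorphic sections of `B`: meromorphic functions with values in `B` away from a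
closed discrete set. -/
def IsMeromorphicSection (B : M → Submodule ℂ V) (H : M → V) : Prop :=
  IsMeromorphic H ∧ ∀ᶠ q in codiscrete M, H q ∈ B q

/-- `H` is holomorphic (in particular has no pole) at `p`. -/
def IsHolomorphicAt (H : M → V) (p : M) : Prop :=
  AnalyticAt ℂ (inCoord p H) (chartAt ℂ p p)

/-- The `k`-th derivative `H^{(k)}` at `p` with respect to the complex coordinate around `p`. -/
def derivAt (k : ℕ) (H : M → V) (p : M) : V :=
  iteratedDeriv k (inCoord p H) (chartAt ℂ p p)

/-- Filling in holes: the fibre over `p` is the limit of the fibres `β q` as `q → p`, `q ≠ p`,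
that is, the space of all limits of vectors of `β q`.  It restores a continuous subbundle from
its restriction to the complement of a closed discrete set. -/
def fill (β : M → Submodule ℂ V) (p : M) : Submodule ℂ V where
  carrier := {v | ∃ σ : M → V, (∀ᶠ q in 𝓝[≠] p, σ q ∈ β q) ∧ Tendsto σ (𝓝[≠] p) (𝓝 v)}
  zero_mem' := ⟨fun _ => 0, Eventually.of_forall fun q => (β q).zero_mem, tendsto_const_nhds⟩
  add_mem' := by
    rintro v w ⟨σ, hσ, hv⟩ ⟨τ, hτ, hw⟩
    refine ⟨fun q => σ q + τ q, ?_, hv.add hw⟩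
    filter_upwards [hσ, hτ] with q h1 h2 using (β q).add_mem h1 h2
  smul_mem' := by
    rintro c v ⟨σ, hσ, hv⟩
    refine ⟨fun q => c • σ q, ?_, hv.const_smul c⟩
    filter_upwards [hσ] with q h1 using (β q).smul_mem c h1

/-- The associated bundle `X_{(i)}`: the subbundle spanned by the meromorphic sections of `X`
and their first `i` derivatives. -/
def assocBundle (X : M → Submodule ℂ V) (i : ℕ) : M → Submodule ℂ V :=
  fill fun q => Submodule.span ℂ
    {v | ∃ H : M → V, IsMeromorphicSection X H ∧ IsHolomorphicAt H q ∧
      ∃ j ≤ i, v = derivAt j H q}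

/-- A family of subspaces is full if no proper constant subspace contains all of its members. -/
def IsFull (α : M → Submodule ℂ V) : Prop :=
  ∀ A : Submodule ℂ V, (∀ p, α p ≤ A) → A = ⊤

end Bundles

/-! ### The subbundles `α_i` and the map `φ` given by `B` -/

/-- `π_α`, as an endomorphism of `ℂⁿ`. -/
def proj {n : ℕ} (α : Submodule ℂ (Cn n)) : EndCn n := α.starProjection

/-- `π_α^⊥`, as an endomorphism of `ℂⁿ`. -/
def projPerp {n : ℕ} (α : Submodule ℂ (Cn n)) : EndCn n := αᗮ.starProjection

/-- `C^i_s`: the sum over all `i_1 < ⋯ < i_s` of `π_{i_s}^⊥ ⋯ π_{i_1}^⊥`, for the `i` subspaces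
`A`. -/
def elemFn {n i : ℕ} (A : Fin i → Submodule ℂ (Cn n)) (s : ℕ) : EndCn n :=
  ∑ S ∈ Finset.powersetCard s (Finset.univ : Finset (Fin i)),
    ((S.sort (· ≥ ·)).map fun l => projPerp (A l)).prod

section Unitons

variable {M : Type*} [TopologicalSpace M] [ChartedSpace ℂ M] {r n : ℕ}

/-- `∑_{s=k}^{i} C^i_s H^{(k)}_{s-k}` at the point `q`; `A` lists the fibres of `α_1, …, α_i`
over `q`. -/
def Kvec {i : ℕ} (A : Fin i → Submodule ℂ (Cn n)) (k : ℕ) (H : M → Crn r n) (q : M) : Cn n :=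
  ∑ s ∈ Finset.Icc k i, elemFn A s (coord (derivAt k H q) (s - k))

/-- `α_{i+1}^{(k)}`, given `α_1, …, α_i`: the subbundle of all
`∑_{s=k}^{i} C^i_s H^{(k)}_{s-k}` with `H` a meromorphic section of `B`. -/
def nextUnitonPart (B : M → Submodule ℂ (Crn r n)) {i : ℕ}
    (α : Fin i → M → Submodule ℂ (Cn n)) (k : ℕ) : M → Submodule ℂ (Cn n) :=
  fill fun q => Submodule.span ℂ
    {v | ∃ H : M → Crn r n, IsMeromorphicSection B H ∧ IsHolomorphicAt H q ∧
      v = Kvec (fun l => α l q) k H q}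

/-- `α_{i+1} = ∑_{k=0}^{i} α_{i+1}^{(k)}`, given `α_1, …, α_i`. -/
def nextUniton (B : M → Submodule ℂ (Crn r n)) {i : ℕ}
    (α : Fin i → M → Submodule ℂ (Cn n)) : M → Submodule ℂ (Cn n) :=
  fill fun q => ⨆ k : Fin (i + 1), nextUnitonPart B α k q

/-- `uniton B i` is the subbundle `α_{i+1}` given by `B` (indices are shifted by one). -/
def uniton (B : M → Submodule ℂ (Crn r n)) (i : ℕ) : M → Submodule ℂ (Cn n) :=
  nextUniton B fun l : Fin i => uniton B l.1
termination_by i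
decreasing_by exact l.2

/-- The map `φ = φ₀ (π_1 - π_1^⊥) ⋯ (π_r - π_r^⊥)` given by `B`. -/
def harmonicMap (φ₀ : unitary (EndCn n)) (B : M → Submodule ℂ (Crn r n)) (p : M) : EndCn n :=
  φ₀ * (List.ofFn fun i : Fin r => proj (uniton B i p) - projPerp (uniton B i p)).prod

/-- The family `Φ_λ = (π_1 + λ π_1^⊥) ⋯ (π_r + λ π_r^⊥)` given by `B`. -/
def unitonProduct (B : M → Submodule ℂ (Crn r n)) (l : Circle) (p : M) : EndCn n :=
  (List.ofFn fun i : Fin r =>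
    proj (uniton B i p) + (l : ℂ) • projPerp (uniton B i p)).prod

end Unitons

/-! ### The bundle `W` given by `X` -/

/-- The linear map `H ↦ L`, `L_i = ∑_{l=0}^{i} (i choose l) H_l`. -/
def HtoL (r n : ℕ) : Crn r n →ₗ[ℂ] Crn r n where
  toFun H i := ∑ l ∈ Finset.Iic i, ((i : ℕ).choose (l : ℕ) : ℂ) • H l
  map_add' := by
    intro x y; funext i; simp [Finset.sum_add_distrib]
  map_smul' := by
    intro c x; funext i; simp [Finset.smul_sum, smul_comm c]

/-- Multiplication by `λʲ` on `H₊ / λʳ H₊ = ℂʳⁿ`. -/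
def shift (r n j : ℕ) : Crn r n →ₗ[ℂ] Crn r n where
  toFun L i := if j ≤ (i : ℕ) then coord L (i - j) else 0
  map_add' := by
    intro x y; funext i; simp only [coord, Pi.add_apply]; split_ifs <;> simp
  map_smul' := by
    intro c x; funext i
    simp only [coord, Pi.smul_apply, RingHom.id_apply]; split_ifs <;> simp

/-- `X + λ X_{(1)} + ⋯ + λ^{r-1} X_{(r-1)}`, as a subbundle of `ℂʳⁿ = H₊ / λʳ H₊`. -/
def modelBundle {M : Type*} [TopologicalSpace M] [ChartedSpace ℂ M] {r n : ℕ}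
    (X : M → Submodule ℂ (Crn r n)) : M → Submodule ℂ (Crn r n) :=
  fill fun q => ⨆ j : Fin r, (assocBundle X j q).map (shift r n j)

/-! ### Harmonic maps and extended solutions -/

section Harmonic

variable {M : Type*} [TopologicalSpace M] [ChartedSpace ℂ M] {n : ℕ}

/-- `∂f/∂z = (∂f/∂x - i ∂f/∂y) / 2`. -/
def dz (f : ℂ → EndCn n) (w : ℂ) : EndCn n :=
  (1 / 2 : ℂ) • (fderiv ℝ f w 1 - Complex.I • fderiv ℝ f w Complex.I)

/-- `∂f/∂z̄ = (∂f/∂x + i ∂f/∂y) / 2`. -/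
def dzbar (f : ℂ → EndCn n) (w : ℂ) : EndCn n :=
  (1 / 2 : ℂ) • (fderiv ℝ f w 1 + Complex.I • fderiv ℝ f w Complex.I)

/-- Smooth maps (in the real sense) on the surface. -/
def IsSmooth (f : M → EndCn n) : Prop :=
  ContMDiff 𝓘(ℝ, ℂ) 𝓘(ℝ, EndCn n) ∞ f

/-- Harmonic maps `M → U(n)`: smooth maps with `d*(φ⁻¹ dφ) = 0`, i.e.
`∂_x(φ⁻¹ ∂_x φ) + ∂_y(φ⁻¹ ∂_y φ) = 0` in every complex coordinate `x + iy`. -/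
def IsHarmonic (φ : M → EndCn n) : Prop :=
  (∀ p, φ p ∈ unitary (EndCn n)) ∧ IsSmooth φ ∧
  ∀ e ∈ atlas ℂ M, ∀ w ∈ e.target,
    fderiv ℝ (fun u => star (φ (e.symm u)) * fderiv ℝ (φ ∘ e.symm) u 1) w 1 +
    fderiv ℝ (fun u => star (φ (e.symm u)) * fderiv ℝ (φ ∘ e.symm) u Complex.I) w Complex.I = 0

/-- `A_z = ½ φ⁻¹ ∂_z φ`, for `φ` written in a complex coordinate. -/
def Az (φ : ℂ → EndCn n) (w : ℂ) : EndCn n := (1 / 2 : ℂ) • (star (φ w) * dz φ w)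

/-- `A_z̄ = ½ φ⁻¹ ∂_z̄ φ`, for `φ` written in a complex coordinate. -/
def Azbar (φ : ℂ → EndCn n) (w : ℂ) : EndCn n := (1 / 2 : ℂ) • (star (φ w) * dzbar φ w)

/-- `Φ` is an extended solution for the harmonic map `φ`: a family of smooth maps
`Φ_λ : M → U(n)`, `λ ∈ S¹`, with `Φ_1 = I`, `∂_z Φ_λ = (1 - λ⁻¹) Φ_λ A_z` and
`∂_z̄ Φ_λ = (1 - λ) Φ_λ A_z̄` in every complex coordinate. -/
structure IsExtendedSolution (φ : M → EndCn n) (Φ : Circle → M → EndCn n) : Prop where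
  harmonic : IsHarmonic φ
  unitary : ∀ l p, Φ l p ∈ unitary (EndCn n)
  smooth : ∀ l, IsSmooth (Φ l)
  one : ∀ p, Φ 1 p = 1
  eq_dz : ∀ l, ∀ e ∈ atlas ℂ M, ∀ w ∈ e.target,
    dz (Φ l ∘ e.symm) w = (1 - (l : ℂ)⁻¹) • (Φ l (e.symm w) * Az (φ ∘ e.symm) w)
  eq_dzbar : ∀ l, ∀ e ∈ atlas ℂ M, ∀ w ∈ e.target,
    dzbar (Φ l ∘ e.symm) w = (1 - (l : ℂ)) • (Φ l (e.symm w) * Azbar (φ ∘ e.symm) w)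

/-- `Φ = T_0 + λ T_1 + ⋯ + λᵈ T_d`. -/
def HasExpansion (Φ : Circle → M → EndCn n) (d : ℕ) (T : ℕ → M → EndCn n) : Prop :=
  ∀ l p, Φ l p = ∑ k ∈ Finset.range (d + 1), (l : ℂ) ^ k • T k p

/-- `Φ` is polynomial in `λ` and of type one: the image of its constant term is full. -/
def IsTypeOne (Φ : Circle → M → EndCn n) : Prop :=
  ∃ (d : ℕ) (T : ℕ → M → EndCn n), HasExpansion Φ d T ∧
    IsFull fun p => LinearMap.range (T 0 p : Cn n →ₗ[ℂ] Cn n)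

end Harmonic

/-! ### The Grassmannian model -/

/-- The Hilbert space `L²(S¹, ℂⁿ)`, where `S¹` is parametrized by `λ = exp (2πit)`, `t ∈ ℝ/ℤ`. -/
abbrev HilbertH (n : ℕ) :=
  MeasureTheory.Lp (Cn n) 2 (AddCircle.haarAddCircle : MeasureTheory.Measure UnitAddCircle)

/-- `H₊ = {∑_{k ≥ 0} λᵏ a_k}`. -/
def Hplus (n : ℕ) : Set (HilbertH n) :=
  {f | ∀ k : ℤ, k < 0 → fourierCoeff (f : UnitAddCircle → Cn n) k = 0}

/-- `γ(H₊)`, for a loop `γ` of endomorphisms acting by pointwise multiplication. -/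
def loopImage {n : ℕ} (γ : Circle → EndCn n) : Set (HilbertH n) :=
  {f | ∃ g ∈ Hplus n,
    (f : UnitAddCircle → Cn n) =ᵐ[AddCircle.haarAddCircle] fun t => γ (AddCircle.toCircle t) (g t)}

/-- The subspace `W + λʳ H₊` of `H₊` that corresponds to the subspace `W` of
`ℂʳⁿ = H₊ / λʳ H₊`, where `(L_0, …, L_{r-1})` is the class of
`L_0 + λ L_1 + ⋯ + λ^{r-1} L_{r-1}`. -/
def cosetSpace {r n : ℕ} (W : Submodule ℂ (Crn r n)) : Set (HilbertH n) :=
  {f | f ∈ Hplus n ∧ (fun i : Fin r => fourierCoeff (f : UnitAddCircle → Cn n) (i : ℤ)) ∈ W}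

/-- `W` is the Grassmannian model of `φ`: there is exactly one polynomial extended solution `Φ` of
type one for `φ`, and `Φ(H₊) = W + λʳ H₊` at each point. -/
def IsGrassmannianModel {M : Type*} [TopologicalSpace M] [ChartedSpace ℂ M] {r n : ℕ}
    (φ : M → EndCn n) (W : M → Submodule ℂ (Crn r n)) : Prop :=
  (∃! Φ : Circle → M → EndCn n, IsExtendedSolution φ Φ ∧ IsTypeOne Φ) ∧
  ∀ Φ : Circle → M → EndCn n, IsExtendedSolution φ Φ → IsTypeOne Φ →
    ∀ p, loopImage (fun l => Φ l p) = cosetSpace (W p)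

end GrassModel

end

/-!
Throughout, `ℂʳⁿ` is read as `H₊ / λʳ H₊`, with `Nop` the nilpotent operator of multiplication by
the loop parameter. The binomial isomorphism `HtoL` is the substitution `μ = λ / (1 - λ)`. It turns
`π + λ π^⊥` into `π + μ`, up to the unit `1 + μ`, and the theorem is proved first in the
parameter `μ`, where the sums `∑ C^i_s H_{s-k}^{(k)}` have a transparent meaning.

*The unitons are images of holomorphic bundles.* Let `T_i` be multiplication by
`(π_1 + μ) ⋯ (π_i + μ)` (`muOp`). The operators `C^i_s` are the coefficients of the adjugate
`(μ + π_i^⊥) ⋯ (μ + π_1^⊥)`, whose product with `T_i` is `μⁱ (1 + μ)ⁱ`. Hence the map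
`R : v ↦ ∑_s C^i_s v_s` reads off the constant term of `u` from `T_i u` (`Rop_muOp`), and it kills
exactly `μ T_i(H₊)` inside `T_i(H₊)`. With `model B i = ∑_{j<i} μʲ B_{(j)} + μⁱ H₊` one shows by
induction that `T_i(H₊) = model B i` and that `α_{i+1}` is the image under `R` of
`model B (i + 1)`, which lies between `μ T_i(H₊)` and `T_i(H₊)` (`smoothFam_and_range_muOp`). The
same induction gives smoothness: a holomorphic projection onto `model B (i + 1)` is compressed to a
smooth oblique projection onto `α_{i+1}` (`compress_isProj`), and the orthogonal projection is a
smooth function of the oblique one (`proj_range_eq`).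

*Filling in the holes.* The sections in question are global meromorphic ones, so one needs enough
of them. A linear map that identifies one fibre of `B` with `ℂᵈ`
identifies the generic one as well, and the preimages of the unit vectors form a global meromorphic
frame (`exists_meromorphic_frame`); generically its jets span the same spaces as those of a local
holomorphic frame (`exists_frame_jetSpan`). A span of finitely many holomorphic functions extends
over its discrete set of bad points as the range of a holomorphic family of projections
(`exists_analytic_projection`).

*The bundle `W` and the extended solution.* Undoing the change of parameter, `W = Φ(H₊)` modulo
`λʳ H₊` (`modelBundle_eq_range`), and Fourier coefficients give the equality in `L²`
(`loopImage_prodLoop`). The bundle `W` is holomorphic and `λ ∂_z` preserves its sections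
(`exists_projection_model`). Therefore `Φ⁻¹ ∂_z̄ Φ` and `λ Φ⁻¹ ∂_z Φ` are polynomial in `λ`. As `Φ`
is unitary, `Φ⁻¹ ∂_z̄ Φ` is minus the adjoint of `Φ⁻¹ ∂_z Φ`, so it has degree at most one in `λ`.
It vanishes at `λ = 1`, and this is the equation of an extended solution
(`exists_wirtinger_prodLoop`). Harmonicity of `φ` is the integrability condition of that equation
at two values of `λ` (`wirtingerBar_add_wirtinger_eq_zero`).

*Type one.* The image of the constant term of `Φ` and `α_1` both agree, off a discrete set, with the
space of values `L_0 = H_0` of sections of `B`, so one is full if and only if the other is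
(`isFull_range_iff`). Two extended solutions of `φ` differ by a loop that is constant on `M`. When
both are polynomial of type one, the lowest coefficient of that loop kills a full family if its
exponent is negative. The same holds for the inverse loop, so the loop is the constant `1`
(`IsExtendedSolution.eq_of_isTypeOne`).
-/

noncomputable section

namespace GrassModel

/-! ### Operators on `ℂʳⁿ` -/

/-- Endomorphisms of `ℂʳⁿ = H₊ / λʳ H₊`. -/
abbrev OpV (r n : ℕ) := Crn r n →L[ℂ] Crn r n

section Algebra

theorem clm_mul_apply {V : Type*} [NormedAddCommGroup V] [NormedSpace ℂ V] (S T : V →L[ℂ] V)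
    (v : V) : (S * T) v = S (T v) := rfl

variable {r n : ℕ}

theorem coord_of_lt (v : Crn r n) {j : ℕ} (h : j < r) : coord v j = v ⟨j, h⟩ := by
  simp [coord, h]

theorem coord_of_le (v : Crn r n) {j : ℕ} (h : r ≤ j) : coord v j = 0 := by
  simp [coord, not_lt.mpr h]

@[simp] theorem coord_fin (v : Crn r n) (i : Fin r) : coord v i = v i := by
  simp [coord]

theorem coord_add (v w : Crn r n) (j : ℕ) : coord (v + w) j = coord v j + coord w j := by
  unfold coord; split_ifs <;> simp

theorem coord_smul (c : ℂ) (v : Crn r n) (j : ℕ) : coord (c • v) j = c • coord v j := by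
  unfold coord; split_ifs <;> simp

@[simp] theorem coord_zero (j : ℕ) : coord (0 : Crn r n) j = 0 := by
  unfold coord; split_ifs <;> simp

theorem coord_sum {ι : Type*} (s : Finset ι) (f : ι → Crn r n) (j : ℕ) :
    coord (∑ k ∈ s, f k) j = ∑ k ∈ s, coord (f k) j := by
  classical
  induction s using Finset.induction_on with
  | empty => simp
  | insert a s ha ih => rw [Finset.sum_insert ha, Finset.sum_insert ha, coord_add, ih]

theorem ext_coord {v w : Crn r n} (h : ∀ j < r, coord v j = coord w j) : v = w := by
  funext i
  simpa using h i i.2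

/-- The `j`-th component as a continuous linear map; it is zero for `j ≥ r`. -/
def coordL (r n j : ℕ) : Crn r n →L[ℂ] Cn n :=
  LinearMap.toContinuousLinearMap
    { toFun := fun v => coord v j
      map_add' := fun v w => coord_add v w j
      map_smul' := fun c v => coord_smul c v j }

@[simp] theorem coordL_apply (j : ℕ) (v : Crn r n) : coordL r n j v = coord v j := rfl

/-- The inclusion of `ℂⁿ` as the constants in `H₊ / λʳ H₊`. -/
def constL (r n : ℕ) : Cn n →L[ℂ] Crn r n :=
  ContinuousLinearMap.pi fun i : Fin r => if (i : ℕ) = 0 then ContinuousLinearMap.id ℂ (Cn n) else 0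

theorem coord_constL (c : Cn n) {j : ℕ} (hj : j < r) :
    coord (constL r n c) j = if j = 0 then c else 0 := by
  rw [coord_of_lt _ hj]
  simp only [constL, ContinuousLinearMap.coe_pi']
  split_ifs <;> simp

/-- Multiplication by the loop parameter on `ℂʳⁿ = H₊ / λʳ H₊`. -/
def Nop (r n : ℕ) : OpV r n := LinearMap.toContinuousLinearMap (shift r n 1)

theorem coord_shift (j : ℕ) (v : Crn r n) (i : ℕ) :
    coord (shift r n j v) i = if j ≤ i ∧ i < r then coord v (i - j) else 0 := by
  by_cases hi : i < r
  · rw [coord_of_lt _ hi]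
    simp [shift, hi]
  · rw [coord_of_le _ (not_lt.mp hi)]
    simp [hi]

theorem coord_Nop (v : Crn r n) (i : ℕ) :
    coord (Nop r n v) i = if 1 ≤ i ∧ i < r then coord v (i - 1) else 0 :=
  coord_shift 1 v i

theorem Nop_pow_apply (j : ℕ) (v : Crn r n) : (Nop r n ^ j) v = shift r n j v := by
  induction j with
  | zero =>
    refine ext_coord fun i hi => ?_
    simp [coord_shift, hi]
  | succ j ih =>
    rw [pow_succ', clm_mul_apply, ih]
    refine ext_coord fun i hi => ?_
    rw [coord_Nop, coord_shift, coord_shift]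
    rcases i with _ | i
    · simp
    · have h1 : i + 1 - 1 = i := by omega
      have h2 : i + 1 - (j + 1) = i - j := by omega
      have h3 : i < r := by omega
      by_cases h4 : j ≤ i <;> simp [h1, h2, h3, hi, h4]

theorem coord_Nop_pow (j : ℕ) (v : Crn r n) (i : ℕ) :
    coord ((Nop r n ^ j) v) i = if j ≤ i ∧ i < r then coord v (i - j) else 0 := by
  rw [Nop_pow_apply, coord_shift]

theorem Nop_pow_eq_zero {j : ℕ} (h : r ≤ j) : Nop r n ^ j = 0 := by
  ext1 v
  refine ext_coord fun i hi => ?_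
  rw [coord_Nop_pow, if_neg (by omega)]
  simp

/-- An element of `H₊ / λʳ H₊` without constant term is a multiple of the loop parameter. -/
theorem exists_Nop_eq_of_coord_zero {v : Crn r n} (h : coord v 0 = 0) : ∃ u, Nop r n u = v := by
  refine ⟨fun i => coord v (i + 1), ext_coord fun i hi => ?_⟩
  rw [coord_Nop]
  rcases i with _ | i
  · simp [h]
  · have h3 : i < r := by omega
    simp only [le_add_iff_nonneg_left, zero_le, hi, and_self, if_true, add_tsub_cancel_right]
    rw [coord_of_lt _ h3]

/-- An endomorphism of `ℂⁿ` acting on each component of `ℂʳⁿ`. -/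
def diagOp (r n : ℕ) : EndCn n →ₗ[ℂ] OpV r n where
  toFun a := ContinuousLinearMap.pi fun i => a ∘L ContinuousLinearMap.proj i
  map_add' a b := by ext; rfl
  map_smul' c a := by ext; rfl

theorem coord_diagOp (a : EndCn n) (v : Crn r n) (j : ℕ) :
    coord (diagOp r n a v) j = a (coord v j) := by
  unfold coord diagOp
  split_ifs <;> simp

@[simp] theorem diagOp_one : diagOp r n 1 = 1 := by
  ext; rfl

theorem diagOp_mul (a b : EndCn n) : diagOp r n (a * b) = diagOp r n a * diagOp r n b := by
  ext; rfl

theorem commute_Nop_diagOp (a : EndCn n) : Commute (Nop r n) (diagOp r n a) := by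
  ext1 v
  refine ext_coord fun i hi => ?_
  simp only [clm_mul_apply, coord_Nop, coord_diagOp]
  split_ifs <;> simp

/-- With `μ = λ / (1 - λ)`, the operator of multiplication by `(π_1 + μ) ⋯ (π_i + μ)` on
`ℂⁿ[μ] / μʳ`.  It agrees with `(π_1 + λ π_1^⊥) ⋯ (π_i + λ π_i^⊥)` up to the unit `(1 + μ)ⁱ`. -/
def muOp (r : ℕ) {n : ℕ} (P : ℕ → EndCn n) : ℕ → OpV r n
  | 0 => 1
  | i + 1 => muOp r P i * (diagOp r n (P i) + Nop r n)

/-- Multiplication by `(μ + π_i^⊥) ⋯ (μ + π_1^⊥)` on `ℂⁿ[μ] / μʳ`. -/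
def muAdj (r : ℕ) {n : ℕ} (P : ℕ → EndCn n) : ℕ → OpV r n
  | 0 => 1
  | i + 1 => (Nop r n + diagOp r n (1 - P i)) * muAdj r P i

/-- Multiplication by `(π_1 + λ π_1^⊥) ⋯ (π_i + λ π_i^⊥)` on `H₊ / λʳ H₊`. -/
def laOp (r : ℕ) {n : ℕ} (P : ℕ → EndCn n) : ℕ → OpV r n
  | 0 => 1
  | i + 1 => laOp r P i * (diagOp r n (P i) + Nop r n * diagOp r n (1 - P i))

/-- The coefficients `C^i_s` of `(1 + t π_i^⊥) ⋯ (1 + t π_1^⊥)`, by recursion on `i`. -/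
def csum {n : ℕ} (P : ℕ → EndCn n) : ℕ → ℕ → EndCn n
  | 0, 0 => 1
  | 0, _ + 1 => 0
  | i + 1, 0 => csum P i 0
  | i + 1, s + 1 => csum P i (s + 1) + (1 - P i) * csum P i s

theorem csum_eq_zero (P : ℕ → EndCn n) {i s : ℕ} (h : i < s) : csum P i s = 0 := by
  induction i generalizing s with
  | zero =>
    obtain ⟨s, rfl⟩ : ∃ t, s = t + 1 := ⟨s - 1, by omega⟩
    rfl
  | succ i ih =>
    obtain ⟨s, rfl⟩ : ∃ t, s = t + 1 := ⟨s - 1, by omega⟩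
    rw [csum, ih (by omega), ih (by omega)]
    simp

/-- `muAdj` is an adjugate of `muOp`: for each factor, `(μ + π^⊥)(π + μ) = μ (1 + μ)`. -/
theorem muAdj_mul_muOp {P : ℕ → EndCn n} (hP : ∀ j, P j * P j = P j) (i : ℕ) :
    muAdj r P i * muOp r P i = Nop r n ^ i * (1 + Nop r n) ^ i := by
  induction i with
  | zero => simp [muAdj, muOp]
  | succ i ih =>
    set N := Nop r n
    set p := diagOp r n (P i)
    have hp : p * p = p := by rw [← diagOp_mul, hP]
    have hNp : N * p = p * N := commute_Nop_diagOp (P i)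
    have hq : diagOp r n (1 - P i) = 1 - p := by rw [map_sub, diagOp_one]
    have key : (N + (1 - p)) * (p + N) = N * (1 + N) := by
      simp only [add_mul, mul_add, sub_mul, hp, hNp, one_mul, mul_one]
      abel
    have hc : Commute (N ^ i * (1 + N) ^ i) (p + N) := by
      have h1 : Commute N (p + N) := Commute.add_right hNp rfl
      have h2 : Commute (1 + N) (p + N) := (Commute.one_left _).add_left h1
      exact (h1.pow_left i).mul_left (h2.pow_left i)
    have hN : Commute (1 + N) N := (Commute.one_left _).add_left rfl
    calc muAdj r P (i + 1) * muOp r P (i + 1)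
        = (N + (1 - p)) * (muAdj r P i * muOp r P i) * (p + N) := by
          rw [muAdj, muOp, hq]; noncomm_ring
      _ = (N + (1 - p)) * (p + N) * (N ^ i * (1 + N) ^ i) := by
          rw [ih, mul_assoc, hc.eq, ← mul_assoc]
      _ = N ^ (i + 1) * (1 + N) ^ (i + 1) := by
          rw [key, pow_succ', pow_succ', mul_assoc, mul_assoc, ← mul_assoc (1 + N) (N ^ i),
            (hN.pow_right i).eq, mul_assoc]

/-- The coefficients of the polynomial `(μ + π_i^⊥) ⋯ (μ + π_1^⊥)` are the `C^i_s`. -/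
theorem muAdj_eq_sum (P : ℕ → EndCn n) (i : ℕ) :
    muAdj r P i = ∑ s ∈ Finset.range (i + 1), diagOp r n (csum P i s) * Nop r n ^ (i - s) := by
  induction i with
  | zero => simp [muAdj, csum]
  | succ i ih =>
    rw [muAdj, ih, add_mul, Finset.mul_sum, Finset.mul_sum, Finset.sum_range_succ' _ (i + 1)]
    simp only [csum, map_add, add_mul, Finset.sum_add_distrib]
    have h1 : ∑ s ∈ Finset.range (i + 1), diagOp r n (csum P i (s + 1)) *
        Nop r n ^ (i + 1 - (s + 1)) + diagOp r n (csum P i 0) * Nop r n ^ (i + 1 - 0) =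
        ∑ s ∈ Finset.range (i + 1), Nop r n * (diagOp r n (csum P i s) * Nop r n ^ (i - s)) := by
      rw [← Finset.sum_range_succ'
        (fun s => diagOp r n (csum P i s) * Nop r n ^ (i + 1 - s)) (i + 1),
        Finset.sum_range_succ, csum_eq_zero P (Nat.lt_succ_self i)]
      simp only [map_zero, zero_mul, add_zero]
      refine Finset.sum_congr rfl fun s hs => ?_
      have hs' : s ≤ i := by simpa [Nat.lt_succ_iff] using hs
      rw [← mul_assoc, (commute_Nop_diagOp (r := r) (csum P i s)).eq, mul_assoc, ← pow_succ',
        Nat.sub_add_comm hs']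
    rw [← h1]
    simp only [Nat.add_sub_add_right, diagOp_mul, mul_assoc]
    abel

/-- The map `v ↦ ∑_s C^i_s v_s`.  It reads off the constant term of `u` from `muOp u`. -/
def Rop (r : ℕ) {n : ℕ} (P : ℕ → EndCn n) (i : ℕ) : Crn r n →L[ℂ] Cn n :=
  coordL r n i ∘L muAdj r P i

/-- On `μᵏ v`, the map `Rop` is the sum `∑_{s=k}^{i} C^i_s v_{s-k}` that defines `α_{i+1}^{(k)}`. -/
theorem Rop_Nop_pow (P : ℕ → EndCn n) {i : ℕ} (hi : i < r) (k : ℕ) (v : Crn r n) :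
    Rop r P i ((Nop r n ^ k) v) = ∑ s ∈ Finset.Icc k i, csum P i s (coord v (s - k)) := by
  have h : Rop r P i ((Nop r n ^ k) v) =
      ∑ s ∈ Finset.range (i + 1), if k ≤ s then csum P i s (coord v (s - k)) else 0 := by
    simp only [Rop, ContinuousLinearMap.comp_apply, coordL_apply, muAdj_eq_sum,
      _root_.sum_apply, coord_sum]
    refine Finset.sum_congr rfl fun s hs => ?_
    have hs' : s ≤ i := by simpa [Nat.lt_succ_iff] using hs
    rw [clm_mul_apply, coord_diagOp, coord_Nop_pow, if_pos (by omega),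
      coord_Nop_pow, Nat.sub_sub_self hs']
    have : s < r := by omega
    by_cases hk : k ≤ s <;> simp [hk, this]
  rw [h, ← Finset.sum_filter]
  refine Finset.sum_congr ?_ fun _ _ => rfl
  ext s
  simp [and_comm]

theorem coord_zero_one_add_Nop_pow (i : ℕ) (u : Crn r n) :
    coord (((1 + Nop r n) ^ i) u) 0 = coord u 0 := by
  induction i with
  | zero => simp
  | succ i ih =>
    rw [pow_succ', clm_mul_apply, _root_.add_apply, coord_add,
      coord_Nop, _root_.one_apply_eq_self, ih]
    simp

/-- `Rop` inverts `muOp` on constant terms, because `muAdj muOp u = μⁱ (1 + μ)ⁱ u` has `i`-th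
coefficient `u_0`. -/
theorem Rop_muOp {P : ℕ → EndCn n} (hP : ∀ j, P j * P j = P j) {i : ℕ} (hi : i < r)
    (u : Crn r n) : Rop r P i (muOp r P i u) = coord u 0 := by
  have h : muAdj r P i (muOp r P i u) = (Nop r n ^ i) (((1 + Nop r n) ^ i) u) := by
    rw [← clm_mul_apply, muAdj_mul_muOp hP, clm_mul_apply]
  rw [Rop, ContinuousLinearMap.comp_apply, h, coordL_apply, coord_Nop_pow,
    if_pos ⟨le_rfl, hi⟩, Nat.sub_self, coord_zero_one_add_Nop_pow]

theorem commute_Nop_muOp (P : ℕ → EndCn n) (i : ℕ) : Commute (Nop r n) (muOp r P i) := by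
  induction i with
  | zero => exact Commute.one_right _
  | succ i ih => exact ih.mul_right ((commute_Nop_diagOp _).add_right rfl)

/-- The range of an operator, as a subspace. -/
abbrev rg {r n : ℕ} (T : OpV r n) : Submodule ℂ (Crn r n) := LinearMap.range (T : Crn r n →ₗ[ℂ] Crn r n)

/-- Multiplication by the loop parameter, on subspaces. -/
abbrev nmap {r n : ℕ} (k : ℕ) (W : Submodule ℂ (Crn r n)) : Submodule ℂ (Crn r n) :=
  W.map ((Nop r n ^ k : OpV r n) : Crn r n →ₗ[ℂ] Crn r n)

theorem nmap_nmap (j k : ℕ) (W : Submodule ℂ (Crn r n)) : nmap j (nmap k W) = nmap (j + k) W := by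
  rw [nmap, nmap, nmap, ← Submodule.map_comp]
  congr 1
  rw [pow_add]
  rfl

theorem Rop_eq_zero_of_mem {P : ℕ → EndCn n} (hP : ∀ j, P j * P j = P j) {i : ℕ} (hi : i < r)
    {y : Crn r n} (hy : y ∈ nmap 1 (rg (muOp r P i))) : Rop r P i y = 0 := by
  obtain ⟨_, ⟨u, rfl⟩, rfl⟩ := hy
  have h : (Nop r n) (muOp r P i u) = muOp r P i (Nop r n u) := by
    rw [← clm_mul_apply, (commute_Nop_muOp P i).eq, clm_mul_apply]
  simp only [pow_one, ContinuousLinearMap.coe_coe, h, Rop_muOp hP hi, coord_Nop]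
  simp

/-- Inside `W = muOp(H₊)`, the kernel of `Rop` is `λW`. -/
theorem mem_of_Rop_eq_zero {P : ℕ → EndCn n} (hP : ∀ j, P j * P j = P j) {i : ℕ} (hi : i < r)
    {y : Crn r n} (hy : y ∈ rg (muOp r P i)) (h0 : Rop r P i y = 0) :
    y ∈ nmap 1 (rg (muOp r P i)) := by
  obtain ⟨u, rfl⟩ := hy
  simp only [ContinuousLinearMap.coe_coe, Rop_muOp hP hi] at h0
  obtain ⟨w, rfl⟩ := exists_Nop_eq_of_coord_zero h0
  refine ⟨muOp r P i w, ⟨w, rfl⟩, ?_⟩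
  simp only [pow_one, ContinuousLinearMap.coe_coe]
  rw [← clm_mul_apply, (commute_Nop_muOp P i).eq, clm_mul_apply]

/-- Modulo `λW`, an element of `W = muOp(H₊)` is recovered from its image under `Rop`. -/
theorem muOp_constL_mem {P : ℕ → EndCn n} (hP : ∀ j, P j * P j = P j) {i : ℕ} (hi : i < r)
    {Y : Submodule ℂ (Crn r n)} (h1 : nmap 1 (rg (muOp r P i)) ≤ Y) (h2 : Y ≤ rg (muOp r P i))
    {y : Crn r n} (hy : y ∈ Y) : muOp r P i (constL r n (Rop r P i y)) ∈ Y := by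
  have h : muOp r P i (constL r n (Rop r P i y)) - y ∈ nmap 1 (rg (muOp r P i)) := by
    refine mem_of_Rop_eq_zero hP hi (Submodule.sub_mem _ ⟨_, rfl⟩ (h2 hy)) ?_
    rw [map_sub, Rop_muOp hP hi, coord_constL _ (by omega), if_pos rfl, sub_self]
  simpa using Y.add_mem (h1 h) hy

/-- If `Y` lies between `λW` and `W = muOp(H₊)`, then `F = R E muOp ι` is a projection onto `R Y`,
for every projection `E` onto `Y`. Here `R` is `Rop` and `ι` is `constL`. -/
theorem compress_isProj {P : ℕ → EndCn n} (hP : ∀ j, P j * P j = P j) {i : ℕ} (hi : i < r)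
    {E : OpV r n} (hE : E * E = E)
    (h1 : nmap 1 (rg (muOp r P i)) ≤ rg E) (h2 : rg E ≤ rg (muOp r P i)) :
    let F : EndCn n := Rop r P i ∘L E ∘L muOp r P i ∘L constL r n
    F * F = F ∧ LinearMap.range (F : Cn n →ₗ[ℂ] Cn n) =
      (rg E).map (Rop r P i : Crn r n →ₗ[ℂ] Cn n) := by
  intro F
  have hfix : ∀ y ∈ rg E, E y = y := by
    rintro _ ⟨u, rfl⟩
    change E (E u) = E u
    rw [← clm_mul_apply, hE]
  have hF : ∀ y ∈ rg E, F (Rop r P i y) = Rop r P i y := by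
    intro y hy
    have := hfix _ (muOp_constL_mem hP hi h1 h2 hy)
    change Rop r P i (E (muOp r P i (constL r n (Rop r P i y)))) = _
    rw [this, Rop_muOp hP hi, coord_constL _ (by omega), if_pos rfl]
  constructor
  · ext1 c
    exact hF _ ⟨_, rfl⟩
  · ext c
    constructor
    · rintro ⟨d, rfl⟩
      exact ⟨_, ⟨_, rfl⟩, rfl⟩
    · rintro ⟨y, hy, rfl⟩
      exact ⟨_, hF y hy⟩

/-- A subspace that is stable under a nilpotent `K` is stable under the inverse of `1 + K`. -/
theorem mem_of_add_mem {K : OpV r n} {m : ℕ} (hK : K ^ m = 0) {S : Submodule ℂ (Crn r n)}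
    (hS : ∀ y ∈ S, K y ∈ S) {y : Crn r n} (hy : y + K y ∈ S) : y ∈ S := by
  have h : ∀ k, y - ((-K) ^ k) y ∈ S := by
    intro k
    induction k with
    | zero => simp
    | succ k ih =>
      have h1 : y - ((-K) ^ (k + 1)) y = (y + K y) - K (y - ((-K) ^ k) y) := by
        rw [pow_succ', clm_mul_apply, map_sub]
        simp only [_root_.neg_apply]
        abel
      rw [h1]
      exact S.sub_mem hy (hS _ ih)
  have h2 := h m
  have h3 : (-K) ^ m = 0 := by rw [neg_pow K, hK, mul_zero]
  rwa [h3, _root_.zero_apply, sub_zero] at h2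

/-- The range of `π + μ` consists of the elements whose constant term lies in the range of `π`. -/
theorem mem_range_diagOp_add_Nop {p : EndCn n} (hp : p * p = p) {v : Crn r n} :
    v ∈ rg (diagOp r n p + Nop r n) ↔ p (coord v 0) = coord v 0 := by
  constructor
  · rintro ⟨u, rfl⟩
    simp only [ContinuousLinearMap.coe_coe, _root_.add_apply, coord_add, coord_diagOp,
      coord_Nop]
    simp [← clm_mul_apply, hp]
  · intro h
    set N := Nop r n
    set d := diagOp r n p
    have hd : d * d = d := by rw [← diagOp_mul, hp]
    have hNd : N * d = d * N := commute_Nop_diagOp p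
    -- `(π + μ)(μ + π^⊥) = μ (1 + μ)`, and `1 + μ` is invertible
    have key : (d + N) * (N + (1 - d)) = N * (1 + N) := by
      simp only [add_mul, mul_add, mul_sub, hd, hNd, mul_one]
      abel
    have hN' : ∀ u, N u ∈ rg (d + N) := by
      intro u
      refine mem_of_add_mem (K := N) (Nop_pow_eq_zero le_rfl) ?_ ⟨(N + (1 - d)) u, ?_⟩
      · rintro _ ⟨w, rfl⟩
        refine ⟨N w, ?_⟩
        change (d + N) (N w) = N ((d + N) w)
        simp only [← clm_mul_apply, mul_add, add_mul, hNd]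
      · change ((d + N) * (N + (1 - d))) u = _
        rw [key, mul_add, mul_one]
        rfl
    have h0 : coord (v - (d + N) v) 0 = 0 := by
      rw [sub_eq_add_neg, coord_add, ← neg_one_smul ℂ, coord_smul, _root_.add_apply,
        coord_add, coord_diagOp, coord_Nop, h]
      simp
    obtain ⟨u, hu⟩ := exists_Nop_eq_of_coord_zero h0
    have : v = N u + (d + N) v := by rw [hu]; abel
    rw [this]
    exact Submodule.add_mem _ (hN' u) ⟨v, rfl⟩

/-- The inductive step for the factorization: if `muOp` maps onto `W` and `λW ≤ W' ≤ W`, then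
multiplication by `π + μ` on the right gives `W'`, where `π` projects onto `R W'`. -/
theorem range_muOp_succ {P : ℕ → EndCn n} (hP : ∀ j, P j * P j = P j) {i : ℕ} (hi : i < r)
    {W' : Submodule ℂ (Crn r n)} (h1 : nmap 1 (rg (muOp r P i)) ≤ W')
    (h2 : W' ≤ rg (muOp r P i))
    (hπ : LinearMap.range (P i : Cn n →ₗ[ℂ] Cn n) = W'.map (Rop r P i : Crn r n →ₗ[ℂ] Cn n)) :
    rg (muOp r P (i + 1)) = W' := by
  have hmem : ∀ c, P i c = c ↔ ∃ y ∈ W', Rop r P i y = c := by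
    intro c
    constructor
    · intro hc
      have : c ∈ LinearMap.range (P i : Cn n →ₗ[ℂ] Cn n) := ⟨c, hc⟩
      rw [hπ] at this
      exact this
    · intro hc
      have : c ∈ LinearMap.range (P i : Cn n →ₗ[ℂ] Cn n) := by rw [hπ]; exact hc
      obtain ⟨d, rfl⟩ := this
      change P i (P i d) = P i d
      rw [← clm_mul_apply, hP]
  ext y
  constructor
  · rintro ⟨u, rfl⟩
    set w := (diagOp r n (P i) + Nop r n) u
    change muOp r P i w ∈ W'
    have hw : P i (coord w 0) = coord w 0 := (mem_range_diagOp_add_Nop (hP i)).1 ⟨u, rfl⟩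
    obtain ⟨y, hy, hyw⟩ := (hmem _).1 hw
    have h3 : muOp r P i w - y ∈ nmap 1 (rg (muOp r P i)) := by
      refine mem_of_Rop_eq_zero hP hi (Submodule.sub_mem _ ⟨_, rfl⟩ (h2 hy)) ?_
      rw [map_sub, Rop_muOp hP hi, hyw, sub_self]
    simpa using W'.add_mem (h1 h3) hy
  · intro hy
    obtain ⟨u, rfl⟩ := h2 hy
    have hu : P i (coord u 0) = coord u 0 := (hmem _).2 ⟨_, hy, Rop_muOp hP hi u⟩
    obtain ⟨w, rfl⟩ := (mem_range_diagOp_add_Nop (hP i)).2 hu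
    exact ⟨w, rfl⟩

end Algebra

/-! ### The polynomials `C^i_s` -/

theorem sort_map_castSucc {i : ℕ} (S : Finset (Fin i)) :
    (S.map Fin.castSuccEmb).sort (· ≥ ·) = (S.sort (· ≥ ·)).map Fin.castSucc :=
  (Finset.map_sort Fin.castSuccEmb S (· ≥ ·) (· ≥ ·) (fun a _ b _ => by simp)).symm

theorem projPerp_eq {n : ℕ} (α : Submodule ℂ (Cn n)) : projPerp α = 1 - proj α :=
  Submodule.starProjection_orthogonal' α

theorem proj_mul_self {n : ℕ} (α : Submodule ℂ (Cn n)) : proj α * proj α = proj α :=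
  α.isIdempotentElem_starProjection

theorem star_proj {n : ℕ} (α : Submodule ℂ (Cn n)) : star (proj α) = proj α :=
  isSelfAdjoint_starProjection α

theorem range_proj {n : ℕ} (α : Submodule ℂ (Cn n)) :
    LinearMap.range (proj α : Cn n →ₗ[ℂ] Cn n) = α :=
  Submodule.range_starProjection α

/-- The sums of ordered products defining `C^i_s` satisfy the recursion of `csum`: a subset of
`{1, …, i + 1}` either omits the largest index or has it as the leftmost factor. -/
theorem elemFn_eq_csum {n : ℕ} (A : ℕ → Submodule ℂ (Cn n)) (i s : ℕ) :
    elemFn (fun l : Fin i => A l) s = csum (fun j => proj (A j)) i s := by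
  induction i generalizing s with
  | zero =>
    cases s with
    | zero => simp [elemFn, csum]
    | succ s =>
      have : Finset.powersetCard (s + 1) (Finset.univ : Finset (Fin 0)) = ∅ := by
        rw [Finset.powersetCard_eq_empty]; simp
      rw [elemFn, this]
      rfl
  | succ i ih =>
    have hu : (Finset.univ : Finset (Fin (i + 1))) =
        insert (Fin.last i) (Finset.univ.map Fin.castSuccEmb) := by
      rw [Fin.univ_castSuccEmb, Finset.cons_eq_insert]
    have hl : Fin.last i ∉ (Finset.univ.map Fin.castSuccEmb : Finset (Fin (i + 1))) := by
      simp [Fin.castSucc_ne_last]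
    have hmap : ∀ s, ∑ S ∈ Finset.powersetCard s
        (Finset.univ.map Fin.castSuccEmb : Finset (Fin (i + 1))),
          ((S.sort (· ≥ ·)).map fun l : Fin (i + 1) => projPerp (A (l : ℕ))).prod =
        elemFn (fun l : Fin i => A l) s := by
      intro s
      rw [Finset.powersetCard_map, Finset.sum_map]
      refine Finset.sum_congr rfl fun S _ => ?_
      simp only [RelEmbedding.coe_toEmbedding, Finset.mapEmbedding_apply]
      rw [sort_map_castSucc, List.map_map]
      rfl
    cases s with
    | zero =>
      rw [csum, ← ih]
      simp [elemFn]
    | succ s =>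
      rw [csum, ← ih, ← ih, ← hmap, ← hmap, ← projPerp_eq, Finset.mul_sum]
      have hdis : Disjoint
          (Finset.powersetCard (s + 1) (Finset.univ.map Fin.castSuccEmb : Finset (Fin (i + 1))))
          (Finset.image (insert (Fin.last i)) (Finset.powersetCard s
            (Finset.univ.map Fin.castSuccEmb))) := by
        rw [Finset.disjoint_left]
        intro S hS hS'
        obtain ⟨T, _, rfl⟩ := Finset.mem_image.1 hS'
        exact hl ((Finset.mem_powersetCard.1 hS).1 (Finset.mem_insert_self _ _))
      unfold elemFn
      rw [hu, Finset.powersetCard_succ_insert hl, Finset.sum_union hdis, Finset.sum_image]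
      · congr 1
        refine Finset.sum_congr rfl fun S hS => ?_
        have hS' : Fin.last i ∉ S := fun h => hl ((Finset.mem_powersetCard.1 hS).1 h)
        rw [Finset.sort_insert (· ≥ ·) (fun b _ => Fin.le_last b) hS', List.map_cons, List.prod_cons]
        rfl
      · intro S hS T hT hST
        have hS' : Fin.last i ∉ S := fun h => hl ((Finset.mem_powersetCard.1 hS).1 h)
        have hT' : Fin.last i ∉ T := fun h => hl ((Finset.mem_powersetCard.1 hT).1 h)
        rw [← Finset.erase_insert hS', ← Finset.erase_insert hT', hST]

theorem prod_ofFn_succ {R : Type*} [Monoid R] (f : ℕ → R) (i : ℕ) :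
    (List.ofFn fun j : Fin (i + 1) => f j).prod = (List.ofFn fun j : Fin i => f j).prod * f i := by
  rw [List.ofFn_succ', List.concat_eq_append, List.prod_append]
  simp

/-! ### The change of parameter from `μ = λ / (1 - λ)` to `λ` -/

section HtoL

variable {r n : ℕ}

theorem coord_HtoL (H : Crn r n) {i : ℕ} (hi : i < r) :
    coord (HtoL r n H) i = ∑ l ∈ Finset.range (i + 1), (i.choose l : ℂ) • coord H l := by
  rw [coord_of_lt _ hi]
  change ∑ l ∈ Finset.Iic (⟨i, hi⟩ : Fin r), ((i.choose (l : ℕ) : ℕ) : ℂ) • H l = _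
  refine Finset.sum_bij (fun l _ => (l : ℕ)) ?_ ?_ ?_ ?_
  · intro l hl
    simpa [Nat.lt_succ_iff, Fin.le_def] using hl
  · intro a _ b _ h
    exact Fin.ext h
  · intro b hb
    have hb' : b ≤ i := by simpa [Nat.lt_succ_iff] using hb
    exact ⟨⟨b, by omega⟩, by simpa [Fin.le_def] using hb', rfl⟩
  · intro l _
    rw [coord_fin]

/-- `HtoL` as a continuous linear map. -/
def HtoLc (r n : ℕ) : OpV r n := LinearMap.toContinuousLinearMap (HtoL r n)

theorem HtoL_injective : Function.Injective (HtoL r n) := by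
  rw [← LinearMap.ker_eq_bot, LinearMap.ker_eq_bot']
  intro H hH
  have h : ∀ i, i < r → coord H i = 0 := by
    intro i
    induction i using Nat.strong_induction_on with
    | _ i ih =>
      intro hi
      have h1 := coord_HtoL H hi
      rw [hH, Finset.sum_range_succ, Finset.sum_eq_zero] at h1
      · simpa using h1.symm
      · intro l hl
        have hl' : l < i := by simpa using hl
        rw [ih l hl' (by omega), smul_zero]
  exact ext_coord fun i hi => by simpa using h i hi

/-- The isomorphism `HtoL`. -/
def HtoLe (r n : ℕ) : Crn r n ≃L[ℂ] Crn r n :=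
  (LinearEquiv.ofInjectiveEndo (HtoL r n) HtoL_injective).toContinuousLinearEquiv

/-- `HtoL` turns multiplication by `μ` into multiplication by `λ / (1 - λ)`. -/
theorem one_sub_Nop_mul_HtoLc :
    (1 - Nop r n) * (HtoLc r n * Nop r n) = Nop r n * HtoLc r n := by
  ext1 H
  refine ext_coord fun i hi => ?_
  have h : coord (HtoL r n (Nop r n H)) i =
      coord (Nop r n (HtoL r n (Nop r n H))) i + coord (Nop r n (HtoL r n H)) i := by
    rw [coord_HtoL _ hi, coord_Nop, coord_Nop]
    rcases i with _ | i
    · simp [coord_Nop]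
    · rw [if_pos ⟨by omega, hi⟩, if_pos ⟨by omega, hi⟩, Nat.add_sub_cancel,
        coord_HtoL _ (by omega), coord_HtoL _ (by omega), Finset.sum_range_succ']
      have e0 : coord (Nop r n H) 0 = 0 := by simp [coord_Nop]
      have e1 : ∀ l ∈ Finset.range (i + 1), coord (Nop r n H) (l + 1) = coord H l := by
        intro l hl
        have hl' : l < i + 1 := by simpa using hl
        rw [coord_Nop, if_pos ⟨by omega, by omega⟩, Nat.add_sub_cancel]
      have e2 : ∑ l ∈ Finset.range (i + 1), (i.choose l : ℂ) • coord (Nop r n H) l =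
          ∑ l ∈ Finset.range (i + 1), (i.choose (l + 1) : ℂ) • coord H l := by
        rw [Finset.sum_range_succ', Finset.sum_range_succ, e0]
        simp only [smul_zero, add_zero, Nat.choose_succ_self, Nat.cast_zero, zero_smul]
        refine Finset.sum_congr rfl fun l hl => ?_
        rw [e1 l (Finset.mem_range.2 (by have := Finset.mem_range.1 hl; omega))]
      rw [e0, smul_zero, add_zero, e2, ← Finset.sum_add_distrib]
      refine Finset.sum_congr rfl fun l hl => ?_
      rw [e1 l hl, ← add_smul, Nat.choose_succ_succ]
      push_cast
      rw [add_comm]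
  change coord (HtoL r n (Nop r n H) - Nop r n (HtoL r n (Nop r n H))) i =
    coord (Nop r n (HtoL r n H)) i
  rw [sub_eq_add_neg, coord_add, ← neg_one_smul ℂ, coord_smul, h]
  simp

theorem commute_HtoLc_diagOp (a : EndCn n) : Commute (HtoLc r n) (diagOp r n a) := by
  ext1 v
  refine ext_coord fun i hi => ?_
  change coord (HtoL r n (diagOp r n a v)) i = coord (diagOp r n a (HtoL r n v)) i
  rw [coord_diagOp, coord_HtoL _ hi, coord_HtoL _ hi, map_sum]
  refine Finset.sum_congr rfl fun l _ => ?_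
  rw [coord_diagOp, map_smul]

/-- The change of parameter carries `∏ (π_j + μ)` to `∏ (π_j + λ π_j^⊥)`, up to a unit. -/
theorem one_sub_Nop_pow_mul (P : ℕ → EndCn n) (i : ℕ) :
    (1 - Nop r n) ^ i * (HtoLc r n * muOp r P i) = laOp r P i * HtoLc r n := by
  induction i with
  | zero => simp [muOp, laOp]
  | succ i ih =>
    have hc : ∀ a, Commute (1 - Nop r n) (diagOp r n a) := fun a =>
      (Commute.one_left _).sub_left (commute_Nop_diagOp a)
    have hc1 : Commute (1 - Nop r n) (Nop r n) := (Commute.one_left _).sub_left rfl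
    have hc2 : Commute (1 - Nop r n) (laOp r P i) := by
      clear ih
      induction i with
      | zero => exact Commute.one_right _
      | succ i ih => exact ih.mul_right ((hc _).add_right (hc1.mul_right (hc _)))
    have h1 : (1 - Nop r n) * (HtoLc r n * (diagOp r n (P i) + Nop r n)) =
        (diagOp r n (P i) + Nop r n * diagOp r n (1 - P i)) * HtoLc r n := by
      have e1 := one_sub_Nop_mul_HtoLc (r := r) (n := n)
      have e2 := (commute_HtoLc_diagOp (r := r) (P i)).eq
      rw [mul_add, mul_add, e1, e2, map_sub, diagOp_one]
      simp only [sub_mul, one_mul, mul_sub, mul_one, add_mul, mul_assoc]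
      abel
    calc (1 - Nop r n) ^ (i + 1) * (HtoLc r n * muOp r P (i + 1))
        = (1 - Nop r n) * ((1 - Nop r n) ^ i * (HtoLc r n * muOp r P i)) *
            (diagOp r n (P i) + Nop r n) := by
          rw [pow_succ', muOp]; simp only [mul_assoc]
      _ = laOp r P i * ((1 - Nop r n) * (HtoLc r n * (diagOp r n (P i) + Nop r n))) := by
          rw [ih, ← mul_assoc, hc2.eq]; simp only [mul_assoc]
      _ = _ := by rw [h1, laOp]; simp only [mul_assoc]

theorem mem_of_one_sub_Nop_pow_mem {S : Submodule ℂ (Crn r n)}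
    (hS : ∀ y ∈ S, Nop r n y ∈ S) (k : ℕ) {y : Crn r n} (hy : ((1 - Nop r n) ^ k) y ∈ S) :
    y ∈ S := by
  induction k with
  | zero => simpa using hy
  | succ k ih =>
    rw [pow_succ', clm_mul_apply] at hy
    refine ih (mem_of_add_mem (K := -Nop r n) (m := r) ?_ ?_ ?_)
    · rw [neg_pow (Nop r n), Nop_pow_eq_zero le_rfl, mul_zero]
    · intro z hz
      exact S.neg_mem (hS z hz)
    · simpa [sub_eq_add_neg] using hy

theorem one_sub_Nop_pow_injective (j : ℕ) : Function.Injective ((1 - Nop r n : OpV r n) ^ j) := by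
  intro x y hxy
  have h0 : ((1 - Nop r n) ^ j) (x - y) ∈ (⊥ : Submodule ℂ (Crn r n)) := by
    rw [map_sub, hxy, sub_self]; exact Submodule.zero_mem _
  have := mem_of_one_sub_Nop_pow_mem (S := ⊥) (by simp) j h0
  exact sub_eq_zero.1 (by simpa using this)

theorem commute_Nop_laOp (P : ℕ → EndCn n) (i : ℕ) : Commute (Nop r n) (laOp r P i) := by
  induction i with
  | zero => exact Commute.one_right _
  | succ i ih =>
    exact ih.mul_right ((commute_Nop_diagOp _).add_right
      (Commute.mul_right rfl (commute_Nop_diagOp _)))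

/-- The change of parameter carries the image of `∏ (π_j + μ)` to that of `∏ (π_j + λ π_j^⊥)`. -/
theorem map_HtoL_range_muOp (P : ℕ → EndCn n) (i : ℕ) :
    (rg (muOp r P i)).map (HtoL r n) = rg (laOp r P i) := by
  have hN : ∀ y ∈ rg (laOp r P i), Nop r n y ∈ rg (laOp r P i) := by
    rintro _ ⟨u, rfl⟩
    refine ⟨Nop r n u, ?_⟩
    change (laOp r P i * Nop r n) u = (Nop r n * laOp r P i) u
    rw [(commute_Nop_laOp P i).eq]
  have key : ∀ u, ((1 - Nop r n) ^ i) (HtoL r n (muOp r P i u)) = laOp r P i (HtoL r n u) := by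
    intro u
    exact DFunLike.congr_fun (one_sub_Nop_pow_mul (r := r) P i) u
  have hle : (rg (muOp r P i)).map (HtoL r n) ≤ rg (laOp r P i) := by
    rintro _ ⟨_, ⟨u, rfl⟩, rfl⟩
    refine mem_of_one_sub_Nop_pow_mem hN i ?_
    change ((1 - Nop r n) ^ i) (HtoL r n (muOp r P i u)) ∈ _
    rw [key]
    exact ⟨_, rfl⟩
  refine le_antisymm hle ?_
  -- `HtoL` is onto, so the dimension of `laOp(ℂʳⁿ)` is at most that of the left-hand side
  have hrange : rg (laOp r P i) ≤ ((rg (muOp r P i)).map (HtoL r n)).map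
      (((1 - Nop r n : OpV r n) ^ i : OpV r n) : Crn r n →ₗ[ℂ] Crn r n) := by
    rintro _ ⟨u, rfl⟩
    obtain ⟨w, rfl⟩ := (HtoLe r n).surjective u
    exact ⟨_, ⟨_, ⟨w, rfl⟩, rfl⟩, key w⟩
  refine (Submodule.eq_of_le_of_finrank_le hle ?_).ge
  exact (Submodule.finrank_mono hrange).trans (Submodule.finrank_map_le _ _)

/-! ### Coefficients of the loop `(π_1 + λ π_1^⊥) ⋯ (π_i + λ π_i^⊥)` -/

/-- The coefficient of `λᵏ` in `(π_1 + λ π_1^⊥) ⋯ (π_i + λ π_i^⊥)`. -/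
def loopCoeff {n : ℕ} (P : ℕ → EndCn n) : ℕ → ℕ → EndCn n
  | 0, 0 => 1
  | 0, _ + 1 => 0
  | i + 1, 0 => loopCoeff P i 0 * P i
  | i + 1, k + 1 => loopCoeff P i (k + 1) * P i + loopCoeff P i k * (1 - P i)

theorem loopCoeff_eq_zero (P : ℕ → EndCn n) {i k : ℕ} (h : i < k) : loopCoeff P i k = 0 := by
  induction i generalizing k with
  | zero =>
    obtain ⟨k, rfl⟩ : ∃ t, k = t + 1 := ⟨k - 1, by omega⟩
    rfl
  | succ i ih =>
    obtain ⟨k, rfl⟩ : ∃ t, k = t + 1 := ⟨k - 1, by omega⟩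
    rw [loopCoeff, ih (by omega), ih (by omega)]
    simp

theorem prod_eq_sum_loopCoeff (P : ℕ → EndCn n) (c : ℂ) (i : ℕ) :
    (List.ofFn fun j : Fin i => P j + c • (1 - P j)).prod =
      ∑ k ∈ Finset.range (i + 1), c ^ k • loopCoeff P i k := by
  induction i with
  | zero => simp [loopCoeff]
  | succ i ih =>
    rw [prod_ofFn_succ (fun j => P j + c • (1 - P j)), ih, Finset.sum_range_succ' _ (i + 1)]
    simp only [loopCoeff, smul_add, Finset.sum_add_distrib, mul_add]
    have h1 : ∑ k ∈ Finset.range (i + 1), c ^ (k + 1) • (loopCoeff P i (k + 1) * P i) +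
        c ^ 0 • (loopCoeff P i 0 * P i) =
        (∑ k ∈ Finset.range (i + 1), c ^ k • loopCoeff P i k) * P i := by
      rw [← Finset.sum_range_succ' (fun k => c ^ k • (loopCoeff P i k * P i)) (i + 1),
        Finset.sum_range_succ, loopCoeff_eq_zero P (Nat.lt_succ_self i), Finset.sum_mul]
      simp [smul_mul_assoc]
    rw [← h1, Finset.sum_mul]
    simp only [pow_succ, mul_smul, smul_mul_assoc, mul_smul_comm, smul_comm c]
    abel

/-- The components of `laOp v` are those of the product of the loop with the polynomial `v`. -/
theorem coord_laOp (P : ℕ → EndCn n) (i : ℕ) (v : Crn r n) {m : ℕ} (hm : m < r) :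
    coord (laOp r P i v) m =
      ∑ k ∈ Finset.range (m + 1), loopCoeff P i k (coord v (m - k)) := by
  induction i generalizing v with
  | zero =>
    rw [Finset.sum_range_succ']
    simp [laOp, loopCoeff]
  | succ i ih =>
    have h1 : laOp r P (i + 1) v =
        laOp r P i (diagOp r n (P i) v + Nop r n (diagOp r n (1 - P i) v)) := rfl
    rw [h1, ih, Finset.sum_range_succ']
    rw [Finset.sum_range_succ' (fun k => loopCoeff P (i + 1) k (coord v (m - k)))]
    simp only [coord_add, coord_diagOp, coord_Nop, loopCoeff, map_add, Finset.sum_add_distrib,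
      _root_.add_apply, clm_mul_apply, Nat.sub_zero]
    have h2 : ∑ k ∈ Finset.range m, loopCoeff P i (k + 1)
          (if 1 ≤ m - (k + 1) ∧ m - (k + 1) < r then (1 - P i) (coord v (m - (k + 1) - 1)) else 0) +
        loopCoeff P i 0 (if 1 ≤ m ∧ m < r then (1 - P i) (coord v (m - 1)) else 0) =
        ∑ k ∈ Finset.range m, loopCoeff P i k ((1 - P i) (coord v (m - (k + 1)))) := by
      have h3 := Finset.sum_range_succ' (fun k => loopCoeff P i k
          (if 1 ≤ m - k ∧ m - k < r then (1 - P i) (coord v (m - k - 1)) else 0)) m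
      simp only [Nat.sub_zero] at h3
      rw [← h3,
        Finset.sum_range_succ]
      have h4 : (if 1 ≤ m - m ∧ m - m < r then (1 - P i) (coord v (m - m - 1)) else 0) = 0 :=
        if_neg (by omega)
      rw [h4, map_zero, add_zero]
      refine Finset.sum_congr rfl fun k hk => ?_
      have hk' : k < m := Finset.mem_range.1 hk
      rw [if_pos ⟨by omega, by omega⟩, Nat.sub_sub]
    rw [← h2]
    abel

end HtoL

/-! ### Spans of finitely many holomorphic functions -/

section Germs

variable {V : Type*} [NormedAddCommGroup V] [NormedSpace ℂ V] [CompleteSpace V]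
variable {W : Type*} [NormedAddCommGroup W] [NormedSpace ℂ W] [CompleteSpace W]

theorem analyticAt_clm_apply {A : ℂ → V →L[ℂ] W} {f : ℂ → V} {w : ℂ} (hA : AnalyticAt ℂ A w)
    (hf : AnalyticAt ℂ f w) : AnalyticAt ℂ (fun z => A z (f z)) w := by
  rw [Complex.analyticAt_iff_eventually_differentiableAt] at *
  filter_upwards [hA, hf] with z h1 h2 using h1.clm_apply h2

theorem _root_.AnalyticAt.clmComp {f : ℂ → V} {w : ℂ} (hf : AnalyticAt ℂ f w) (L : V →L[ℂ] W) :
    AnalyticAt ℂ (fun z => L (f z)) w :=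
  analyticAt_clm_apply analyticAt_const hf

theorem eventually_nhds_of_punctured_eq {V : Type*} [TopologicalSpace V] [T2Space V]
    {f g : ℂ → V} {w : ℂ} (hf : ContinuousAt f w)
    (hg : ContinuousAt g w) (h : ∀ᶠ z in 𝓝[≠] w, f z = g z) : ∀ᶠ z in 𝓝 w, f z = g z :=
  (hf.eventuallyEq_nhds_iff_eventuallyEq_nhdsNE hg).1 h

/-- The span of finitely many holomorphic functions of one variable agrees, away from the centre,
with the range of a holomorphic family of projections that is also defined at the centre.  In the
inductive step the component of the new function that the projection misses is divided by the
largest possible power of `z - w`. -/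
theorem exists_analytic_projection {w : ℂ} (S : Set (ℂ → V)) (hfin : S.Finite)
    (hS : ∀ v ∈ S, AnalyticAt ℂ v w) :
    ∃ E : ℂ → V →L[ℂ] V, AnalyticAt ℂ E w ∧ (∀ᶠ z in 𝓝 w, E z * E z = E z) ∧
      ∀ᶠ z in 𝓝[≠] w, LinearMap.range (E z : V →ₗ[ℂ] V) =
        Submodule.span ℂ ((fun v : ℂ → V => v z) '' S) := by
  induction S, hfin using Set.Finite.induction_on with
  | empty =>
    refine ⟨fun _ => 0, analyticAt_const, by simp, ?_⟩
    simp
  | @insert v S hv hfin ih =>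
    obtain ⟨E, hE, hidem, hspan⟩ := ih fun u hu => hS u (Set.mem_insert_of_mem _ hu)
    have hva : AnalyticAt ℂ v w := hS v (Set.mem_insert _ _)
    have hx : AnalyticAt ℂ (fun z => v z - E z (v z)) w := hva.sub (analyticAt_clm_apply hE hva)
    have hins : ∀ z, Submodule.span ℂ ((fun u : ℂ → V => u z) '' insert v S) =
        Submodule.span ℂ {v z} ⊔ Submodule.span ℂ ((fun u : ℂ → V => u z) '' S) := by
      intro z
      rw [Set.image_insert_eq, Submodule.span_insert]
    by_cases hzero : ∀ᶠ z in 𝓝 w, v z - E z (v z) = 0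
    · refine ⟨E, hE, hidem, ?_⟩
      filter_upwards [hspan, hzero.filter_mono nhdsWithin_le_nhds] with z h1 h2
      rw [hins, ← h1, eq_comm, sup_eq_right, Submodule.span_singleton_le_iff_mem]
      exact ⟨v z, (sub_eq_zero.1 h2).symm⟩
    · obtain ⟨k, y, hy, hy0, hxy⟩ := (hx.exists_eventuallyEq_pow_smul_nonzero_iff).2 hzero
      -- `E` kills `v - E v`, hence also the quotient `y` by a power of `z - w`
      have hEy : ∀ᶠ z in 𝓝 w, E z (y z) = 0 := by
        refine eventually_nhds_of_punctured_eq (analyticAt_clm_apply hE hy).continuousAt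
          continuousAt_const ?_
        filter_upwards [self_mem_nhdsWithin, hxy.filter_mono nhdsWithin_le_nhds,
          hidem.filter_mono nhdsWithin_le_nhds] with z hz h1 h2
        have hz' : (z - w) ^ k ≠ 0 := pow_ne_zero _ (sub_ne_zero.2 hz)
        have h3 : (z - w) ^ k • E z (y z) = 0 := by
          rw [← map_smul, ← h1, map_sub, ← clm_mul_apply, h2, sub_self]
        exact (smul_eq_zero.1 h3).resolve_left hz'
      obtain ⟨l, hl⟩ := SeparatingDual.exists_ne_zero (R := ℂ) hy0
      have hly : ∀ᶠ z in 𝓝 w, l (y z) ≠ 0 := (hy.clmComp l).continuousAt.eventually_ne hl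
      -- the projection onto the line of `y z` along the kernel of a functional `l`
      let K : ℂ → V →L[ℂ] V := fun z =>
        ContinuousLinearMap.smulRightL ℂ V V l ((l (y z))⁻¹ • y z)
      have hK : AnalyticAt ℂ K w :=
        (((hy.clmComp l).inv hl).smul hy).clmComp (ContinuousLinearMap.smulRightL ℂ V V l)
      have hKx : ∀ z x, K z x = l x • (l (y z))⁻¹ • y z := fun z x => rfl
      refine ⟨fun z => E z + K z * (1 - E z), hE.add (hK.mul (analyticAt_const.sub hE)), ?_, ?_⟩
      · filter_upwards [hidem, hEy, hly] with z h1 h2 h3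
        have e1 : E z * K z = 0 := by
          ext1 x
          rw [clm_mul_apply, hKx, map_smul, map_smul, h2]
          simp
        have e2 : K z * K z = K z := by
          ext1 x
          rw [clm_mul_apply, hKx z x, map_smul, map_smul, hKx z (y z), smul_smul (l (y z)),
            mul_inv_cancel₀ h3, one_smul]
        have e3 : (1 - E z) * E z = 0 := by rw [sub_mul, h1, one_mul, sub_self]
        have e4 : (1 - E z) * K z = K z := by rw [sub_mul, e1, one_mul, sub_zero]
        have e5 : E z * (K z * (1 - E z)) = 0 := by rw [← mul_assoc, e1, zero_mul]
        have e6 : K z * (1 - E z) * E z = 0 := by rw [mul_assoc, e3, mul_zero]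
        have e7 : K z * (1 - E z) * (K z * (1 - E z)) = K z * (1 - E z) := by
          rw [mul_assoc, ← mul_assoc (1 - E z), e4, ← mul_assoc, e2]
        rw [add_mul, mul_add, mul_add, h1, e5, e6, e7, add_zero, zero_add]
      · filter_upwards [self_mem_nhdsWithin, hspan, hxy.filter_mono nhdsWithin_le_nhds,
          hidem.filter_mono nhdsWithin_le_nhds, hEy.filter_mono nhdsWithin_le_nhds,
          hly.filter_mono nhdsWithin_le_nhds] with z hz h1 h2 h3 h4 h5
        have hz' : (z - w) ^ k ≠ 0 := pow_ne_zero _ (sub_ne_zero.2 hz)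
        have hyv : y z = ((z - w) ^ k)⁻¹ • (v z - E z (v z)) := by
          rw [h2, smul_smul, inv_mul_cancel₀ hz', one_smul]
        have hvy : v z = (z - w) ^ k • y z + E z (v z) := by rw [← h2]; abel
        rw [hins, ← h1]
        apply le_antisymm
        · rintro _ ⟨x, rfl⟩
          change E z x + K z (x - E z x) ∈ _
          refine Submodule.add_mem _ (Submodule.mem_sup_right ⟨x, rfl⟩) ?_
          rw [hKx]
          refine Submodule.smul_mem _ _ (Submodule.smul_mem _ _ ?_)
          rw [hyv]
          refine Submodule.smul_mem _ _ (Submodule.sub_mem _ ?_ (Submodule.mem_sup_right ⟨_, rfl⟩))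
          exact Submodule.mem_sup_left (Submodule.mem_span_singleton_self _)
        · have hEr : ∀ x, E z x ∈
              LinearMap.range ((E z + K z * (1 - E z) : V →L[ℂ] V) : V →ₗ[ℂ] V) := by
            intro x
            refine ⟨E z x, ?_⟩
            change E z (E z x) + K z (E z x - E z (E z x)) = E z x
            rw [← clm_mul_apply, h3, sub_self, map_zero, add_zero]
          have hyr : y z ∈
              LinearMap.range ((E z + K z * (1 - E z) : V →L[ℂ] V) : V →ₗ[ℂ] V) := by
            refine ⟨y z, ?_⟩
            change E z (y z) + K z (y z - E z (y z)) = y z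
            rw [h4, sub_zero, zero_add, hKx, smul_smul, mul_inv_cancel₀ h5, one_smul]
          refine sup_le ?_ ?_
          · rw [Submodule.span_singleton_le_iff_mem, hvy]
            exact Submodule.add_mem _ (Submodule.smul_mem _ _ hyr) (hEr _)
          · rintro _ ⟨x, rfl⟩
            exact hEr x

/-- Chain rule and Leibniz rule, up to the exact coefficients: the derivatives of
`∑ f_l • (g_l ∘ τ)` of order at most `j` are combinations of those of the `g_l`. -/
theorem iteratedDeriv_mem_span {ι : Type} [Fintype ι] {z : ℂ} {τ : ℂ → ℂ}
    (hτ : AnalyticAt ℂ τ z) (f : ι → ℂ → ℂ) (hf : ∀ l, AnalyticAt ℂ (f l) z)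
    (g : ι → ℂ → V) (hg : ∀ l, AnalyticAt ℂ (g l) (τ z)) (u : ℂ → V)
    (hu : ∀ᶠ x in 𝓝 z, u x = ∑ l, f l x • g l (τ x)) (j : ℕ) :
    iteratedDeriv j u z ∈
      Submodule.span ℂ {v | ∃ l, ∃ j' ≤ j, v = iteratedDeriv j' (g l) (τ z)} := by
  induction j generalizing ι u with
  | zero =>
    rw [iteratedDeriv_zero, hu.self_of_nhds]
    refine Submodule.sum_mem _ fun l _ => Submodule.smul_mem _ _ (Submodule.subset_span ?_)
    exact ⟨l, 0, le_rfl, by simp⟩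
  | succ j ih =>
    rw [iteratedDeriv_succ']
    have hev : ∀ᶠ x in 𝓝 z, ∀ l, DifferentiableAt ℂ (f l) x ∧ DifferentiableAt ℂ (g l) (τ x) := by
      rw [eventually_all]
      intro l
      have h1 := Complex.analyticAt_iff_eventually_differentiableAt.1 (hf l)
      have h2 := hτ.continuousAt.eventually
        (Complex.analyticAt_iff_eventually_differentiableAt.1 (hg l))
      exact h1.and h2
    have hτ' := Complex.analyticAt_iff_eventually_differentiableAt.1 hτ
    have hder : ∀ᶠ x in 𝓝 z, deriv u x =
        ∑ l : ι ⊕ ι, Sum.elim (fun l x => deriv (f l) x) (fun l x => f l x * deriv τ x) l x •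
          Sum.elim g (fun l => deriv (g l)) l (τ x) := by
      filter_upwards [hu.eventually_nhds, hev, hτ'] with x h1 h2 h3
      have h4 : u =ᶠ[𝓝 x] fun x => ∑ l, f l x • g l (τ x) := h1
      rw [h4.deriv_eq, Fintype.sum_sum_type]
      simp only [Sum.elim_inl, Sum.elim_inr]
      have h7 : HasDerivAt (fun x => ∑ l, f l x • g l (τ x))
          (∑ l, (f l x • (deriv τ x • deriv (g l) (τ x)) + deriv (f l) x • g l (τ x))) x := by
        refine HasDerivAt.fun_sum fun l _ => (h2 l).1.hasDerivAt.smul ?_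
        exact HasDerivAt.scomp x (h2 l).2.hasDerivAt h3.hasDerivAt
      rw [h7.deriv, ← Finset.sum_add_distrib]
      refine Finset.sum_congr rfl fun l _ => ?_
      rw [smul_smul]
      abel
    have h := ih (ι := ι ⊕ ι) _ (by
        rintro (l | l)
        · exact (hf l).deriv
        · exact (hf l).mul hτ.deriv) _ (by
        rintro (l | l)
        · exact hg l
        · exact (hg l).deriv) (deriv u) hder
    refine Submodule.span_mono ?_ h
    rintro _ ⟨l | l, j', hj', rfl⟩
    · exact ⟨l, j', by omega, rfl⟩
    · exact ⟨l, j' + 1, by omega, by rw [iteratedDeriv_succ']; rfl⟩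

end Germs

/-! ### Charts, and families of subspaces with holes filled in -/

section Families

variable {M : Type*} [TopologicalSpace M]
variable {V : Type*} [NormedAddCommGroup V] [NormedSpace ℂ V]
variable {W : Type*} [NormedAddCommGroup W] [NormedSpace ℂ W]

theorem eventually_nhds_chart (e : OpenPartialHomeomorph M ℂ) {w : ℂ} (hw : w ∈ e.target)
    (P : M → Prop) : (∀ᶠ z in 𝓝 w, P (e.symm z)) ↔ ∀ᶠ q in 𝓝 (e.symm w), P q :=
  (e.symm.eventually_nhds P hw).symm

theorem eventually_punctured_chart (e : OpenPartialHomeomorph M ℂ) {w : ℂ} (hw : w ∈ e.target)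
    (P : M → Prop) : (∀ᶠ z in 𝓝[≠] w, P (e.symm z)) ↔ ∀ᶠ q in 𝓝[≠] (e.symm w), P q := by
  rw [← e.symm.eventually_nhdsWithin P (s := {w}ᶜ) hw]
  have h : 𝓝[e.symm.symm ⁻¹' {w}ᶜ] (e.symm w) = 𝓝[≠] (e.symm w) := by
    rw [nhdsWithin_eq_iff_eventuallyEq]
    filter_upwards [e.open_source.mem_nhds (e.map_target hw)] with q hq
    refine propext (not_congr ?_)
    change e q = w ↔ q = e.symm w
    exact ⟨fun h => by rw [← h, e.left_inv hq], fun h => by rw [h, e.right_inv hw]⟩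
  rw [h]

theorem eventually_target {e : OpenPartialHomeomorph M ℂ} {w : ℂ} (hw : w ∈ e.target) :
    ∀ᶠ z in 𝓝 w, z ∈ e.target := e.open_target.mem_nhds hw

theorem eventually_codiscrete_iff {P : M → Prop} :
    (∀ᶠ q in codiscrete M, P q) ↔ ∀ p, ∀ᶠ q in 𝓝[≠] p, P q := by
  rw [Filter.Eventually, mem_codiscrete]
  refine forall_congr' fun p => ?_
  rw [disjoint_principal_right, compl_compl]
  rfl

theorem fill_mono {β γ : M → Submodule ℂ V} {p : M} (h : ∀ᶠ q in 𝓝[≠] p, β q ≤ γ q) :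
    fill β p ≤ fill γ p := by
  rintro v ⟨σ, hσ, hv⟩
  exact ⟨σ, by filter_upwards [h, hσ] with q h1 h2 using h1 h2, hv⟩

theorem fill_congr {β γ : M → Submodule ℂ V} {p : M} (h : ∀ᶠ q in 𝓝[≠] p, β q = γ q) :
    fill β p = fill γ p :=
  le_antisymm (fill_mono (h.mono fun _ h => h.le)) (fill_mono (h.mono fun _ h => h.ge))

theorem map_fill_le (L : V →L[ℂ] W) (β : M → Submodule ℂ V) (p : M) :
    (fill β p).map (L : V →ₗ[ℂ] W) ≤ fill (fun q => (β q).map (L : V →ₗ[ℂ] W)) p := by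
  rintro _ ⟨v, ⟨σ, hσ, hv⟩, rfl⟩
  exact ⟨fun q => L (σ q), hσ.mono fun q hq => ⟨_, hq, rfl⟩, (L.continuous.tendsto v).comp hv⟩

theorem fill_map_equiv (L : V ≃L[ℂ] W) (β : M → Submodule ℂ V) (p : M) :
    fill (fun q => (β q).map (L : V →ₗ[ℂ] W)) p = (fill β p).map (L : V →ₗ[ℂ] W) := by
  refine le_antisymm ?_ (map_fill_le (L : V →L[ℂ] W) β p)
  rintro v ⟨σ, hσ, hv⟩
  refine ⟨L.symm v, ⟨fun q => L.symm (σ q), ?_, (L.symm.continuous.tendsto v).comp hv⟩, by simp⟩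
  filter_upwards [hσ] with q hq
  obtain ⟨u, hu, h⟩ := hq
  have h' : σ q = L u := h.symm
  rw [h', L.symm_apply_apply]
  exact hu

theorem comp_chart_eventuallyEq {e e' : OpenPartialHomeomorph M ℂ} {z : ℂ}
    (hz : z ∈ e.target) (hz' : e.symm z ∈ e'.source) {X : Type*} (f : M → X) :
    f ∘ e.symm =ᶠ[𝓝 z] (f ∘ e'.symm) ∘ (e' ∘ e.symm) := by
  filter_upwards [(eventually_nhds_chart e hz (· ∈ e'.source)).2
    (e'.open_source.mem_nhds hz')] with x hx'
  simp only [Function.comp_apply, e'.left_inv hx']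

variable [ChartedSpace ℂ M]

/-- A statement that holds near each point of a punctured neighbourhood. -/
theorem eventually_punctured_nhds {X : Type*} [TopologicalSpace X] [T1Space X] {w : X}
    {P : X → Prop} (h : ∀ᶠ z in 𝓝[≠] w, P z) : ∀ᶠ z in 𝓝[≠] w, ∀ᶠ x in 𝓝 z, P x := by
  have h1 := eventually_eventually_nhdsWithin.2 h
  filter_upwards [h1, self_mem_nhdsWithin] with z h2 h3
  rwa [isOpen_compl_singleton.nhdsWithin_eq h3] at h2

variable (M) in
theorem neBot_punctured (p : M) : (𝓝[≠] p).NeBot := by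
  have h := eventually_punctured_chart (chartAt ℂ p) (mem_chart_target ℂ p) (fun _ => False)
  rw [(chartAt ℂ p).left_inv (mem_chart_source ℂ p)] at h
  rw [neBot_iff, Ne, ← Filter.eventually_false_iff_eq_bot, ← h, Filter.eventually_false_iff_eq_bot]
  exact NeBot.ne inferInstance

theorem analyticAt_transition [IsManifold 𝓘(ℂ) ω M] {e e' : OpenPartialHomeomorph M ℂ}
    (he : e ∈ atlas ℂ M) (he' : e' ∈ atlas ℂ M) {z : ℂ} (hz : z ∈ e.target)
    (hz' : e.symm z ∈ e'.source) : AnalyticAt ℂ (e' ∘ e.symm) z := by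
  rw [Complex.analyticAt_iff_eventually_differentiableAt]
  filter_upwards [eventually_target hz, (eventually_nhds_chart e hz (· ∈ e'.source)).2
    (e'.open_source.mem_nhds hz')] with x hx hx'
  rw [← mdifferentiableAt_iff_differentiableAt]
  exact (mdifferentiableAt_atlas (I := 𝓘(ℂ)) he' hx').comp x
    (mdifferentiableAt_atlas_symm (I := 𝓘(ℂ)) he hx)

/-- Holomorphy of a function at a point of `M` does not depend on the chart. -/
theorem analyticAt_of_chart [IsManifold 𝓘(ℂ) ω M] {e e' : OpenPartialHomeomorph M ℂ}
    (he : e ∈ atlas ℂ M) (he' : e' ∈ atlas ℂ M) {z : ℂ} (hz : z ∈ e.target)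
    (hz' : e.symm z ∈ e'.source) {f : M → V}
    (hf : AnalyticAt ℂ (f ∘ e'.symm) (e' (e.symm z))) : AnalyticAt ℂ (f ∘ e.symm) z :=
  (AnalyticAt.comp (f := e' ∘ e.symm) hf (analyticAt_transition he he' hz hz')).congr
    (comp_chart_eventuallyEq hz hz' f).symm

theorem isHolomorphicAt_iff [IsManifold 𝓘(ℂ) ω M] {e : OpenPartialHomeomorph M ℂ}
    (he : e ∈ atlas ℂ M) {z : ℂ} (hz : z ∈ e.target) {f : M → V} :
    IsHolomorphicAt f (e.symm z) ↔ AnalyticAt ℂ (f ∘ e.symm) z := by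
  have hs := mem_chart_source ℂ (e.symm z)
  constructor
  · intro h
    exact analyticAt_of_chart he (chart_mem_atlas ℂ _) hz hs h
  · intro h
    refine analyticAt_of_chart (chart_mem_atlas ℂ _) he ((chartAt ℂ (e.symm z)).map_source hs) ?_ ?_
    · rw [(chartAt ℂ (e.symm z)).left_inv hs]; exact e.map_target hz
    · rwa [(chartAt ℂ (e.symm z)).left_inv hs, e.right_inv hz]

/-- The limit of the ranges of a continuous family of projections is the range of the limit. -/
theorem fill_eq_range {β : M → Submodule ℂ V} {e : OpenPartialHomeomorph M ℂ} {w : ℂ}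
    (hw : w ∈ e.target) {E : ℂ → V →L[ℂ] V} (hE : ContinuousAt E w)
    (hidem : ∀ᶠ z in 𝓝 w, E z * E z = E z)
    (hβ : ∀ᶠ z in 𝓝[≠] w, β (e.symm z) = LinearMap.range (E z : V →ₗ[ℂ] V)) :
    fill β (e.symm w) = LinearMap.range (E w : V →ₗ[ℂ] V) := by
  have hs := e.map_target hw
  have hE' : Tendsto (fun q => E (e q)) (𝓝[≠] (e.symm w)) (𝓝 (E w)) := by
    have h1 : ContinuousAt e (e.symm w) := e.continuousAt hs
    have h2 : Tendsto e (𝓝 (e.symm w)) (𝓝 w) := by simpa [ContinuousAt, e.right_inv hw] using h1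
    exact (hE.tendsto.comp h2).mono_left nhdsWithin_le_nhds
  have happ : ∀ {σ : M → V} {v : V}, Tendsto σ (𝓝[≠] (e.symm w)) (𝓝 v) →
      Tendsto (fun q => E (e q) (σ q)) (𝓝[≠] (e.symm w)) (𝓝 (E w v)) := by
    intro σ v hv
    exact (isBoundedBilinearMap_apply.continuous.tendsto (E w, v)).comp (hE'.prodMk_nhds hv)
  have hmem : ∀ᶠ q in 𝓝[≠] (e.symm w), ∀ v, v ∈ β q ↔ E (e q) v = v := by
    rw [← eventually_punctured_chart e hw]
    filter_upwards [hβ, hidem.filter_mono nhdsWithin_le_nhds,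
      (eventually_target hw).filter_mono nhdsWithin_le_nhds] with z h1 h2 h3 v
    rw [h1, e.right_inv h3]
    constructor
    · rintro ⟨u, rfl⟩
      change E z (E z u) = E z u
      rw [← clm_mul_apply, h2]
    · intro h
      exact ⟨v, h⟩
  have := neBot_punctured M (e.symm w)
  ext v
  constructor
  · rintro ⟨σ, hσ, hv⟩
    refine ⟨v, tendsto_nhds_unique (happ hv) (hv.congr' ?_)⟩
    filter_upwards [hσ, hmem] with q h1 h2 using ((h2 _).1 h1).symm
  · rintro ⟨u, rfl⟩
    refine ⟨fun q => E (e q) u, ?_, happ tendsto_const_nhds⟩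
    rw [← eventually_punctured_chart e hw]
    filter_upwards [hβ, (eventually_target hw).filter_mono nhdsWithin_le_nhds] with z h1 h3
    rw [h1, e.right_inv h3]
    exact ⟨u, rfl⟩

/-- A family of subspaces that is, near each point and in each chart, the range of a holomorphic
family of projections. -/
def HolFam (β : M → Submodule ℂ V) : Prop :=
  ∀ e ∈ atlas ℂ M, ∀ w ∈ e.target, ∃ E : ℂ → V →L[ℂ] V, AnalyticAt ℂ E w ∧
    (∀ᶠ z in 𝓝 w, E z * E z = E z) ∧
    ∀ᶠ z in 𝓝 w, β (e.symm z) = LinearMap.range (E z : V →ₗ[ℂ] V)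

/-- A family of subspaces that is, away from each point and in each chart, the span of finitely many
functions holomorphic at that point. -/
def GenFam (β : M → Submodule ℂ V) : Prop :=
  ∀ e ∈ atlas ℂ M, ∀ w ∈ e.target, ∃ S : Set (ℂ → V), S.Finite ∧ (∀ v ∈ S, AnalyticAt ℂ v w) ∧
    ∀ᶠ z in 𝓝[≠] w, β (e.symm z) = Submodule.span ℂ ((fun v : ℂ → V => v z) '' S)

/-- Near each point, a generically spanned family becomes the range of a holomorphic family of
projections once its holes are filled in; away from the point nothing changes. -/
theorem GenFam.exists_projection [CompleteSpace V] {β : M → Submodule ℂ V} (h : GenFam β)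
    {e : OpenPartialHomeomorph M ℂ} (he : e ∈ atlas ℂ M) {w : ℂ} (hw : w ∈ e.target) :
    ∃ E : ℂ → V →L[ℂ] V, AnalyticAt ℂ E w ∧ (∀ᶠ z in 𝓝 w, E z * E z = E z) ∧
      (∀ᶠ z in 𝓝 w, fill β (e.symm z) = LinearMap.range (E z : V →ₗ[ℂ] V)) ∧
      ∀ᶠ z in 𝓝[≠] w, β (e.symm z) = LinearMap.range (E z : V →ₗ[ℂ] V) := by
  obtain ⟨S, hfin, hS, hspan⟩ := h e he w hw
  obtain ⟨E, hE, hidem, hEs⟩ := exists_analytic_projection S hfin hS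
  have hβ : ∀ᶠ z in 𝓝[≠] w, β (e.symm z) = LinearMap.range (E z : V →ₗ[ℂ] V) := by
    filter_upwards [hspan, hEs] with z h1 h2
    rw [h1, h2]
  refine ⟨E, hE, hidem, ?_, hβ⟩
  -- the formula for the fibres of `fill β` holds at `w` and at all points near `w`
  have hβ' : ∀ᶠ z in 𝓝 w, ∀ᶠ x in 𝓝[≠] z, β (e.symm x) = LinearMap.range (E x : V →ₗ[ℂ] V) := by
    have h1 := eventually_punctured_nhds hβ
    rw [eventually_nhdsWithin_iff] at h1
    filter_upwards [h1] with z h2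
    by_cases hz : z = w
    · rw [hz]; exact hβ
    · exact (h2 hz).filter_mono nhdsWithin_le_nhds
  filter_upwards [hβ', eventually_target hw, hidem.eventually_nhds, hE.eventually_analyticAt]
    with z h1 h2 h3 h4
  exact fill_eq_range h2 h4.continuousAt h3 h1

theorem GenFam.holFam_fill [CompleteSpace V] {β : M → Submodule ℂ V} (h : GenFam β) :
    HolFam (fill β) := by
  intro e he w hw
  obtain ⟨E, h1, h2, h3, -⟩ := h.exists_projection he hw
  exact ⟨E, h1, h2, h3⟩

/-- Filling in holes changes a generically spanned family only on a discrete set. -/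
theorem GenFam.fill_eq [CompleteSpace V] {β : M → Submodule ℂ V} (h : GenFam β) (p : M) :
    ∀ᶠ q in 𝓝[≠] p, fill β q = β q := by
  have hw := mem_chart_target ℂ p
  obtain ⟨E, -, -, h3, h4⟩ := h.exists_projection (chart_mem_atlas ℂ p) hw
  have h5 : ∀ᶠ z in 𝓝[≠] (chartAt ℂ p p),
      fill β ((chartAt ℂ p).symm z) = β ((chartAt ℂ p).symm z) := by
    filter_upwards [h3.filter_mono nhdsWithin_le_nhds, h4] with z h6 h7
    rw [h6, h7]
  rw [eventually_punctured_chart _ hw (fun q => fill β q = β q),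
    (chartAt ℂ p).left_inv (mem_chart_source ℂ p)] at h5
  exact h5

theorem GenFam.sup {β γ : M → Submodule ℂ V} (h1 : GenFam β) (h2 : GenFam γ) :
    GenFam fun q => β q ⊔ γ q := by
  intro e he w hw
  obtain ⟨S, hS, ha, hs⟩ := h1 e he w hw
  obtain ⟨T, hT, hb, ht⟩ := h2 e he w hw
  refine ⟨S ∪ T, hS.union hT, ?_, ?_⟩
  · rintro v (hv | hv)
    · exact ha v hv
    · exact hb v hv
  · filter_upwards [hs, ht] with z h3 h4
    rw [h3, h4, Set.image_union, Submodule.span_union]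

theorem GenFam.map [CompleteSpace V] [CompleteSpace W] {β : M → Submodule ℂ V} (h : GenFam β)
    (L : V →L[ℂ] W) : GenFam fun q => (β q).map (L : V →ₗ[ℂ] W) := by
  intro e he w hw
  obtain ⟨S, hS, ha, hs⟩ := h e he w hw
  refine ⟨(fun v z => L (v z)) '' S, hS.image _, ?_, ?_⟩
  · rintro _ ⟨v, hv, rfl⟩
    exact (ha v hv).clmComp L
  · filter_upwards [hs] with z h1
    rw [h1, ← Submodule.span_image, Set.image_image, Set.image_image]
    rfl

theorem genFam_const [FiniteDimensional ℂ V] (A : Submodule ℂ V) : GenFam fun _ : M => A := by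
  intro e _ w _
  obtain ⟨s, hs⟩ := IsNoetherian.noetherian A
  refine ⟨(fun x _ => x) '' (s : Set V), s.finite_toSet.image _, ?_, ?_⟩
  · rintro _ ⟨v, _, rfl⟩
    exact analyticAt_const
  · refine Eventually.of_forall fun z => ?_
    rw [Set.image_image, Set.image_id', hs]

theorem GenFam.iSup [FiniteDimensional ℂ V] {k : ℕ} {β : ℕ → M → Submodule ℂ V}
    (h : ∀ i < k, GenFam (β i)) : GenFam fun q => ⨆ i : Fin k, β i q := by
  induction k with
  | zero =>
    have : (fun q : M => ⨆ i : Fin 0, β i q) = fun _ => ⊥ := by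
      funext q; simp
    rw [this]
    exact genFam_const ⊥
  | succ k ih =>
    have : (fun q : M => ⨆ i : Fin (k + 1), β i q) = fun q => (⨆ i : Fin k, β i q) ⊔ β k q := by
      funext q
      apply le_antisymm
      · refine iSup_le fun i => ?_
        by_cases hi : (i : ℕ) < k
        · exact le_sup_of_le_left (le_iSup (fun i : Fin k => β i q) ⟨i, hi⟩)
        · have : (i : ℕ) = k := by omega
          rw [this]
          exact le_sup_right
      · refine sup_le (iSup_le fun i => ?_) ?_
        · exact le_iSup (fun i : Fin (k + 1) => β i q) i.castSucc
        · exact le_iSup (fun i : Fin (k + 1) => β i q) (Fin.last k)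
    rw [this]
    exact (ih fun i hi => h i (by omega)).sup (h k (by omega))

/-- A holomorphic family of projections gives a holomorphic frame of its range near each point. -/
theorem HolFam.isHolomorphicSubbundle [IsManifold 𝓘(ℂ) ω M] [FiniteDimensional ℂ V]
    {β : M → Submodule ℂ V} (h : HolFam β) : IsHolomorphicSubbundle β := by
  intro p
  have := FiniteDimensional.complete ℂ V
  set e := chartAt ℂ p
  have hp : p ∈ e.source := mem_chart_source ℂ p
  have he : e ∈ atlas ℂ M := chart_mem_atlas ℂ p
  set w := e p
  have hw : w ∈ e.target := mem_chart_target ℂ p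
  obtain ⟨E, hE, hidem, hβ⟩ := h e he w hw
  -- `U z` conjugates the projection at `w` to the one at `z`
  let U : ℂ → V →L[ℂ] V := fun z => E z * E w + (1 - E z) * (1 - E w)
  have hidw := hidem.self_of_nhds
  have hU1 : U w = 1 := by
    simp only [U, sub_mul, mul_sub, hidw, one_mul, mul_one]
    abel
  have hUc : ContinuousAt U w := by
    have := hE.continuousAt
    exact (this.mul continuousAt_const).add ((continuousAt_const.sub this).mul continuousAt_const)
  have hunit : ∀ᶠ z in 𝓝 w, IsUnit (U z) :=
    hUc.eventually_mem (Units.isOpen.mem_nhds (by rw [hU1]; exact isUnit_one))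
  have hd : ∀ᶠ z in 𝓝 w, DifferentiableAt ℂ E z :=
    Complex.analyticAt_iff_eventually_differentiableAt.1 hE
  obtain ⟨O, hO, hOo, hwO⟩ := eventually_nhds_iff.1 (hβ.and (hidem.and (hunit.and hd)))
  let A : Submodule ℂ V := LinearMap.range (E w : V →ₗ[ℂ] V)
  let b := Module.finBasis ℂ A
  refine ⟨e.source ∩ e ⁻¹' O, e.isOpen_inter_preimage hOo, ⟨hp, hwO⟩, _,
    fun j q => E (e q) (b j), ?_, ?_⟩
  · rintro j q ⟨hq, hqO⟩
    apply MDifferentiableAt.mdifferentiableWithinAt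
    have h1 : MDifferentiableAt 𝓘(ℂ) 𝓘(ℂ, V) (fun z => E z (b j)) (e q) :=
      mdifferentiableAt_iff_differentiableAt.2 ((hO _ hqO).2.2.2.clm_apply (differentiableAt_const _))
    exact h1.comp q (mdifferentiableAt_atlas he hq)
  · rintro q ⟨hq, hqO⟩
    obtain ⟨h1, h2, ⟨u, hu⟩, -⟩ := hO _ hqO
    rw [e.left_inv hq] at h1
    have hbw : ∀ x ∈ A, E w x = x := by
      rintro _ ⟨y, rfl⟩
      change E w (E w y) = E w y
      rw [← clm_mul_apply, hidw]
    have hUb : ∀ j, E (e q) (b j) = (u : V →L[ℂ] V) (b j) := by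
      intro j
      rw [hu]
      change _ = E (e q) (E w (b j)) + (1 - E (e q)) ((b j : V) - E w (b j))
      rw [hbw _ (b j).2, sub_self, map_zero, add_zero]
    have huE : (u : V →L[ℂ] V) * E w = E (e q) * (u : V →L[ℂ] V) := by
      rw [hu]
      simp only [U, add_mul, mul_add, sub_mul, mul_sub, mul_one, one_mul, mul_assoc, hidw]
      simp only [← mul_assoc, h2]
      abel
    have hinj : Function.Injective (u : V →L[ℂ] V) := by
      intro x y hxy
      have h3 := congrArg (fun x => (↑u⁻¹ : V →L[ℂ] V) x) hxy
      simpa [← clm_mul_apply] using h3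
    simp only [hUb]
    constructor
    · have h3 : LinearIndependent ℂ (fun j => (b j : V)) :=
        b.linearIndependent.map' A.subtype (Submodule.ker_subtype A)
      exact h3.map' ((u : V →L[ℂ] V) : V →ₗ[ℂ] V) (LinearMap.ker_eq_bot.2 hinj)
    · have h3 : (Set.range fun j => (u : V →L[ℂ] V) (b j)) =
          ((u : V →L[ℂ] V) : V →ₗ[ℂ] V) '' (A.subtype '' Set.range b) := by
        rw [← Set.range_comp, ← Set.range_comp]; rfl
      rw [h3, Submodule.span_image, Submodule.span_image, b.span_eq, Submodule.map_subtype_top, h1]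
      ext v
      constructor
      · rintro ⟨x, rfl⟩
        refine ⟨E w ((↑u⁻¹ : V →L[ℂ] V) x), ⟨_, rfl⟩, ?_⟩
        change ((u : V →L[ℂ] V) * E w) ((↑u⁻¹ : V →L[ℂ] V) x) = E (e q) x
        rw [huE, clm_mul_apply, ← clm_mul_apply (u : V →L[ℂ] V), Units.mul_inv]
        rfl
      · rintro ⟨_, ⟨y, rfl⟩, rfl⟩
        exact ⟨(u : V →L[ℂ] V) y, (DFunLike.congr_fun huE y).symm⟩

/-- A local holomorphic frame of a holomorphic subbundle, in a given chart. -/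
theorem IsHolomorphicSubbundle.exists_frame [IsManifold 𝓘(ℂ) ω M] [CompleteSpace V]
    {B : M → Submodule ℂ V} (h : IsHolomorphicSubbundle B) {e : OpenPartialHomeomorph M ℂ}
    (he : e ∈ atlas ℂ M) {w : ℂ} (hw : w ∈ e.target) :
    ∃ (d : ℕ) (b : Fin d → ℂ → V), (∀ j, AnalyticAt ℂ (b j) w) ∧
      ∀ᶠ z in 𝓝 w, LinearIndependent ℂ (fun j => b j z) ∧
        B (e.symm z) = Submodule.span ℂ (Set.range fun j => b j z) := by
  obtain ⟨U, hU, hpU, d, b, hb, hspan⟩ := h (e.symm w)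
  have hev : ∀ᶠ z in 𝓝 w, e.symm z ∈ U :=
    (eventually_nhds_chart e hw (· ∈ U)).2 (hU.mem_nhds hpU)
  refine ⟨d, fun j => b j ∘ e.symm, fun j => ?_, hev.mono fun z hz => hspan _ hz⟩
  rw [Complex.analyticAt_iff_eventually_differentiableAt]
  filter_upwards [eventually_target hw, hev] with z h1 h2
  rw [← mdifferentiableAt_iff_differentiableAt]
  exact ((hb j).mdifferentiableAt (hU.mem_nhds h2)).comp z
    (mdifferentiableAt_atlas_symm (I := 𝓘(ℂ)) he h1)

end Families

/-! ### Global meromorphic frames and jets -/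

section Determinants

variable {w : ℂ} {d : ℕ}

theorem analyticAt_det {A : ℂ → Matrix (Fin d) (Fin d) ℂ}
    (hA : ∀ i j, AnalyticAt ℂ (fun z => A z i j) w) : AnalyticAt ℂ (fun z => (A z).det) w := by
  simp only [Matrix.det_apply]
  refine Finset.analyticAt_fun_sum _ fun σ _ => ?_
  have h : AnalyticAt ℂ (fun z => ∏ i, A z (σ i) i) w :=
    Finset.analyticAt_fun_prod _ fun i _ => hA _ _
  have h2 : (fun z => Equiv.Perm.sign σ • ∏ i, A z (σ i) i) =
      fun z => ((Equiv.Perm.sign σ : ℤ) : ℂ) * ∏ i, A z (σ i) i := by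
    funext z
    rw [Units.smul_def, zsmul_eq_mul]
  rw [h2]
  exact analyticAt_const.mul h

theorem analyticAt_adjugate {A : ℂ → Matrix (Fin d) (Fin d) ℂ}
    (hA : ∀ i j, AnalyticAt ℂ (fun z => A z i j) w) (i j : Fin d) :
    AnalyticAt ℂ (fun z => (A z).adjugate i j) w := by
  simp only [Matrix.adjugate_apply]
  refine analyticAt_det fun k l => ?_
  by_cases hk : k = j
  · subst hk
    simp only [Matrix.updateRow_self]
    exact analyticAt_const
  · simp only [Matrix.updateRow_ne hk]
    exact hA k l

end Determinants

section Frames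

variable {V : Type*} [NormedAddCommGroup V] [NormedSpace ℂ V]

theorem clm_sum_smul {d m : ℕ} (P : V →L[ℂ] (Fin d → ℂ)) (b : Fin m → V) (c : Fin m → ℂ) :
    P (∑ j, c j • b j) = (Matrix.of fun i j => P (b j) i).mulVec c := by
  rw [map_sum]
  funext i
  simp [Matrix.mulVec, dotProduct, mul_comm]

theorem analyticAt_apply_coord [CompleteSpace V] {d : ℕ} (P : V →L[ℂ] (Fin d → ℂ)) {f : ℂ → V}
    {w : ℂ} (hf : AnalyticAt ℂ f w) (i : Fin d) : AnalyticAt ℂ (fun z => P (f z) i) w :=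
  hf.clmComp ((ContinuousLinearMap.proj (R := ℂ) (φ := fun _ : Fin d => ℂ) i).comp P)

/-- Cramer's rule, without inverting the determinant. -/
theorem adjugate_coeff {d : ℕ} {G : Matrix (Fin d) (Fin d) ℂ} {c y : Fin d → ℂ}
    (h : G.mulVec c = y) : G.adjugate.mulVec y = G.det • c := by
  rw [← h, Matrix.mulVec_mulVec, Matrix.adjugate_mul, Matrix.smul_mulVec, Matrix.one_mulVec]

/-- A holomorphic function with values in the span of a holomorphic frame has holomorphic
coefficients. -/
theorem exists_analytic_coeffs [FiniteDimensional ℂ V] {d : ℕ} {z : ℂ} {b : Fin d → ℂ → V}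
    (hb : ∀ j, AnalyticAt ℂ (b j) z) (hli : LinearIndependent ℂ fun j => b j z) {h : ℂ → V}
    (hh : AnalyticAt ℂ h z)
    (hmem : ∀ᶠ x in 𝓝[≠] z, h x ∈ Submodule.span ℂ (Set.range fun j => b j x)) :
    ∃ a : Fin d → ℂ → ℂ, (∀ j, AnalyticAt ℂ (a j) z) ∧
      ∀ᶠ x in 𝓝 z, h x = ∑ j, a j x • b j x := by
  have := FiniteDimensional.complete ℂ V
  -- functionals dual to the frame at the centre
  have hinj : Function.Injective (Fintype.linearCombination ℂ fun j => b j z) :=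
    linearIndependent_iff_injective_fintypeLinearCombination.1 hli
  obtain ⟨P₀, hP₀⟩ := LinearMap.exists_leftInverse_of_injective
    (Fintype.linearCombination ℂ fun j => b j z) (LinearMap.ker_eq_bot.2 hinj)
  let P : V →L[ℂ] (Fin d → ℂ) := LinearMap.toContinuousLinearMap P₀
  let G : ℂ → Matrix (Fin d) (Fin d) ℂ := fun x => Matrix.of fun i j => P (b j x) i
  have hPa : ∀ (u : ℂ → V), AnalyticAt ℂ u z → ∀ i, AnalyticAt ℂ (fun x => P (u x) i) z :=
    fun u hu i => analyticAt_apply_coord P hu i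
  have hG : ∀ i j, AnalyticAt ℂ (fun x => G x i j) z := fun i j => hPa _ (hb j) i
  have hGz : G z = 1 := by
    ext i j
    have h1 := LinearMap.congr_fun hP₀ (Pi.single j 1)
    have h2 : P (b j z) = Pi.single j 1 := by
      change P₀ (b j z) = Pi.single j 1
      simpa [Fintype.linearCombination_apply_single] using h1
    simp only [G, Matrix.of_apply, h2, Matrix.one_apply, Pi.single_apply]
  have hdet : (G z).det ≠ 0 := by rw [hGz, Matrix.det_one]; exact one_ne_zero
  have hdeta := analyticAt_det hG
  have ha : ∀ j, AnalyticAt ℂ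
      (fun x => ((G x).det)⁻¹ * (G x).adjugate.mulVec (P (h x)) j) z := by
    intro j
    refine (hdeta.inv hdet).mul ?_
    simp only [Matrix.mulVec, dotProduct]
    exact Finset.analyticAt_fun_sum _ fun i _ => (analyticAt_adjugate hG j i).mul (hPa _ hh i)
  refine ⟨_, ha, eventually_nhds_of_punctured_eq hh.continuousAt ?_ ?_⟩
  · exact (Finset.analyticAt_fun_sum _ fun j _ => (ha j).smul (hb j)).continuousAt
  · filter_upwards [hmem, (hdeta.continuousAt.eventually_ne hdet).filter_mono nhdsWithin_le_nhds]
      with x h1 h2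
    obtain ⟨c, hc⟩ := (Submodule.mem_span_range_iff_exists_fun ℂ).1 h1
    have h3 : (G x).mulVec c = P (h x) := by rw [← hc, clm_sum_smul]
    rw [adjugate_coeff h3]
    simp only [Pi.smul_apply, smul_eq_mul, ← mul_assoc, inv_mul_cancel₀ h2, one_mul, hc]

end Frames

section Meromorphic

variable {M : Type*} {V : Type*} [NormedAddCommGroup V] [NormedSpace ℂ V]

/-- The vectors of the fibre of `B` over `q` are determined by their images under `P`, and these
are arbitrary. -/
def IsGraphAt {d : ℕ} (B : M → Submodule ℂ V) (P : V →L[ℂ] (Fin d → ℂ)) (q : M) : Prop :=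
  Function.Bijective fun v : B q => P v

open Classical in
/-- The section of `B` whose image under `P` is the `l`-th unit vector, set to zero at the points
where `P` does not identify the fibre of `B` with `ℂᵈ`. -/
def graphSection {d : ℕ} (B : M → Submodule ℂ V) (P : V →L[ℂ] (Fin d → ℂ)) (l : Fin d) (q : M) :
    V :=
  if h : IsGraphAt B P q then (Equiv.ofBijective _ h).symm (Pi.single l 1) else 0

theorem graphSection_mem {d : ℕ} {B : M → Submodule ℂ V} {P : V →L[ℂ] (Fin d → ℂ)} {q : M}
    (h : IsGraphAt B P q) (l : Fin d) : graphSection B P l q ∈ B q := by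
  rw [graphSection, dif_pos h]
  exact Subtype.mem _

theorem apply_graphSection {d : ℕ} {B : M → Submodule ℂ V} {P : V →L[ℂ] (Fin d → ℂ)} {q : M}
    (h : IsGraphAt B P q) (l : Fin d) : P (graphSection B P l q) = Pi.single l 1 := by
  rw [graphSection, dif_pos h]
  exact (Equiv.ofBijective _ h).apply_symm_apply _

theorem IsGraphAt.ext {d : ℕ} {B : M → Submodule ℂ V} {P : V →L[ℂ] (Fin d → ℂ)} {q : M}
    (h : IsGraphAt B P q) {u v : V} (hu : u ∈ B q) (hv : v ∈ B q) (huv : P u = P v) : u = v :=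
  congrArg Subtype.val (h.1 (a₁ := ⟨u, hu⟩) (a₂ := ⟨v, hv⟩) huv)

theorem IsGraphAt.eq_sum {d : ℕ} {B : M → Submodule ℂ V} {P : V →L[ℂ] (Fin d → ℂ)} {q : M}
    (h : IsGraphAt B P q) {v : V} (hv : v ∈ B q) :
    v = ∑ l, P v l • graphSection B P l q := by
  refine h.ext hv (Submodule.sum_mem _ fun l _ => Submodule.smul_mem _ _ (graphSection_mem h l)) ?_
  rw [map_sum]
  simp only [map_smul, apply_graphSection h]
  funext i
  simp [Pi.single_apply]

variable [TopologicalSpace M] [ChartedSpace ℂ M]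

/-- The span of the derivatives of order at most `k` of the meromorphic sections of `B`. -/
def jetSpan (B : M → Submodule ℂ V) (k : ℕ) (q : M) : Submodule ℂ V :=
  Submodule.span ℂ {v | ∃ H : M → V, IsMeromorphicSection B H ∧ IsHolomorphicAt H q ∧
    ∃ j ≤ k, v = derivAt j H q}

theorem jetSpan_mono (B : M → Submodule ℂ V) {j k : ℕ} (h : j ≤ k) (q : M) :
    jetSpan B j q ≤ jetSpan B k q := by
  refine Submodule.span_mono ?_
  rintro v ⟨H, h1, h2, i, hi, rfl⟩
  exact ⟨H, h1, h2, i, hi.trans h, rfl⟩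

/-- In a local frame of `B`, the condition `IsGraphAt` says that a holomorphic determinant `δ` does
not vanish, and the sections `graphSection` are quotients with denominator `δ`. -/
theorem exists_local_determinant [IsManifold 𝓘(ℂ) ω M] [FiniteDimensional ℂ V] {d : ℕ}
    {B : M → Submodule ℂ V} (hB : IsHolomorphicSubbundle B) (P : V →L[ℂ] (Fin d → ℂ))
    {e : OpenPartialHomeomorph M ℂ} (he : e ∈ atlas ℂ M) {w : ℂ} (hw : w ∈ e.target) :
    ∃ δ : ℂ → ℂ, AnalyticAt ℂ δ w ∧ (∀ᶠ z in 𝓝 w, IsGraphAt B P (e.symm z) ↔ δ z ≠ 0) ∧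
      ∀ l, ∃ g : ℂ → V, AnalyticAt ℂ g w ∧
        ∀ᶠ z in 𝓝 w, δ z ≠ 0 → graphSection B P l (e.symm z) = (δ z)⁻¹ • g z := by
  have := FiniteDimensional.complete ℂ V
  obtain ⟨m, b, hb, hspan⟩ := hB.exists_frame he hw
  by_cases hm : m = d
  · subst hm
    let G : ℂ → Matrix (Fin m) (Fin m) ℂ := fun x => Matrix.of fun i j => P (b j x) i
    have hG : ∀ i j, AnalyticAt ℂ (fun x => G x i j) w := fun i j =>
      analyticAt_apply_coord P (hb j) i
    have hiff : ∀ᶠ z in 𝓝 w, IsGraphAt B P (e.symm z) ↔ (G z).det ≠ 0 := by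
      filter_upwards [hspan] with z ⟨hli, hBz⟩
      constructor
      · intro h hdet
        obtain ⟨c, hc, hGc⟩ := Matrix.exists_mulVec_eq_zero_iff.2 hdet
        have h1 : ∑ j, c j • b j z = 0 := by
          refine h.ext ?_ (Submodule.zero_mem _) ?_
          · rw [hBz]
            exact (Submodule.mem_span_range_iff_exists_fun ℂ).2 ⟨c, rfl⟩
          · rw [clm_sum_smul, map_zero]
            exact hGc
        exact hc (funext fun j => Fintype.linearIndependent_iff.1 hli c h1 j)
      · intro hdet
        constructor
        · rintro ⟨u, hu⟩ ⟨v, hv⟩ huv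
          have h1 : u - v ∈ B (e.symm z) := Submodule.sub_mem _ hu hv
          rw [hBz] at h1
          obtain ⟨c, hc⟩ := (Submodule.mem_span_range_iff_exists_fun ℂ).1 h1
          have h2 : (G z).mulVec c = 0 := by
            have h3 : P (u - v) = 0 := by rw [map_sub]; exact sub_eq_zero.2 huv
            rw [← hc, clm_sum_smul] at h3
            exact h3
          have h4 : c = 0 := by
            by_contra hne
            exact hdet (Matrix.exists_mulVec_eq_zero_iff.1 ⟨c, hne, h2⟩)
          rw [h4] at hc
          simp only [Pi.zero_apply, zero_smul, Finset.sum_const_zero] at hc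
          exact Subtype.ext (sub_eq_zero.1 hc.symm)
        · intro y
          refine ⟨⟨∑ j, ((G z)⁻¹.mulVec y) j • b j z, ?_⟩, ?_⟩
          · rw [hBz]
            exact (Submodule.mem_span_range_iff_exists_fun ℂ).2 ⟨_, rfl⟩
          · change P (∑ j, ((G z)⁻¹.mulVec y) j • b j z) = y
            rw [clm_sum_smul]
            change (G z).mulVec ((G z)⁻¹.mulVec y) = y
            rw [Matrix.mulVec_mulVec, Matrix.mul_nonsing_inv _ (isUnit_iff_ne_zero.2 hdet),
              Matrix.one_mulVec]
    refine ⟨fun z => (G z).det, analyticAt_det hG, hiff, fun l => ?_⟩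
    refine ⟨fun z => ∑ j, (G z).adjugate j l • b j z,
      Finset.analyticAt_fun_sum _ fun j _ => (analyticAt_adjugate hG j l).smul (hb j), ?_⟩
    filter_upwards [hiff, hspan] with z h1 ⟨_, hBz⟩ h2
    have h3 := h1.2 h2
    have h4 := graphSection_mem h3 l
    rw [hBz] at h4
    obtain ⟨c, hc⟩ := (Submodule.mem_span_range_iff_exists_fun ℂ).1 h4
    have h5 : (G z).mulVec c = Pi.single l 1 := by
      rw [← apply_graphSection h3 l, ← hc, clm_sum_smul]
    have h6 := adjugate_coeff h5
    rw [Matrix.mulVec_single_one] at h6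
    have h7 : ∀ j, (G z).adjugate j l = (G z).det * c j := fun j => congrFun h6 j
    simp only [h7, mul_smul, ← Finset.smul_sum, hc]
    rw [smul_smul, inv_mul_cancel₀ h2, one_smul]
  · -- in the wrong rank the fibres are nowhere identified with `ℂᵈ`, and `δ = 0` will do
    have hnot : ∀ᶠ z in 𝓝 w, ¬ IsGraphAt B P (e.symm z) := by
      filter_upwards [hspan] with z ⟨hli, hBz⟩ h
      refine hm ?_
      let L : B (e.symm z) →ₗ[ℂ] (Fin d → ℂ) := (P : V →ₗ[ℂ] (Fin d → ℂ)).domRestrict _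
      have h1 := (LinearEquiv.ofBijective L h).finrank_eq
      rw [hBz, finrank_span_eq_card hli] at h1
      simpa using h1
    refine ⟨fun _ => 0, analyticAt_const, ?_, fun l => ⟨fun _ => 0, analyticAt_const, ?_⟩⟩
    · filter_upwards [hnot] with z h
      simp [h]
    · simp

/-- A holomorphic subbundle of a trivial bundle over a connected surface has a global meromorphic
frame: sections of the form `graphSection`, for a map `P` that identifies one fibre with `ℂᵈ`.
The set of points near which `P` identifies the generic fibre with `ℂᵈ` is open and closed. -/
theorem exists_meromorphic_frame [T2Space M] [ConnectedSpace M] [IsManifold 𝓘(ℂ) ω M]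
    [FiniteDimensional ℂ V] {B : M → Submodule ℂ V} (hB : IsHolomorphicSubbundle B) :
    ∃ (d : ℕ) (P : V →L[ℂ] (Fin d → ℂ)), (∀ l, IsMeromorphicSection B (graphSection B P l)) ∧
      ∀ p, ∀ᶠ q in 𝓝[≠] p, IsGraphAt B P q ∧ ∀ l, IsHolomorphicAt (graphSection B P l) q := by
  have := FiniteDimensional.complete ℂ V
  obtain ⟨q₀⟩ : Nonempty M := inferInstance
  obtain ⟨P₀, hP₀⟩ := LinearMap.exists_leftInverse_of_injective (B q₀).subtype
    (Submodule.ker_subtype _)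
  let d := Module.finrank ℂ (B q₀)
  let P : V →L[ℂ] (Fin d → ℂ) :=
    LinearMap.toContinuousLinearMap ((Module.finBasis ℂ (B q₀)).equivFun ∘ₗ P₀)
  have hq₀ : IsGraphAt B P q₀ := by
    have h : (fun v : B q₀ => P v) = (Module.finBasis ℂ (B q₀)).equivFun := by
      funext v
      exact congrArg (Module.finBasis ℂ (B q₀)).equivFun (LinearMap.congr_fun hP₀ v)
    rw [IsGraphAt, h]
    exact (Module.finBasis ℂ (B q₀)).equivFun.bijective
  -- a determinant vanishes identically near `p` or nowhere in a punctured neighbourhood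
  have hdich : ∀ p, (∀ᶠ q in 𝓝[≠] p, ¬ IsGraphAt B P q) ∨ ∀ᶠ q in 𝓝[≠] p, IsGraphAt B P q := by
    intro p
    have hw := mem_chart_target ℂ p
    have hl := (chartAt ℂ p).left_inv (mem_chart_source ℂ p)
    obtain ⟨δ, hδ, hiff, -⟩ := exists_local_determinant hB P (chart_mem_atlas ℂ p) hw
    rw [← hl, ← eventually_punctured_chart _ hw, ← eventually_punctured_chart _ hw]
    rcases hδ.eventually_eq_zero_or_eventually_ne_zero with h | h
    · left
      filter_upwards [h.filter_mono nhdsWithin_le_nhds, hiff.filter_mono nhdsWithin_le_nhds]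
        with z h1 h2
      rw [h2, not_not, h1]
    · right
      filter_upwards [h, hiff.filter_mono nhdsWithin_le_nhds] with z h1 h2
      rwa [h2]
  have hopen : ∀ Q : M → Prop, IsOpen {p | ∀ᶠ q in 𝓝[≠] p, Q q} := by
    intro Q
    rw [isOpen_iff_eventually]
    intro p hp
    have h1 := eventually_nhdsWithin_iff.1 (eventually_punctured_nhds hp)
    filter_upwards [h1] with q h2
    by_cases hq : q = p
    · rw [hq]; exact hp
    · exact (h2 hq).filter_mono nhdsWithin_le_nhds
  have hall : ∀ p, ∀ᶠ q in 𝓝[≠] p, IsGraphAt B P q := by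
    have hclopen : IsClopen {p | ∀ᶠ q in 𝓝[≠] p, IsGraphAt B P q} := by
      refine ⟨⟨?_⟩, hopen _⟩
      have : {p | ∀ᶠ q in 𝓝[≠] p, IsGraphAt B P q}ᶜ = {p | ∀ᶠ q in 𝓝[≠] p, ¬ IsGraphAt B P q} := by
        ext p
        simp only [Set.mem_compl_iff, Set.mem_ofPred_eq]
        refine ⟨fun h => (hdich p).resolve_right h, fun h h' => ?_⟩
        have := neBot_punctured M p
        obtain ⟨q, h1, h2⟩ := (h.and h').exists
        exact h1 h2
      rw [this]
      exact hopen _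
    have hne : {p | ∀ᶠ q in 𝓝[≠] p, IsGraphAt B P q}.Nonempty := by
      refine ⟨q₀, ?_⟩
      have hw := mem_chart_target ℂ q₀
      have hl := (chartAt ℂ q₀).left_inv (mem_chart_source ℂ q₀)
      obtain ⟨δ, hδ, hiff, -⟩ := exists_local_determinant hB P (chart_mem_atlas ℂ q₀) hw
      have h0 := hiff.self_of_nhds
      rw [hl] at h0
      rw [Set.mem_ofPred_eq, ← hl, ← eventually_punctured_chart _ hw]
      refine Eventually.filter_mono nhdsWithin_le_nhds ?_
      filter_upwards [hδ.continuousAt.eventually_ne (h0.1 hq₀), hiff] with z h1 h2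
      exact h2.2 h1
    intro p
    have h : p ∈ {p | ∀ᶠ q in 𝓝[≠] p, IsGraphAt B P q} := by
      rw [hclopen.eq_univ hne]; exact Set.mem_univ p
    exact h
  refine ⟨d, P, fun l => ⟨fun p => ?_, ?_⟩, fun p => ?_⟩
  · have hw := mem_chart_target ℂ p
    have hl := (chartAt ℂ p).left_inv (mem_chart_source ℂ p)
    obtain ⟨δ, hδ, hiff, hg⟩ := exists_local_determinant hB P (chart_mem_atlas ℂ p) hw
    obtain ⟨g, hg, hgl⟩ := hg l
    refine MeromorphicAt.congr (hδ.meromorphicAt.inv.smul hg.meromorphicAt) ?_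
    have h1 := hall p
    rw [← hl, ← eventually_punctured_chart _ hw] at h1
    filter_upwards [h1, hiff.filter_mono nhdsWithin_le_nhds, hgl.filter_mono nhdsWithin_le_nhds]
      with z h2 h3 h4
    exact (h4 (h3.1 h2)).symm
  · rw [eventually_codiscrete_iff]
    intro p
    filter_upwards [hall p] with q hq using graphSection_mem hq l
  · refine (hall p).and ?_
    have hw := mem_chart_target ℂ p
    have hl := (chartAt ℂ p).left_inv (mem_chart_source ℂ p)
    obtain ⟨δ, hδ, hiff, hg⟩ := exists_local_determinant hB P (chart_mem_atlas ℂ p) hw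
    choose g hg hgl using hg
    have h1 := hall p
    rw [← hl, ← eventually_punctured_chart _ hw] at h1 ⊢
    filter_upwards [h1, hδ.eventually_analyticAt.filter_mono nhdsWithin_le_nhds,
      hiff.filter_mono nhdsWithin_le_nhds,
      (eventually_all.2 fun l => (hg l).eventually_analyticAt).filter_mono nhdsWithin_le_nhds,
      (eventually_all.2 fun l => (hgl l).eventually_nhds).filter_mono nhdsWithin_le_nhds,
      (eventually_target hw).filter_mono nhdsWithin_le_nhds]
      with z h2 h3 h4 h5 h6 h7 l
    have h8 := h4.1 h2
    rw [isHolomorphicAt_iff (chart_mem_atlas ℂ p) h7]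
    refine ((h3.inv h8).smul (h5 l)).congr ?_
    filter_upwards [h6 l, h3.continuousAt.eventually_ne h8] with x h9 h10
    exact (h9 h10).symm

/-- In every chart the spaces of jets of global meromorphic sections are, generically, spanned by
the derivatives of a local holomorphic frame. -/
theorem exists_frame_jetSpan [T2Space M] [ConnectedSpace M] [IsManifold 𝓘(ℂ) ω M]
    [FiniteDimensional ℂ V] {B : M → Submodule ℂ V} (hB : IsHolomorphicSubbundle B)
    {e : OpenPartialHomeomorph M ℂ} (he : e ∈ atlas ℂ M) {w : ℂ} (hw : w ∈ e.target) :
    ∃ (d : ℕ) (b : Fin d → ℂ → V), (∀ l, AnalyticAt ℂ (b l) w) ∧ ∀ᶠ z in 𝓝[≠] w, ∀ k,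
      jetSpan B k (e.symm z) =
        Submodule.span ℂ {v | ∃ l, ∃ j ≤ k, v = iteratedDeriv j (b l) z} := by
  have := FiniteDimensional.complete ℂ V
  obtain ⟨m, P, hsec, hgen⟩ := exists_meromorphic_frame hB
  obtain ⟨d, b, hb, hspan⟩ := hB.exists_frame he hw
  refine ⟨d, b, hb, ?_⟩
  have hgen' := hgen (e.symm w)
  rw [← eventually_punctured_chart _ hw] at hgen'
  filter_upwards [hspan.eventually_nhds.filter_mono nhdsWithin_le_nhds,
    eventually_punctured_nhds hgen',
    (eventually_all.2 fun l => (hb l).eventually_analyticAt).filter_mono nhdsWithin_le_nhds,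
    (eventually_target hw).filter_mono nhdsWithin_le_nhds] with z h1 h2 h3 h4 k
  set q := e.symm z
  set c := chartAt ℂ q
  have hq : q ∈ c.source := mem_chart_source ℂ q
  have hc : c ∈ atlas ℂ M := chart_mem_atlas ℂ q
  have hcq : c q ∈ c.target := c.map_source hq
  have hcl : c.symm (c q) = q := c.left_inv hq
  have hqe : q ∈ e.source := e.map_target h4
  have hez : e q = z := e.right_inv h4
  apply le_antisymm
  · -- sections have holomorphic coefficients in the frame, and `j`-jets in the chart at `q` are
    -- combinations of the derivatives of order at most `j` in the chart `e`
    refine Submodule.span_le.2 ?_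
    rintro _ ⟨H, ⟨-, hHB⟩, hHq, j, hj, rfl⟩
    have hHe : AnalyticAt ℂ (H ∘ e.symm) z := (isHolomorphicAt_iff he h4).1 hHq
    have hmem : ∀ᶠ x in 𝓝[≠] z, (H ∘ e.symm) x ∈ Submodule.span ℂ (Set.range fun j => b j x) := by
      have h5 := eventually_codiscrete_iff.1 hHB q
      rw [← eventually_punctured_chart e h4] at h5
      filter_upwards [h5, h1.filter_mono nhdsWithin_le_nhds] with x h6 h7
      rw [← h7.2]
      exact h6
    obtain ⟨a, ha, hsum⟩ := exists_analytic_coeffs h3 h1.self_of_nhds.1 hHe hmem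
    have hτ : AnalyticAt ℂ (e ∘ c.symm) (c q) :=
      analyticAt_transition hc he hcq (by rw [hcl]; exact hqe)
    have hτz : (e ∘ c.symm) (c q) = z := by rw [Function.comp_apply, hcl, hez]
    have key := iteratedDeriv_mem_span hτ (fun l => a l ∘ (e ∘ c.symm))
      (fun l => AnalyticAt.comp (by rw [hτz]; exact ha l) hτ) b (fun l => by rw [hτz]; exact h3 l)
      (H ∘ c.symm) (by
        have h5 := comp_chart_eventuallyEq (e' := e) hcq (by rw [hcl]; exact hqe) H
        have h6 : ∀ᶠ x in 𝓝 ((e ∘ c.symm) (c q)), (H ∘ e.symm) x = ∑ j, a j x • b j x := by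
          rw [hτz]; exact hsum
        filter_upwards [h5, hτ.continuousAt.eventually h6] with x h7 h8
        rw [h7, Function.comp_apply, h8]
        rfl) j
    rw [hτz] at key
    refine Submodule.span_mono ?_ key
    rintro _ ⟨l, j', hj', rfl⟩
    exact ⟨l, j', hj'.trans hj, rfl⟩
  · -- conversely, the frame has holomorphic coefficients in the global meromorphic frame
    refine Submodule.span_le.2 ?_
    rintro _ ⟨l, j, hj, rfl⟩
    have hτ : AnalyticAt ℂ (c ∘ e.symm) z := analyticAt_transition he hc h4 hq
    have key := iteratedDeriv_mem_span (ι := Fin m) hτ (fun i x => P (b l x) i)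
      (fun i => analyticAt_apply_coord P (h3 l) i)
      (fun i => graphSection B P i ∘ c.symm) (fun i => h2.self_of_nhds.2 i) (b l) (by
        have h5 : ∀ᶠ x in 𝓝 z, e.symm x ∈ c.source :=
          (eventually_nhds_chart e h4 (· ∈ c.source)).2 (c.open_source.mem_nhds hq)
        filter_upwards [h1, h2, h5] with x h6 h7 h8
        have h9 : b l x ∈ B (e.symm x) := by
          rw [h6.2]; exact Submodule.subset_span ⟨l, rfl⟩
        have h10 := h7.1.eq_sum h9
        simp only [Function.comp_apply, c.left_inv h8]
        exact h10) j
    refine Submodule.span_mono ?_ key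
    rintro _ ⟨i, j', hj', rfl⟩
    exact ⟨graphSection B P i, hsec i, h2.self_of_nhds.2 i, j', hj'.trans hj, rfl⟩

/-- The spaces of jets of order at most `k` are generically spanned by finitely many holomorphic
functions, so that `B_{(k)}` is a holomorphic bundle after the holes are filled in. -/
theorem genFam_jetSpan [T2Space M] [ConnectedSpace M] [IsManifold 𝓘(ℂ) ω M]
    [FiniteDimensional ℂ V] {B : M → Submodule ℂ V} (hB : IsHolomorphicSubbundle B) (k : ℕ) :
    GenFam (jetSpan B k) := by
  intro e he w hw
  have := FiniteDimensional.complete ℂ V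
  obtain ⟨d, b, hb, hspan⟩ := exists_frame_jetSpan hB he hw
  refine ⟨Set.range fun x : Fin d × Fin (k + 1) => iteratedDeriv x.2 (b x.1), Set.finite_range _,
    ?_, ?_⟩
  · rintro _ ⟨⟨l, j⟩, rfl⟩
    have h : ∀ j, AnalyticAt ℂ (iteratedDeriv j (b l)) w := by
      intro j
      induction j with
      | zero => simpa using hb l
      | succ j ih => rw [iteratedDeriv_succ]; exact ih.deriv
    exact h j
  · filter_upwards [hspan] with z h
    rw [h k]
    congr 1
    ext v
    constructor
    · rintro ⟨l, j, hj, rfl⟩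
      exact ⟨_, ⟨(l, ⟨j, by omega⟩), rfl⟩, rfl⟩
    · rintro ⟨_, ⟨⟨l, j⟩, rfl⟩, rfl⟩
      exact ⟨l, j, by omega, rfl⟩

end Meromorphic

/-! ### Orthogonal projections from oblique ones, and smoothness -/

section Projections

variable {n : ℕ}

/-- A skew-adjoint operator has no eigenvalue `-1`. -/
theorem isUnit_one_add_sub_star (F : EndCn n) : IsUnit (1 + (F - star F)) := by
  rw [ContinuousLinearMap.isUnit_iff_bijective]
  have hinj : Function.Injective ((1 + (F - star F) : EndCn n) : Cn n →ₗ[ℂ] Cn n) := by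
    rw [← LinearMap.ker_eq_bot, LinearMap.ker_eq_bot']
    intro x hx
    have hx' : x + (F x - star F x) = 0 := hx
    -- the skew-adjoint part does not contribute to the real part of `⟪x, (1 + S) x⟫`
    have h1 : inner ℂ x (x + (F x - star F x)) = 0 := by rw [hx', inner_zero_right]
    have h2 : RCLike.re (inner ℂ x (F x - star F x)) = 0 := by
      rw [inner_sub_right, ContinuousLinearMap.star_eq_adjoint,
        ContinuousLinearMap.adjoint_inner_right, map_sub, inner_re_symm, sub_self]
    have h3 := congrArg RCLike.re h1
    rw [inner_add_right, map_add, h2, add_zero, map_zero] at h3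
    exact re_inner_self_nonpos.1 h3.le
  exact ⟨hinj, LinearMap.injective_iff_surjective.1 hinj⟩

/-- The orthogonal projection onto the range of an oblique projection `F` is
`F (1 + F - F*)⁻¹`. -/
theorem proj_range_eq {F : EndCn n} (hF : F * F = F) :
    proj (LinearMap.range (F : Cn n →ₗ[ℂ] Cn n)) = F * Ring.inverse (1 + (F - star F)) := by
  set p := proj (LinearMap.range (F : Cn n →ₗ[ℂ] Cn n)) with hp
  have h1 : p * F = F := by
    ext1 x
    exact Submodule.starProjection_eq_self_iff.2 ⟨x, rfl⟩
  have h2 : F * p = p := by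
    ext1 x
    have h3 : p x ∈ LinearMap.range (F : Cn n →ₗ[ℂ] Cn n) := by
      have : p x ∈ LinearMap.range (p : Cn n →ₗ[ℂ] Cn n) := ⟨x, rfl⟩
      rwa [hp, range_proj] at this
    obtain ⟨y, hy⟩ := h3
    have hy' : F y = p x := hy
    rw [clm_mul_apply, ← hy', ← clm_mul_apply, hF]
  have h4 : p * star F = p := by
    have := congrArg star h2
    rwa [star_mul, hp, star_proj] at this
  have h5 : p * (1 + (F - star F)) = F := by
    rw [mul_add, mul_sub, h1, h4, mul_one]; abel
  calc p = p * ((1 + (F - star F)) * Ring.inverse (1 + (F - star F))) := by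
        rw [Ring.mul_inverse_cancel _ (isUnit_one_add_sub_star F), mul_one]
    _ = F * Ring.inverse (1 + (F - star F)) := by rw [← mul_assoc, h5]

theorem contDiffAt_proj_range {X : Type*} [NormedAddCommGroup X] [NormedSpace ℝ X]
    {F : X → EndCn n} {w : X} (hF : ContDiffAt ℝ ∞ F w) (hidem : ∀ᶠ z in 𝓝 w, F z * F z = F z) :
    ContDiffAt ℝ ∞ (fun z => proj (LinearMap.range (F z : Cn n →ₗ[ℂ] Cn n))) w := by
  have hs : ContDiffAt ℝ ∞ (fun z => 1 + (F z - star (F z))) w :=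
    contDiffAt_const.add (hF.sub ((starL' ℝ : EndCn n ≃L[ℝ] EndCn n).contDiff.contDiffAt.comp w hF))
  have hinv : ContDiffAt ℝ ∞ (fun z => Ring.inverse (1 + (F z - star (F z)))) w := by
    obtain ⟨u, hu⟩ := isUnit_one_add_sub_star (F w)
    have h := contDiffAt_ringInverse ℝ (n := ∞) u
    rw [hu] at h
    exact h.comp w hs
  refine (hF.mul hinv).congr_of_eventuallyEq ?_
  filter_upwards [hidem] with z hz using proj_range_eq hz

variable {r : ℕ} {X : Type*} [NormedAddCommGroup X] [NormedSpace ℝ X]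
variable {P : X → ℕ → EndCn n} {w : X}

theorem contDiffAt_diagOp {f : X → EndCn n} (hf : ContDiffAt ℝ ∞ f w) :
    ContDiffAt ℝ ∞ (fun z => diagOp r n (f z)) w :=
  ((LinearMap.toContinuousLinearMap (diagOp r n)).restrictScalars ℝ).contDiff.contDiffAt.comp w hf

theorem contDiffAt_muOp {i : ℕ} (hP : ∀ j < i, ContDiffAt ℝ ∞ (fun z => P z j) w) :
    ContDiffAt ℝ ∞ (fun z => muOp r (P z) i) w := by
  induction i with
  | zero => exact contDiffAt_const
  | succ i ih =>
    exact (ih fun j hj => hP j (by omega)).mul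
      ((contDiffAt_diagOp (hP i (by omega))).add contDiffAt_const)

theorem contDiffAt_muAdj {i : ℕ} (hP : ∀ j < i, ContDiffAt ℝ ∞ (fun z => P z j) w) :
    ContDiffAt ℝ ∞ (fun z => muAdj r (P z) i) w := by
  induction i with
  | zero => exact contDiffAt_const
  | succ i ih =>
    exact (contDiffAt_const.add (contDiffAt_diagOp (contDiffAt_const.sub (hP i (by omega))))).mul
      (ih fun j hj => hP j (by omega))

theorem contDiffAt_loopCoeff {i : ℕ} (hP : ∀ j < i, ContDiffAt ℝ ∞ (fun z => P z j) w) (k : ℕ) :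
    ContDiffAt ℝ ∞ (fun z => loopCoeff (P z) i k) w := by
  induction i generalizing k with
  | zero =>
    cases k <;> exact contDiffAt_const
  | succ i ih =>
    have ih' := ih fun j hj => hP j (by omega)
    have hi := hP i (by omega)
    cases k with
    | zero => exact (ih' 0).mul hi
    | succ k => exact ((ih' (k + 1)).mul hi).add ((ih' k).mul (contDiffAt_const.sub hi))

/-- The compression `G ↦ G_{i0}` of an operator on `ℂʳⁿ` to one of its blocks. -/
def compress (r n i : ℕ) : OpV r n →ₗ[ℂ] EndCn n where
  toFun G := coordL r n i ∘L G ∘L constL r n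
  map_add' G H := by ext1 c; simp
  map_smul' c G := by ext1 x; simp

end Projections

/-! ### The unitons as images of holomorphic bundles -/

section Unitons

variable {M : Type*} [TopologicalSpace M] {r n : ℕ}

theorem nmap_fill_le (k : ℕ) (β : M → Submodule ℂ (Crn r n)) (p : M) :
    nmap k (fill β p) ≤ fill (fun q => nmap k (β q)) p :=
  map_fill_le _ β p

variable [ChartedSpace ℂ M]

/-- Smoothness in every chart of the atlas. -/
def SmoothFam (f : M → EndCn n) : Prop :=
  ∀ e ∈ atlas ℂ M, ∀ w ∈ e.target, ContDiffAt ℝ ∞ (f ∘ e.symm) w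

/-- If `Y` is a holomorphic bundle between `λW` and `W = muOp(H₊)`, then `R Y` is locally the range
of a smooth family of (oblique) projections. -/
theorem exists_smooth_projection {P : M → ℕ → EndCn n} (hP : ∀ q j, P q j * P q j = P q j)
    {i : ℕ} (hi : i < r) (hs : ∀ j < i, SmoothFam fun q => P q j)
    {Y : M → Submodule ℂ (Crn r n)} (hY : HolFam Y)
    (h1 : ∀ q, nmap 1 (rg (muOp r (P q) i)) ≤ Y q) (h2 : ∀ q, Y q ≤ rg (muOp r (P q) i))
    {e : OpenPartialHomeomorph M ℂ} (he : e ∈ atlas ℂ M) {w : ℂ} (hw : w ∈ e.target) :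
    ∃ F : ℂ → EndCn n, ContDiffAt ℝ ∞ F w ∧ (∀ᶠ z in 𝓝 w, F z * F z = F z) ∧
      ∀ᶠ z in 𝓝 w, (Y (e.symm z)).map (Rop r (P (e.symm z)) i : Crn r n →ₗ[ℂ] Cn n) =
        LinearMap.range (F z : Cn n →ₗ[ℂ] Cn n) := by
  obtain ⟨E, hE, hidem, hYE⟩ := hY e he w hw
  have hE' : ContDiffAt ℝ ∞ E w := hE.contDiffAt.restrict_scalars ℝ
  have hP' : ∀ j < i, ContDiffAt ℝ ∞ (fun z => P (e.symm z) j) w := fun j hj => hs j hj e he w hw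
  have key : ∀ᶠ z in 𝓝 w, _ := (hidem.and hYE).mono fun z hz =>
    compress_isProj (hP (e.symm z)) hi hz.1 ((h1 _).trans hz.2.le) (hz.2.ge.trans (h2 _))
  refine ⟨fun z => compress r n i (muAdj r (P (e.symm z)) i * E z * muOp r (P (e.symm z)) i),
    ?_, ?_, ?_⟩
  · exact ((LinearMap.toContinuousLinearMap (compress r n i)).restrictScalars
      ℝ).contDiff.contDiffAt.comp w (((contDiffAt_muAdj hP').mul hE').mul (contDiffAt_muOp hP'))
  · filter_upwards [key] with z hz using hz.1
  · filter_upwards [key, hYE] with z hz hz'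
    rw [hz']
    exact hz.2.symm

/-- In the situation of `exists_smooth_projection`, the orthogonal projection onto `R Y` is smooth. -/
theorem smoothFam_proj {P : M → ℕ → EndCn n} (hP : ∀ q j, P q j * P q j = P q j)
    {i : ℕ} (hi : i < r) (hs : ∀ j < i, SmoothFam fun q => P q j)
    {Y : M → Submodule ℂ (Crn r n)} (hY : HolFam Y)
    (h1 : ∀ q, nmap 1 (rg (muOp r (P q) i)) ≤ Y q) (h2 : ∀ q, Y q ≤ rg (muOp r (P q) i)) :
    SmoothFam fun q => proj ((Y q).map (Rop r (P q) i : Crn r n →ₗ[ℂ] Cn n)) := by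
  intro e he w hw
  obtain ⟨F, hF, hidem, hYF⟩ := exists_smooth_projection hP hi hs hY h1 h2 he hw
  refine (contDiffAt_proj_range hF hidem).congr_of_eventuallyEq ?_
  filter_upwards [hYF] with z hz
  simp only [Function.comp_apply, hz]

/-- A family that agrees with `R Y` off a discrete set is extended by `R Y` when its holes are
filled in, since `R Y` varies continuously. -/
theorem fill_eq_map_Rop {P : M → ℕ → EndCn n} (hP : ∀ q j, P q j * P q j = P q j)
    {i : ℕ} (hi : i < r) (hs : ∀ j < i, SmoothFam fun q => P q j)
    {Y : M → Submodule ℂ (Crn r n)} (hY : HolFam Y)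
    (h1 : ∀ q, nmap 1 (rg (muOp r (P q) i)) ≤ Y q) (h2 : ∀ q, Y q ≤ rg (muOp r (P q) i))
    {γ : M → Submodule ℂ (Cn n)} (p : M)
    (hγ : ∀ᶠ q in 𝓝[≠] p, γ q = (Y q).map (Rop r (P q) i : Crn r n →ₗ[ℂ] Cn n)) :
    fill γ p = (Y p).map (Rop r (P p) i : Crn r n →ₗ[ℂ] Cn n) := by
  have hw := mem_chart_target ℂ p
  have hl := (chartAt ℂ p).left_inv (mem_chart_source ℂ p)
  obtain ⟨F, hF, hidem, hYF⟩ := exists_smooth_projection hP hi hs hY h1 h2 (chart_mem_atlas ℂ p) hw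
  have h3 := hYF.self_of_nhds
  rw [hl] at h3
  rw [h3]
  rw [← hl, ← eventually_punctured_chart _ hw] at hγ
  have h4 := fill_eq_range hw hF.continuousAt hidem (β := γ) (by
    filter_upwards [hγ, hYF.filter_mono nhdsWithin_le_nhds] with z h5 h6
    rw [h5, h6])
  rwa [hl] at h4

/-- The space `∑_{j<i} λʲ B_{(j)} + λⁱ H₊`, before the holes are filled in. -/
def rawModel (B : M → Submodule ℂ (Crn r n)) (i : ℕ) (q : M) : Submodule ℂ (Crn r n) :=
  (⨆ j : Fin i, nmap j (jetSpan B j q)) ⊔ rg (Nop r n ^ i)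

/-- The holomorphic subbundle `∑_{j<i} λʲ B_{(j)} + λⁱ H₊`. -/
def model (B : M → Submodule ℂ (Crn r n)) (i : ℕ) : M → Submodule ℂ (Crn r n) :=
  fill (rawModel B i)

theorem nmap_jetSpan_le_rawModel (B : M → Submodule ℂ (Crn r n)) {k i : ℕ} (h : k ≤ i) (q : M) :
    nmap k (jetSpan B k q) ≤ rawModel B i q := by
  rcases h.lt_or_eq with h | rfl
  · exact le_sup_of_le_left (le_iSup (fun j : Fin i => nmap j (jetSpan B j q)) ⟨k, h⟩)
  · exact le_sup_of_le_right LinearMap.map_le_range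

theorem rg_Nop_pow_le {i k : ℕ} (h : i ≤ k) : rg (Nop r n ^ k) ≤ rg (Nop r n ^ i) := by
  rintro _ ⟨u, rfl⟩
  refine ⟨(Nop r n ^ (k - i)) u, ?_⟩
  change (Nop r n ^ i * Nop r n ^ (k - i)) u = (Nop r n ^ k) u
  rw [← pow_add, Nat.add_sub_cancel' h]

theorem rawModel_zero (B : M → Submodule ℂ (Crn r n)) (q : M) : rawModel B 0 q = ⊤ := by
  rw [rawModel, pow_zero]
  refine eq_top_iff.2 (le_sup_of_le_right ?_)
  intro v _
  exact ⟨v, rfl⟩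

theorem rawModel_succ_le (B : M → Submodule ℂ (Crn r n)) (i : ℕ) (q : M) :
    rawModel B (i + 1) q ≤ rawModel B i q :=
  sup_le (iSup_le fun j => nmap_jetSpan_le_rawModel B (by omega) q)
    (le_sup_of_le_right (rg_Nop_pow_le (by omega)))

theorem nmap_one_rg_Nop_pow (i : ℕ) : nmap 1 (rg (Nop r n ^ i)) = rg (Nop r n ^ (i + 1)) := by
  rw [nmap, rg, rg, ← LinearMap.range_comp, pow_succ' _ i, pow_one]
  rfl

theorem nmap_one_rawModel_le (B : M → Submodule ℂ (Crn r n)) (i : ℕ) (q : M) :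
    nmap 1 (rawModel B i q) ≤ rawModel B (i + 1) q := by
  rw [rawModel, nmap, Submodule.map_sup, Submodule.map_iSup]
  refine sup_le (iSup_le fun j => ?_) ?_
  · change nmap 1 (nmap j (jetSpan B j q)) ≤ _
    rw [nmap_nmap, add_comm]
    exact (Submodule.map_mono (jetSpan_mono B (Nat.le_succ j) q)).trans
      (nmap_jetSpan_le_rawModel B (k := j + 1) (by omega) q)
  · exact (nmap_one_rg_Nop_pow i).le.trans le_sup_right

/-- The `k`-th term is the part of `model B (i + 1)` that `Rop` maps onto `α_{i+1}^{(k)}`. -/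
theorem rawModel_succ_eq (B : M → Submodule ℂ (Crn r n)) (i : ℕ) (q : M) :
    rawModel B (i + 1) q =
      ⨆ k : Fin (i + 1), (nmap k (jetSpan B k q) ⊔ nmap 1 (rawModel B i q)) := by
  apply le_antisymm
  · refine sup_le (iSup_le fun k => ?_) ?_
    · exact le_trans le_sup_left
        (le_iSup (fun k : Fin (i + 1) => nmap k (jetSpan B k q) ⊔ nmap 1 (rawModel B i q)) k)
    · rw [← nmap_one_rg_Nop_pow]
      refine le_trans (le_trans (Submodule.map_mono le_sup_right) le_sup_right)
        (le_iSup (fun k : Fin (i + 1) => nmap k (jetSpan B k q) ⊔ nmap 1 (rawModel B i q))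
          (Fin.last i))
  · exact iSup_le fun k => sup_le (nmap_jetSpan_le_rawModel B (by omega) q)
      (nmap_one_rawModel_le B i q)

/-- The orthogonal projections onto the fibres of `α_1, α_2, …` over `q`. -/
def unitonProj (B : M → Submodule ℂ (Crn r n)) (q : M) (j : ℕ) : EndCn n := proj (uniton B j q)

theorem unitonProj_mul_self (B : M → Submodule ℂ (Crn r n)) (q : M) (j : ℕ) :
    unitonProj B q j * unitonProj B q j = unitonProj B q j :=
  proj_mul_self _

theorem Kvec_eq_Rop (B : M → Submodule ℂ (Crn r n)) {i : ℕ} (hi : i < r) (k : ℕ)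
    (H : M → Crn r n) (q : M) :
    Kvec (fun l : Fin i => uniton B l q) k H q =
      Rop r (unitonProj B q) i ((Nop r n ^ k) (derivAt k H q)) := by
  rw [Rop_Nop_pow _ hi, Kvec]
  refine Finset.sum_congr rfl fun s _ => ?_
  rw [elemFn_eq_csum (fun j => uniton B j q)]
  rfl

/-- Where no holes have to be filled in, the spaces defining `α_{i+1}^{(k)}` are images of
`λᵏ B_{(k)} + λ W`: the vectors coming from derivatives of order less than `k` are killed. -/
theorem span_Kvec_eq {B : M → Submodule ℂ (Crn r n)} {i : ℕ} (hi : i < r) {k : ℕ} (hk : k ≤ i)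
    {q : M} (hq : rawModel B i q = rg (muOp r (unitonProj B q) i)) :
    Submodule.span ℂ {v | ∃ H : M → Crn r n, IsMeromorphicSection B H ∧ IsHolomorphicAt H q ∧
        v = Kvec (fun l : Fin i => uniton B l q) k H q} =
      (nmap k (jetSpan B k q) ⊔ nmap 1 (rawModel B i q)).map
        (Rop r (unitonProj B q) i : Crn r n →ₗ[ℂ] Cn n) := by
  have hkill : ∀ y ∈ nmap 1 (rawModel B i q), Rop r (unitonProj B q) i y = 0 := by
    intro y hy
    rw [hq] at hy
    exact Rop_eq_zero_of_mem (unitonProj_mul_self B q) hi hy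
  apply le_antisymm
  · refine Submodule.span_le.2 ?_
    rintro _ ⟨H, h1, h2, rfl⟩
    rw [Kvec_eq_Rop B hi]
    exact ⟨_, Submodule.mem_sup_left ⟨_, Submodule.subset_span ⟨H, h1, h2, k, le_rfl, rfl⟩, rfl⟩,
      rfl⟩
  · rw [Submodule.map_sup]
    refine sup_le ?_ ?_
    · rw [jetSpan, nmap, Submodule.map_span, Submodule.map_span, Submodule.span_le]
      rintro _ ⟨_, ⟨_, ⟨H, h1, h2, j, hj, rfl⟩, rfl⟩, rfl⟩
      rcases hj.lt_or_eq with hj | rfl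
      · have h3 : (Nop r n ^ k) (derivAt j H q) ∈ nmap 1 (rawModel B i q) := by
          have h4 : (Nop r n ^ (k - 1)) (derivAt j H q) ∈ rawModel B i q := by
            refine nmap_jetSpan_le_rawModel B (k := k - 1) (by omega) q ⟨_, ?_, rfl⟩
            exact Submodule.subset_span ⟨H, h1, h2, j, by omega, rfl⟩
          refine ⟨_, h4, ?_⟩
          change (Nop r n ^ 1 * Nop r n ^ (k - 1)) (derivAt j H q) = _
          rw [← pow_add, Nat.add_sub_cancel' (by omega)]
        change Rop r (unitonProj B q) i ((Nop r n ^ k) (derivAt j H q)) ∈ _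
        rw [hkill _ h3]
        exact Submodule.zero_mem _
      · refine Submodule.subset_span ⟨H, h1, h2, ?_⟩
        rw [Kvec_eq_Rop B hi]
        rfl
    · rintro _ ⟨y, hy, rfl⟩
      change Rop r (unitonProj B q) i y ∈ _
      rw [hkill y hy]
      exact Submodule.zero_mem _

variable [T2Space M] [ConnectedSpace M] [IsManifold 𝓘(ℂ) ω M]

theorem genFam_rawModel {B : M → Submodule ℂ (Crn r n)} (hB : IsHolomorphicSubbundle B) (i : ℕ) :
    GenFam (rawModel B i) :=
  (GenFam.iSup (β := fun j q => nmap j (jetSpan B j q)) fun j _ =>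
    (genFam_jetSpan hB j).map _).sup (genFam_const _)

/-- The inductive step of `smoothFam_and_range_muOp`: `α_{i+1}` is the image under `R` of the
bundle `model B (i + 1)`. -/
theorem uniton_eq_map_Rop {B : M → Submodule ℂ (Crn r n)} (hB : IsHolomorphicSubbundle B)
    {i : ℕ} (hi : i < r) (hs : ∀ j < i, SmoothFam fun q => unitonProj B q j)
    (hT : ∀ q, rg (muOp r (unitonProj B q) i) = model B i q) (p : M) :
    uniton B i p = (model B (i + 1) p).map (Rop r (unitonProj B p) i : Crn r n →ₗ[ℂ] Cn n) := by
  have hP := unitonProj_mul_self B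
  have hraw : ∀ p, ∀ᶠ q in 𝓝[≠] p, rawModel B i q = rg (muOp r (unitonProj B q) i) := by
    intro p
    filter_upwards [(genFam_rawModel hB i).fill_eq p] with q hq
    rw [hT, ← hq]
    rfl
  -- `R` maps `Yraw k` onto the fibre of `α_{i+1}^{(k)}`; the added term `λW`, which `R` kills, puts
  -- `Yraw k` between `λW` and `W`
  let Yraw : ℕ → M → Submodule ℂ (Crn r n) := fun k q =>
    nmap k (jetSpan B k q) ⊔ nmap 1 (rawModel B i q)
  have hYgen : ∀ k, GenFam (Yraw k) := fun k =>
    ((genFam_jetSpan hB k).map _).sup ((genFam_rawModel hB i).map _)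
  have hY1 : ∀ k q, nmap 1 (rg (muOp r (unitonProj B q) i)) ≤ fill (Yraw k) q := by
    intro k q
    rw [hT]
    exact (nmap_fill_le 1 _ q).trans (fill_mono (Eventually.of_forall fun _ => le_sup_right))
  have hY2 : ∀ k ≤ i, ∀ q, fill (Yraw k) q ≤ rg (muOp r (unitonProj B q) i) := by
    intro k hk q
    rw [hT]
    refine fill_mono (Eventually.of_forall fun x => sup_le (nmap_jetSpan_le_rawModel B hk x) ?_)
    exact (nmap_one_rawModel_le B i x).trans (rawModel_succ_le B i x)
  have hpart : ∀ k ≤ i, ∀ p, nextUnitonPart B (fun l : Fin i => uniton B l) k p =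
      (fill (Yraw k) p).map (Rop r (unitonProj B p) i : Crn r n →ₗ[ℂ] Cn n) := by
    intro k hk p
    refine fill_eq_map_Rop hP hi hs (hYgen k).holFam_fill (hY1 k) (hY2 k hk) p ?_
    filter_upwards [hraw p, (hYgen k).fill_eq p] with q h1 h2
    rw [h2]
    exact span_Kvec_eq hi hk h1
  have hM1 : ∀ q, nmap 1 (rg (muOp r (unitonProj B q) i)) ≤ model B (i + 1) q := by
    intro q
    rw [hT]
    exact (nmap_fill_le 1 _ q).trans
      (fill_mono (Eventually.of_forall fun x => nmap_one_rawModel_le B i x))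
  have hM2 : ∀ q, model B (i + 1) q ≤ rg (muOp r (unitonProj B q) i) := by
    intro q
    rw [hT]
    exact fill_mono (Eventually.of_forall fun x => rawModel_succ_le B i x)
  rw [uniton]
  refine fill_eq_map_Rop hP hi hs (genFam_rawModel hB (i + 1)).holFam_fill hM1 hM2 p ?_
  have hall : ∀ᶠ q in 𝓝[≠] p, ∀ k : Fin (i + 1), fill (Yraw k) q = Yraw k q :=
    eventually_all.2 fun k => (hYgen k).fill_eq p
  filter_upwards [hall, (genFam_rawModel hB (i + 1)).fill_eq p] with q h1 h2
  rw [h2, rawModel_succ_eq, Submodule.map_iSup]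
  refine iSup_congr fun k => ?_
  rw [hpart k (by omega), h1]

/-- The bundles `α_1, …, α_i` are smooth, and `(π_1 + μ) ⋯ (π_i + μ)` maps onto `model B i`. -/
theorem smoothFam_and_range_muOp {B : M → Submodule ℂ (Crn r n)} (hB : IsHolomorphicSubbundle B)
    {i : ℕ} (hi : i ≤ r) : (∀ j < i, SmoothFam fun q => unitonProj B q j) ∧
      ∀ q, rg (muOp r (unitonProj B q) i) = model B i q := by
  induction i with
  | zero =>
    refine ⟨fun j hj => absurd hj (Nat.not_lt_zero j), fun q => ?_⟩
    have h1 : rg (muOp r (unitonProj B q) 0) = ⊤ := by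
      refine eq_top_iff.2 fun v _ => ⟨v, rfl⟩
    rw [h1, eq_comm, eq_top_iff]
    intro v _
    exact ⟨fun _ => v, Eventually.of_forall fun x => by rw [rawModel_zero]; trivial,
      tendsto_const_nhds⟩
  | succ i ih =>
    obtain ⟨hs, hT⟩ := ih (by omega)
    have hi' : i < r := by omega
    have hu := uniton_eq_map_Rop hB hi' hs hT
    have hM1 : ∀ q, nmap 1 (rg (muOp r (unitonProj B q) i)) ≤ model B (i + 1) q := by
      intro q
      rw [hT]
      exact (nmap_fill_le 1 _ q).trans
        (fill_mono (Eventually.of_forall fun x => nmap_one_rawModel_le B i x))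
    have hM2 : ∀ q, model B (i + 1) q ≤ rg (muOp r (unitonProj B q) i) := by
      intro q
      rw [hT]
      exact fill_mono (Eventually.of_forall fun x => rawModel_succ_le B i x)
    constructor
    · intro j hj
      rcases Nat.lt_succ_iff_lt_or_eq.1 hj with hj | rfl
      · exact hs j hj
      · have h := smoothFam_proj (unitonProj_mul_self B) hi' hs
          (genFam_rawModel hB (j + 1)).holFam_fill hM1 hM2
        have h2 : (fun q => unitonProj B q j) = fun q => proj ((model B (j + 1) q).map
            (Rop r (unitonProj B q) j : Crn r n →ₗ[ℂ] Cn n)) := by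
          funext q
          rw [unitonProj, hu]
        rw [h2]
        exact h
    · intro q
      refine range_muOp_succ (unitonProj_mul_self B q) hi' (hM1 q) (hM2 q) ?_
      rw [← hu, unitonProj, range_proj]

end Unitons

/-! ### The model bundle -/

section Jets

variable {M : Type*} [TopologicalSpace M] [ChartedSpace ℂ M]
variable {V : Type*} [NormedAddCommGroup V] [NormedSpace ℂ V] [CompleteSpace V]
variable {W : Type*} [NormedAddCommGroup W] [NormedSpace ℂ W]

theorem iteratedDeriv_clm_comp (L : V →L[ℂ] W) {f : ℂ → V} {w : ℂ} (hf : AnalyticAt ℂ f w)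
    (j : ℕ) : ∀ᶠ z in 𝓝 w, iteratedDeriv j (fun z => L (f z)) z = L (iteratedDeriv j f z) := by
  induction j generalizing f with
  | zero => simp
  | succ j ih =>
    have h1 : ∀ᶠ z in 𝓝 w, deriv (fun z => L (f z)) z = L (deriv f z) := by
      filter_upwards [Complex.analyticAt_iff_eventually_differentiableAt.1 hf] with z hz
      exact (L.hasFDerivAt.comp_hasDerivAt z hz.hasDerivAt).deriv
    filter_upwards [ih hf.deriv, h1.eventually_nhds] with z h2 h3
    rw [iteratedDeriv_succ', iteratedDeriv_succ', ← h2]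
    exact (Filter.EventuallyEq.iteratedDeriv_eq j h3)

variable [CompleteSpace W]

/-- A constant linear map that carries `B` into `X` carries meromorphic sections to meromorphic
sections and commutes with derivatives. -/
theorem map_jetSpan_le (L : V →L[ℂ] W) {B : M → Submodule ℂ V} {X : M → Submodule ℂ W}
    (h : ∀ p, ∀ v ∈ B p, L v ∈ X p) (k : ℕ) (q : M) :
    (jetSpan B k q).map (L : V →ₗ[ℂ] W) ≤ jetSpan X k q := by
  rw [jetSpan, Submodule.map_span, Submodule.span_le]
  rintro _ ⟨_, ⟨H, ⟨hmer, hsec⟩, hhol, j, hj, rfl⟩, rfl⟩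
  refine Submodule.subset_span ⟨fun q => L (H q), ⟨fun p => ?_, ?_⟩, ?_, j, hj, ?_⟩
  · obtain ⟨m, hm⟩ := hmer p
    refine ⟨m, ?_⟩
    have h1 := hm.clmComp L
    simp only [map_smul] at h1
    exact h1
  · filter_upwards [hsec] with q hq using h _ _ hq
  · exact AnalyticAt.clmComp (f := inCoord q H) hhol L
  · exact (iteratedDeriv_clm_comp L (f := inCoord q H) hhol j).self_of_nhds.symm

theorem jetSpan_map_equiv (L : V ≃L[ℂ] W) {B : M → Submodule ℂ V} {X : M → Submodule ℂ W}
    (h : ∀ p, X p = (B p).map (L : V →ₗ[ℂ] W)) (k : ℕ) (q : M) :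
    jetSpan X k q = (jetSpan B k q).map (L : V →ₗ[ℂ] W) := by
  apply le_antisymm
  · have h1 := map_jetSpan_le (L.symm : W →L[ℂ] V) (B := X) (X := B) (by
      intro p v hv
      rw [h] at hv
      obtain ⟨u, hu, rfl⟩ := hv
      change L.symm (L u) ∈ B p
      rwa [L.symm_apply_apply]) k q
    intro v hv
    exact ⟨L.symm v, h1 ⟨v, hv, rfl⟩, L.apply_symm_apply v⟩
  · exact map_jetSpan_le (L : V →L[ℂ] W) (fun p v hv => by rw [h]; exact ⟨v, hv, rfl⟩) k q

end Jets

section HtoLPowers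

variable {r n : ℕ}

/-- The change of parameter carries `μʲ` to `λʲ (1 - λ)^{-j}`. -/
theorem one_sub_Nop_pow_mul_HtoLc_Nop (j : ℕ) :
    (1 - Nop r n) ^ j * (HtoLc r n * Nop r n ^ j) = Nop r n ^ j * HtoLc r n := by
  induction j with
  | zero => simp
  | succ j ih =>
    have hc : Commute (1 - Nop r n) (Nop r n ^ j) :=
      ((Commute.one_left _).sub_left rfl : Commute (1 - Nop r n) (Nop r n)).pow_right j
    calc (1 - Nop r n) ^ (j + 1) * (HtoLc r n * Nop r n ^ (j + 1))
        = (1 - Nop r n) * ((1 - Nop r n) ^ j * (HtoLc r n * Nop r n ^ j)) * Nop r n := by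
          rw [pow_succ', pow_succ]; simp only [mul_assoc]
      _ = Nop r n ^ j * ((1 - Nop r n) * (HtoLc r n * Nop r n)) := by
          rw [ih, ← mul_assoc, hc.eq]; simp only [mul_assoc]
      _ = _ := by rw [one_sub_Nop_mul_HtoLc, pow_succ, mul_assoc]

/-- The change of parameter carries `(1 + μ)ʲ` to `(1 - λ)^{-j}`. -/
theorem one_sub_Nop_pow_mul_HtoLc (j : ℕ) :
    (1 - Nop r n) ^ j * (HtoLc r n * (1 + Nop r n) ^ j) = HtoLc r n := by
  induction j with
  | zero => simp
  | succ j ih =>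
    have h1 : (1 - Nop r n) * (HtoLc r n * (1 + Nop r n)) = HtoLc r n := by
      rw [mul_add, mul_add, one_sub_Nop_mul_HtoLc, mul_one, sub_mul, one_mul, sub_add_cancel]
    calc (1 - Nop r n) ^ (j + 1) * (HtoLc r n * (1 + Nop r n) ^ (j + 1))
        = (1 - Nop r n) * ((1 - Nop r n) ^ j * (HtoLc r n * (1 + Nop r n) ^ j)) *
            (1 + Nop r n) := by
          rw [pow_succ', pow_succ]; simp only [mul_assoc]
      _ = _ := by rw [ih, mul_assoc, h1]

theorem mem_of_one_add_Nop_pow_mem {S : Submodule ℂ (Crn r n)}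
    (hS : ∀ y ∈ S, Nop r n y ∈ S) (k : ℕ) {y : Crn r n} (hy : ((1 + Nop r n) ^ k) y ∈ S) :
    y ∈ S := by
  induction k with
  | zero => simpa using hy
  | succ k ih =>
    rw [pow_succ', clm_mul_apply] at hy
    exact ih (mem_of_add_mem (K := Nop r n) (Nop_pow_eq_zero le_rfl) hS hy)

end HtoLPowers

section Model

variable {M : Type*} [TopologicalSpace M] [ChartedSpace ℂ M] {r n : ℕ}

theorem Nop_mem_rawModel {B : M → Submodule ℂ (Crn r n)} {i : ℕ} {q : M} {y : Crn r n}
    (hy : y ∈ rawModel B i q) : Nop r n y ∈ rawModel B i q := by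
  refine rawModel_succ_le B i q (nmap_one_rawModel_le B i q ⟨y, hy, ?_⟩)
  rw [pow_one]
  rfl

theorem rawModel_self (B : M → Submodule ℂ (Crn r n)) (q : M) :
    rawModel B r q = ⨆ j : Fin r, nmap j (jetSpan B j q) := by
  have h : rg (Nop r n ^ r) = ⊥ := by
    rw [Nop_pow_eq_zero le_rfl]
    exact LinearMap.range_zero
  rw [rawModel, h, sup_bot_eq]

/-- The change of parameter `HtoL` carries the bundle built from `B` to the one built from
`X = HtoL B`. -/
theorem rawModel_map_HtoL {B X : M → Submodule ℂ (Crn r n)}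
    (hBX : ∀ p, X p = (B p).map (HtoL r n)) (q : M) :
    rawModel X r q = (rawModel B r q).map (HtoL r n) := by
  have hJ : ∀ j, jetSpan X j q = (jetSpan B j q).map (HtoL r n) := fun j =>
    jetSpan_map_equiv (HtoLe r n) hBX j q
  have e1 : ∀ j h, ((1 - Nop r n : OpV r n) ^ j) (HtoL r n ((Nop r n ^ j) h)) =
      (Nop r n ^ j) (HtoL r n h) := fun j h =>
    DFunLike.congr_fun (one_sub_Nop_pow_mul_HtoLc_Nop (r := r) (n := n) j) h
  have e2 : ∀ j h, ((1 - Nop r n : OpV r n) ^ j)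
      (HtoL r n (((1 + Nop r n : OpV r n) ^ j) h)) = HtoL r n h :=
    fun j h => DFunLike.congr_fun (one_sub_Nop_pow_mul_HtoLc (r := r) (n := n) j) h
  apply le_antisymm
  · rw [rawModel_self]
    refine iSup_le fun j => ?_
    rw [hJ]
    rintro _ ⟨_, ⟨h, hh, rfl⟩, rfl⟩
    obtain ⟨y, hy⟩ := (HtoLe r n).surjective ((Nop r n ^ (j : ℕ)) (HtoL r n h))
    refine ⟨y, ?_, hy⟩
    have hy' : HtoL r n y = (Nop r n ^ (j : ℕ)) (HtoL r n h) := hy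
    rw [← e2 j y, ← e1 j h] at hy'
    have h1 := HtoL_injective (one_sub_Nop_pow_injective j hy')
    refine mem_of_one_add_Nop_pow_mem (fun y hy => Nop_mem_rawModel hy) j ?_
    rw [h1]
    exact nmap_jetSpan_le_rawModel B j.2.le q ⟨h, hh, rfl⟩
  · rw [rawModel_self B, Submodule.map_iSup]
    refine iSup_le fun j => ?_
    rintro _ ⟨_, ⟨h, hh, rfl⟩, rfl⟩
    refine mem_of_one_sub_Nop_pow_mem (fun y hy => Nop_mem_rawModel hy) j ?_
    change ((1 - Nop r n) ^ (j : ℕ)) (HtoL r n ((Nop r n ^ (j : ℕ)) h)) ∈ _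
    rw [e1]
    refine nmap_jetSpan_le_rawModel X j.2.le q ⟨HtoL r n h, ?_, rfl⟩
    rw [hJ]
    exact ⟨h, hh, rfl⟩

variable [T2Space M] [ConnectedSpace M] [IsManifold 𝓘(ℂ) ω M]

/-- Filling in the holes of each `X_{(j)}` before summing, as in `modelBundle`, or only those of the
sum, as in `model`, gives the same bundle. -/
theorem modelBundle_eq_model {X : M → Submodule ℂ (Crn r n)} (hX : IsHolomorphicSubbundle X) :
    modelBundle X = model X r := by
  funext p
  refine fill_congr ?_
  have hall : ∀ᶠ q in 𝓝[≠] p, ∀ j : Fin r, fill (jetSpan X j) q = jetSpan X j q :=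
    eventually_all.2 fun j => (genFam_jetSpan hX j).fill_eq p
  filter_upwards [hall] with q hq
  rw [rawModel_self]
  refine iSup_congr fun j => ?_
  change (fill (jetSpan X j) q).map _ = _
  rw [hq]
  congr 1
  exact LinearMap.ext fun v => (Nop_pow_apply _ v).symm

/-- At every point, `X + λ X_{(1)} + ⋯ + λ^{r-1} X_{(r-1)}` is the image of multiplication by
`(π_1 + λ π_1^⊥) ⋯ (π_r + λ π_r^⊥)`. -/
theorem modelBundle_eq_range {B X : M → Submodule ℂ (Crn r n)} (hB : IsHolomorphicSubbundle B)
    (hX : IsHolomorphicSubbundle X) (hBX : ∀ p, X p = (B p).map (HtoL r n)) (q : M) :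
    modelBundle X q = rg (laOp r (unitonProj B q) r) := by
  have h1 : rawModel X r = fun q => (rawModel B r q).map (HtoL r n) :=
    funext (rawModel_map_HtoL hBX)
  have h2 : fill (fun q => (rawModel B r q).map (HtoL r n)) q = (model B r q).map (HtoL r n) :=
    fill_map_equiv (HtoLe r n) (rawModel B r) q
  rw [modelBundle_eq_model hX, model, h1, h2, ← (smoothFam_and_range_muOp hB le_rfl).2,
    map_HtoL_range_muOp]

/-- The bundle `W = model X r` is holomorphic, and `λ ∂_z` maps its sections to sections: the
derivative of a section `λʲ L^{(i)}` with `i ≤ j` is again of this form after multiplication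
by `λ`. -/
theorem exists_projection_model {X : M → Submodule ℂ (Crn r n)} (hX : IsHolomorphicSubbundle X)
    {e : OpenPartialHomeomorph M ℂ} (he : e ∈ atlas ℂ M) {w : ℂ} (hw : w ∈ e.target) :
    ∃ E : ℂ → OpV r n, AnalyticAt ℂ E w ∧ (∀ᶠ z in 𝓝 w, E z * E z = E z) ∧
      (∀ᶠ z in 𝓝 w, model X r (e.symm z) = rg (E z)) ∧
      ∀ᶠ z in 𝓝 w, E z * (Nop r n * deriv E z * E z) = Nop r n * deriv E z * E z := by
  obtain ⟨E, hE, hidem, hrg, hraw⟩ := (genFam_rawModel hX r).exists_projection he hw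
  refine ⟨E, hE, hidem, hrg, ?_⟩
  have hNE : AnalyticAt ℂ (fun z => Nop r n * deriv E z * E z) w :=
    (analyticAt_const.mul hE.deriv).mul hE
  refine eventually_nhds_of_punctured_eq (hE.mul hNE).continuousAt hNE.continuousAt ?_
  obtain ⟨d, b, hb, hjet⟩ := exists_frame_jetSpan hX he hw
  filter_upwards [eventually_punctured_nhds hraw, eventually_punctured_nhds hjet,
    hE.eventually_analyticAt.filter_mono nhdsWithin_le_nhds,
    hidem.filter_mono nhdsWithin_le_nhds,
    hidem.eventually_nhds.filter_mono nhdsWithin_le_nhds,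
    (eventually_all.2 fun l => (hb l).eventually_analyticAt).filter_mono nhdsWithin_le_nhds]
    with z h1 h2 h3 h4 h5 h6
  have hfix : ∀ x, (E x * E x = E x) → ∀ y ∈ rg (E x), E x y = y := by
    rintro x hx _ ⟨u, rfl⟩
    change E x (E x u) = E x u
    rw [← clm_mul_apply, hx]
  have hrz : rawModel X r (e.symm z) = rg (E z) := h1.self_of_nhds
  have hNst : ∀ y ∈ rg (E z), Nop r n y ∈ rg (E z) := by
    intro y hy
    rw [← hrz] at hy ⊢
    exact Nop_mem_rawModel hy
  -- it suffices to differentiate the generators of the bundle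
  have hmem : ∀ y ∈ rg (E z), Nop r n (deriv E z y) ∈ rg (E z) := by
    intro y hy
    rw [← hrz, rawModel_self] at hy
    let S : Submodule ℂ (Crn r n) :=
      (rg (E z)).comap ((Nop r n * deriv E z : OpV r n) : Crn r n →ₗ[ℂ] Crn r n)
    suffices h : ⨆ j : Fin r, nmap j (jetSpan X j (e.symm z)) ≤ S from h hy
    refine iSup_le fun j => ?_
    rw [h2.self_of_nhds j, nmap, Submodule.map_span, Submodule.span_le]
    rintro _ ⟨_, ⟨l, i, hi, rfl⟩, rfl⟩
    have hia : AnalyticAt ℂ (iteratedDeriv i (b l)) z := by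
      have : ∀ i, AnalyticAt ℂ (iteratedDeriv i (b l)) z := by
        intro i
        induction i with
        | zero => simpa using h6 l
        | succ i ih => rw [iteratedDeriv_succ]; exact ih.deriv
      exact this i
    let v : ℂ → Crn r n := fun x => (Nop r n ^ (j : ℕ)) (iteratedDeriv i (b l) x)
    have hv : HasDerivAt v ((Nop r n ^ (j : ℕ)) (iteratedDeriv (i + 1) (b l) z)) z := by
      rw [iteratedDeriv_succ]
      exact (Nop r n ^ (j : ℕ)).hasFDerivAt.comp_hasDerivAt z
        hia.differentiableAt.hasDerivAt
    have hEv : ∀ᶠ x in 𝓝 z, E x (v x) = v x := by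
      filter_upwards [h1, h2, h5] with x h7 h8 h9
      refine hfix x h9 _ ?_
      have hrx : rawModel X r (e.symm x) = rg (E x) := h7
      rw [← hrx]
      refine nmap_jetSpan_le_rawModel X j.2.le _ ⟨_, ?_, rfl⟩
      rw [h8 j]
      exact Submodule.subset_span ⟨l, i, hi, rfl⟩
    have hEv' := (h3.differentiableAt.hasDerivAt.clm_apply hv).congr_of_eventuallyEq
      (hEv.mono fun x hx => hx.symm)
    have hD := hv.unique hEv'
    have hNv : Nop r n ((Nop r n ^ (j : ℕ)) (iteratedDeriv (i + 1) (b l) z)) ∈ rg (E z) := by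
      have h7 : (Nop r n ^ ((j : ℕ) + 1)) (iteratedDeriv (i + 1) (b l) z) ∈ rg (E z) := by
        rw [← hrz]
        refine nmap_jetSpan_le_rawModel X (k := (j : ℕ) + 1) (by omega) _ ⟨_, ?_, rfl⟩
        rw [h2.self_of_nhds]
        exact Submodule.subset_span ⟨l, i + 1, by omega, rfl⟩
      rwa [pow_succ', clm_mul_apply] at h7
    change Nop r n (deriv E z (v z)) ∈ rg (E z)
    have h8 : deriv E z (v z) = (Nop r n ^ (j : ℕ)) (iteratedDeriv (i + 1) (b l) z) -
        E z ((Nop r n ^ (j : ℕ)) (iteratedDeriv (i + 1) (b l) z)) := by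
      rw [eq_sub_iff_add_eq]
      exact hD.symm
    rw [h8, map_sub]
    exact Submodule.sub_mem _ hNv (hNst _ ⟨_, rfl⟩)
  ext1 x
  exact hfix z h4 _ (hmem _ ⟨x, rfl⟩)

end Model

/-! ### Laurent polynomial loops -/

section Loops

variable {F G H : Type*} [AddCommGroup F] [Module ℂ F] [AddCommGroup G] [Module ℂ G]
  [AddCommGroup H] [Module ℂ H]

/-- The loop `λ ↦ λᵏ x`, as a linear function of `x`. -/
def monomialLoop (F : Type*) [AddCommGroup F] [Module ℂ F] (k : ℤ) : F →ₗ[ℂ] (Circle → F) where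
  toFun x l := (l : ℂ) ^ k • x
  map_add' x y := by ext l; simp
  map_smul' c x := by ext l; simp [smul_comm c]

theorem monomialLoop_apply (k : ℤ) (x : F) (l : Circle) :
    monomialLoop F k x l = (l : ℂ) ^ k • x := rfl

/-- The loop `∑ λᵏ a_k` with coefficients `a`. -/
def evalLoop (F : Type*) [AddCommGroup F] [Module ℂ F] : (ℤ →₀ F) →ₗ[ℂ] (Circle → F) :=
  Finsupp.lsum ℂ (monomialLoop F)

theorem evalLoop_single (k : ℤ) (x : F) :
    evalLoop F (Finsupp.single k x) = monomialLoop F k x := by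
  simp [evalLoop]

theorem zpow_ne_one {j : ℤ} (hj : j ≠ 0) : ∃ l : Circle, (l : ℂ) ^ j ≠ 1 := by
  refine ⟨Circle.exp (Real.pi / j), ?_⟩
  rw [← Circle.coe_zpow, ← Circle.exp_intCast_mul, mul_div_cancel₀ _ (by exact_mod_cast hj)]
  exact fun h => Circle.exp_pi_ne_one (Circle.coe_eq_one.1 h)

theorem linearIndependent_zpow : LinearIndependent ℂ fun (k : ℤ) (l : Circle) => (l : ℂ) ^ k := by
  let χ : ℤ → Circle →* ℂ := fun k =>
    { toFun := fun l => (l : ℂ) ^ k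
      map_one' := by simp
      map_mul' := fun a b => by simp [mul_zpow] }
  refine (linearIndependent_monoidHom Circle ℂ).comp χ fun j k hjk => ?_
  by_contra hne
  obtain ⟨l, hl⟩ := zpow_ne_one (sub_ne_zero.2 hne)
  refine hl ?_
  have h1 : (l : ℂ) ^ j = (l : ℂ) ^ k := DFunLike.congr_fun hjk l
  rw [zpow_sub₀ l.coe_ne_zero, h1, div_self (zpow_ne_zero _ l.coe_ne_zero)]

/-- The coefficients of a Laurent polynomial loop are unique. -/
theorem evalLoop_injective : Function.Injective (evalLoop F) := by
  rw [← LinearMap.ker_eq_bot, LinearMap.ker_eq_bot']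
  intro a ha
  ext k
  rw [Finsupp.coe_zero, Pi.zero_apply, ← Module.forall_dual_apply_eq_zero_iff ℂ]
  intro φ
  have h := linearIndependent_iff'.1 linearIndependent_zpow a.support (fun k => φ (a k)) (by
    ext l
    have h1 := congrArg φ (congrFun ha l)
    rw [evalLoop, Finsupp.lsum_apply, Finsupp.sum, Finset.sum_apply, map_sum] at h1
    rw [Finset.sum_apply]
    simp only [Pi.smul_apply, smul_eq_mul]
    simpa [monomialLoop_apply, mul_comm] using h1)
  by_cases hk : k ∈ a.support
  · exact h k hk
  · rw [Finsupp.notMem_support_iff.1 hk, map_zero]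

/-- Laurent polynomial loops in `F` with exponents in `S`. -/
def loops (F : Type*) [AddCommGroup F] [Module ℂ F] (S : Set ℤ) : Submodule ℂ (Circle → F) :=
  (Finsupp.supported F ℂ S).map (evalLoop F)

theorem monomialLoop_mem {S : Set ℤ} {k : ℤ} (hk : k ∈ S) (x : F) :
    (fun l : Circle => (l : ℂ) ^ k • x) ∈ loops F S :=
  ⟨Finsupp.single k x, Finsupp.single_mem_supported ℂ x hk, evalLoop_single k x⟩

theorem monomialLoop_pow_mem {S : Set ℤ} {k : ℕ} (hk : (k : ℤ) ∈ S) (x : F) :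
    (fun l : Circle => (l : ℂ) ^ k • x) ∈ loops F S := by
  have h := monomialLoop_mem hk x
  simpa only [zpow_natCast] using h

theorem const_mem_loops {S : Set ℤ} (hS : (0 : ℤ) ∈ S) (x : F) :
    (fun _ : Circle => x) ∈ loops F S := by
  simpa using monomialLoop_mem hS x

/-- A property of Laurent polynomial loops holds if it is additive and holds for monomials. -/
theorem loops_induction {S : Set ℤ} {p : (f : Circle → F) → f ∈ loops F S → Prop}
    (hzero : p (fun _ => 0) (Submodule.zero_mem _))
    (hadd : ∀ f g hf hg, p f hf → p g hg → p (fun l => f l + g l) (Submodule.add_mem _ hf hg))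
    (hmono : ∀ k (hk : k ∈ S) (x : F), p (fun l : Circle => (l : ℂ) ^ k • x)
      (monomialLoop_mem hk x)) {f : Circle → F} (hf : f ∈ loops F S) : p f hf := by
  suffices h : ∃ hf, p f hf from h.2
  obtain ⟨a, ha, rfl⟩ := hf
  rw [evalLoop, Finsupp.lsum_apply]
  exact Finset.sum_induction _ (fun f => ∃ hf, p f hf)
    (fun f g ⟨hf, hf'⟩ ⟨hg, hg'⟩ => ⟨_, hadd f g hf hg hf' hg'⟩) ⟨_, hzero⟩
    fun k hk => ⟨_, hmono k (ha hk) _⟩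

theorem loops_mono {S T : Set ℤ} (h : S ⊆ T) : loops F S ≤ loops F T :=
  Submodule.map_mono (Finsupp.supported_mono h)

theorem loops_inf (S T : Set ℤ) : loops F S ⊓ loops F T = loops F (S ∩ T) := by
  rw [loops, loops, ← Submodule.map_inf _ evalLoop_injective, ← Finsupp.supported_inter, loops]

theorem mem_loops_inter {S T : Set ℤ} {f : Circle → F} (h1 : f ∈ loops F S) (h2 : f ∈ loops F T) :
    f ∈ loops F (S ∩ T) := by
  rw [← loops_inf]
  exact ⟨h1, h2⟩

theorem eq_const_of_mem_loops {f : Circle → F} (h : f ∈ loops F {0}) : ∀ l, f l = f 1 := by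
  induction h using loops_induction with
  | hzero => exact fun _ => rfl
  | hadd f g _ _ hf hg => exact fun l => congrArg₂ (· + ·) (hf l) (hg l)
  | hmono k hk x =>
    intro l
    obtain rfl : k = 0 := hk
    simp

theorem map_mem_loops (L : F →ₗ[ℂ] G) {S : Set ℤ} {f : Circle → F} (hf : f ∈ loops F S) :
    (fun l => L (f l)) ∈ loops G S := by
  induction hf using loops_induction with
  | hzero => simp only [map_zero]; exact Submodule.zero_mem _
  | hadd f g _ _ hf hg => simp only [map_add]; exact Submodule.add_mem _ hf hg
  | hmono k hk x => simp only [map_smul]; exact monomialLoop_mem hk (L x)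

/-- Exponents add under a pointwise bilinear operation. -/
theorem bilin_mem_loops (β : F →ₗ[ℂ] G →ₗ[ℂ] H) {S T U : Set ℤ}
    (hU : ∀ j ∈ S, ∀ k ∈ T, j + k ∈ U) {f : Circle → F} {g : Circle → G}
    (hf : f ∈ loops F S) (hg : g ∈ loops G T) : (fun l => β (f l) (g l)) ∈ loops H U := by
  induction hf using loops_induction with
  | hzero => simp only [map_zero, LinearMap.zero_apply]; exact Submodule.zero_mem _
  | hadd f g _ _ hf hg =>
    simp only [map_add, LinearMap.add_apply]
    exact Submodule.add_mem _ hf hg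
  | hmono j hj x =>
    induction hg using loops_induction with
    | hzero => simp only [map_zero]; exact Submodule.zero_mem _
    | hadd f g _ _ hf hg => simp only [map_add]; exact Submodule.add_mem _ hf hg
    | hmono k hk y =>
      convert monomialLoop_mem (hU j hj k hk) (β x y) using 2 with l
      rw [map_smul, map_smul, LinearMap.smul_apply, smul_smul, mul_comm, zpow_add₀ l.coe_ne_zero]

theorem zpow_smul_mem_loops (j : ℤ) {S T : Set ℤ} (hT : ∀ k ∈ S, j + k ∈ T) {f : Circle → F}
    (hf : f ∈ loops F S) : (fun l : Circle => (l : ℂ) ^ j • f l) ∈ loops F T := by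
  have h1 : (fun l : Circle => (l : ℂ) ^ j • (1 : ℂ)) ∈ loops ℂ {j} :=
    monomialLoop_mem (F := ℂ) (Set.mem_singleton j) 1
  have h2 := bilin_mem_loops (LinearMap.lsmul ℂ F)
    (fun i hi k hk => by rw [Set.mem_singleton_iff.1 hi]; exact hT k hk) h1 hf
  simpa using h2

end Loops

section EndLoops

variable {n : ℕ}

theorem apply_mem_loops {S T U : Set ℤ} (hU : ∀ j ∈ S, ∀ k ∈ T, j + k ∈ U)
    {f : Circle → EndCn n} {g : Circle → Cn n}
    (hf : f ∈ loops (EndCn n) S) (hg : g ∈ loops (Cn n) T) :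
    (fun l => f l (g l)) ∈ loops (Cn n) U :=
  bilin_mem_loops (ContinuousLinearMap.coeLM ℂ) hU hf hg

theorem mul_mem_loops {S T U : Set ℤ} (hU : ∀ j ∈ S, ∀ k ∈ T, j + k ∈ U)
    {f g : Circle → EndCn n}
    (hf : f ∈ loops (EndCn n) S) (hg : g ∈ loops (EndCn n) T) :
    (fun l => f l * g l) ∈ loops (EndCn n) U :=
  bilin_mem_loops (LinearMap.mul ℂ (EndCn n)) hU hf hg

/-- `star_zero`, `star_add` and `star_sub` on `EndCn n`, restated because the zero, sum and difference
of continuous linear maps are not syntactically those of the star ring. -/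
theorem endStar_zero : star (0 : EndCn n) = 0 := star_zero (EndCn n)

theorem endStar_add (f g : EndCn n) : star (f + g) = star f + star g := star_add f g

theorem endStar_sub (f g : EndCn n) : star (f - g) = star f - star g := star_sub f g

theorem star_coe_circle (l : Circle) : star (l : ℂ) = ((l⁻¹ : Circle) : ℂ) :=
  (Circle.coe_inv_eq_conj l).symm

theorem star_coe_mul_self (l : Circle) : star (l : ℂ) * l = 1 := by
  rw [star_coe_circle, Circle.coe_inv, inv_mul_cancel₀ l.coe_ne_zero]

theorem star_mem_loops {S T : Set ℤ} (hT : ∀ k ∈ S, -k ∈ T) {f : Circle → EndCn n}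
    (hf : f ∈ loops (EndCn n) S) : (fun l => star (f l)) ∈ loops (EndCn n) T := by
  induction hf using loops_induction with
  | hzero => simp only [endStar_zero]; exact Submodule.zero_mem _
  | hadd f g _ _ hf hg => simp only [endStar_add]; exact Submodule.add_mem _ hf hg
  | hmono k hk x =>
    convert monomialLoop_mem (hT k hk) (star x) using 2 with l
    rw [star_smul, star_zpow₀, zpow_neg, ← inv_zpow, star_coe_circle, Circle.coe_inv]

/-- A loop of operators is a Laurent polynomial if its values on each vector are. -/
theorem mem_loops_of_apply {S : Set ℤ} {f : Circle → EndCn n}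
    (h : ∀ c, (fun l => f l c) ∈ loops (Cn n) S) : f ∈ loops (EndCn n) S := by
  let L : Fin n → Cn n →ₗ[ℂ] EndCn n := fun i =>
    { toFun := fun x => ContinuousLinearMap.smulRight (EuclideanSpace.proj i : Cn n →L[ℂ] ℂ) x
      map_add' := fun x y => by ext1 v; simp
      map_smul' := fun c x => by ext1 v; simp [smul_comm c] }
  have h1 : f = ∑ i, fun l => L i (f l (EuclideanSpace.single i 1)) := by
    ext1 l
    rw [Finset.sum_apply]
    ext1 v
    have hv : v = ∑ i, v i • EuclideanSpace.single i (1 : ℂ) := by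
      have := (EuclideanSpace.basisFun (Fin n) ℂ).sum_repr v
      simpa using this.symm
    conv_lhs => rw [hv]
    rw [map_sum, _root_.sum_apply]
    refine Finset.sum_congr rfl fun i _ => ?_
    rw [map_smul]
    rfl
  rw [h1]
  exact Submodule.sum_mem _ fun i _ => map_mem_loops (L i) (h _)

end EndLoops

section PolyLoop

variable {r n : ℕ}

/-- The polynomial loop `v_0 + λ v_1 + ⋯ + λ^{r-1} v_{r-1}` given by `v ∈ ℂʳⁿ`. -/
def polyLoop (r n : ℕ) : Crn r n →ₗ[ℂ] (Circle → Cn n) where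
  toFun v l := ∑ m ∈ Finset.range r, (l : ℂ) ^ m • coord v m
  map_add' v w := by ext1 l; simp [coord_add, Finset.sum_add_distrib]
  map_smul' c v := by ext1 l; simp [coord_smul, Finset.smul_sum, smul_comm c]

theorem polyLoop_apply (v : Crn r n) (l : Circle) :
    polyLoop r n v l = ∑ m ∈ Finset.range r, (l : ℂ) ^ m • coord v m := rfl

theorem polyLoop_mem (v : Crn r n) : polyLoop r n v ∈ loops (Cn n) (Set.Ici 0) := by
  have h : polyLoop r n v = ∑ m ∈ Finset.range r, fun l : Circle => (l : ℂ) ^ m • coord v m := by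
    ext1 l
    rw [polyLoop_apply, Finset.sum_apply]
  rw [h]
  exact Submodule.sum_mem _ fun m _ => monomialLoop_pow_mem (by simp) _

/-- `Nop` is multiplication by `λ`, modulo `λʳ H₊`. -/
theorem polyLoop_Nop (v : Crn r n) :
    (fun l : Circle => (l : ℂ) • polyLoop r n v l - polyLoop r n (Nop r n v) l) ∈
      loops (Cn n) (Set.Ici (r : ℤ)) := by
  rcases r with _ | s
  · convert Submodule.zero_mem (loops (Cn n) _) using 1
    ext1 l
    simp [polyLoop_apply]
  · have h : (fun l : Circle => (l : ℂ) • polyLoop (s + 1) n v l -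
        polyLoop (s + 1) n (Nop (s + 1) n v) l) =
        fun l : Circle => (l : ℂ) ^ (s + 1) • coord v s := by
      ext1 l
      rw [polyLoop_apply, polyLoop_apply, Finset.sum_range_succ, Finset.sum_range_succ',
        smul_add, Finset.smul_sum]
      have h1 : ∑ m ∈ Finset.range s, (l : ℂ) ^ (m + 1) • coord (Nop (s + 1) n v) (m + 1) =
          ∑ m ∈ Finset.range s, (l : ℂ) • (l : ℂ) ^ m • coord v m := by
        refine Finset.sum_congr rfl fun m hm => ?_
        have := Finset.mem_range.1 hm
        rw [coord_Nop, if_pos ⟨by omega, by omega⟩, Nat.add_sub_cancel, smul_smul, pow_succ']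
      have h2 : coord (Nop (s + 1) n v) 0 = 0 := by rw [coord_Nop, if_neg (by omega)]
      rw [h1, h2, smul_zero, add_zero, add_sub_cancel_left, smul_smul, pow_succ']
    rw [h]
    exact monomialLoop_pow_mem (by simp) _

/-- The loop `(π_1 + λ π_1^⊥) ⋯ (π_i + λ π_i^⊥)`. -/
def prodLoop {n : ℕ} (P : ℕ → EndCn n) (i : ℕ) (l : Circle) : EndCn n :=
  (List.ofFn fun j : Fin i => P j + (l : ℂ) • (1 - P j)).prod

theorem prodLoop_eq_sum (P : ℕ → EndCn n) (i : ℕ) (l : Circle) :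
    prodLoop P i l = ∑ k ∈ Finset.range (i + 1), (l : ℂ) ^ k • loopCoeff P i k :=
  prod_eq_sum_loopCoeff P l i

theorem prodLoop_succ (P : ℕ → EndCn n) (i : ℕ) (l : Circle) :
    prodLoop P (i + 1) l = prodLoop P i l * (P i + (l : ℂ) • (1 - P i)) :=
  prod_ofFn_succ (fun j => P j + (l : ℂ) • (1 - P j)) i

theorem prodLoop_one (P : ℕ → EndCn n) (i : ℕ) : prodLoop P i 1 = 1 := by
  induction i with
  | zero => simp [prodLoop]
  | succ i ih => rw [prodLoop_succ, ih]; simp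

theorem prodLoop_mem (P : ℕ → EndCn n) (i : ℕ) :
    prodLoop P i ∈ loops (EndCn n) (Set.Icc 0 (i : ℤ)) := by
  have h : prodLoop P i =
      ∑ k ∈ Finset.range (i + 1), fun l : Circle => (l : ℂ) ^ k • loopCoeff P i k := by
    ext1 l
    rw [prodLoop_eq_sum, Finset.sum_apply]
  rw [h]
  refine Submodule.sum_mem _ fun k hk => monomialLoop_pow_mem ?_ _
  have := Finset.mem_range.1 hk
  exact ⟨by positivity, by exact_mod_cast Nat.lt_succ_iff.1 this⟩

theorem add_smul_mem_unitary {p : EndCn n} (hp : p * p = p) (hs : star p = p) {c : ℂ}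
    (hc : star c * c = 1) : p + c • (1 - p) ∈ unitary (EndCn n) := by
  have hstar : star (p + c • (1 - p)) = p + star c • (1 - p) := by
    rw [endStar_add, star_smul, endStar_sub, hs, star_one]
  have h1 : p * (1 - p) = 0 := by rw [mul_sub, hp, mul_one, sub_self]
  have h2 : (1 - p) * p = 0 := by rw [sub_mul, hp, one_mul, sub_self]
  have h3 : (1 - p) * (1 - p) = 1 - p := by rw [mul_sub, h2, mul_one, sub_zero]
  have key : ∀ a b : ℂ, a * b = 1 → (p + a • (1 - p)) * (p + b • (1 - p)) = 1 := by
    intro a b hab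
    simp only [add_mul, mul_add, smul_mul_assoc, mul_smul_comm, hp, h1, h2, h3,
      zero_add, smul_smul]
    rw [mul_comm, hab, one_smul]
    have h4 : a • (0 : EndCn n) = 0 := smul_zero (A := EndCn n) a
    have h5 : p + (0 : EndCn n) = p := add_zero p
    rw [h4, h5]
    exact add_sub_cancel p 1
  rw [Unitary.mem_iff, hstar]
  exact ⟨key _ _ hc, key _ _ (by rw [mul_comm, hc])⟩

theorem prodLoop_unitary {P : ℕ → EndCn n} (hp : ∀ j, P j * P j = P j)
    (hs : ∀ j, star (P j) = P j) (i : ℕ) (l : Circle) : prodLoop P i l ∈ unitary (EndCn n) := by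
  induction i with
  | zero => simp [prodLoop]
  | succ i ih =>
    rw [prodLoop_succ]
    exact mul_mem ih (add_smul_mem_unitary (hp i) (hs i) (star_coe_mul_self l))

/-- `laOp` is multiplication by `prodLoop`, modulo `λʳ H₊`. -/
theorem prodLoop_polyLoop (P : ℕ → EndCn n) (i : ℕ) (v : Crn r n) :
    (fun l => prodLoop P i l (polyLoop r n v l) - polyLoop r n (laOp r P i v) l) ∈
      loops (Cn n) (Set.Ici (r : ℤ)) := by
  induction i generalizing v with
  | zero =>
    have h : (fun l => prodLoop P 0 l (polyLoop r n v l) - polyLoop r n (laOp r P 0 v) l) = 0 := by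
      ext1 l
      simp [prodLoop, laOp]
    rw [h]
    exact Submodule.zero_mem _
  | succ i ih =>
    let w := diagOp r n (1 - P i) v
    let u := diagOp r n (P i) v + Nop r n w
    have hla : laOp r P (i + 1) v = laOp r P i u := rfl
    have h1 := ih u
    have h2 := apply_mem_loops (U := Set.Ici (r : ℤ)) (fun j hj k hk => by
      have := hj.1; simp only [Set.mem_Ici] at hk ⊢; omega) (prodLoop_mem P i) (polyLoop_Nop w)
    have hdiag : ∀ (a : EndCn n) l, a (polyLoop r n v l) = polyLoop r n (diagOp r n a v) l := by
      intro a l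
      simp [polyLoop_apply, map_sum, coord_diagOp]
    have h3 := Submodule.add_mem _ h1 h2
    convert h3 using 1
    ext1 l
    rw [Pi.add_apply, prodLoop_succ, clm_mul_apply, hla, _root_.add_apply, _root_.smul_apply, hdiag,
      hdiag (1 - P i), map_sub]
    change prodLoop P i l (_ + (l : ℂ) • polyLoop r n w l) - _ = _
    have hu : polyLoop r n u l = polyLoop r n (diagOp r n (P i) v) l +
        polyLoop r n (Nop r n w) l := by
      rw [map_add, Pi.add_apply]
    rw [hu, map_add (prodLoop P i l), map_add (prodLoop P i l), map_sub (prodLoop P i l)]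
    generalize polyLoop r n (laOp r P i u) l = x
    abel

/-- A loop whose first `r` coefficients form a vector of `laOp(ℂʳⁿ)` is the product of `prodLoop`
with a polynomial loop. -/
theorem star_prodLoop_apply_mem {P : ℕ → EndCn n} (hp : ∀ j, P j * P j = P j)
    (hs : ∀ j, star (P j) = P j) {v : Crn r n} (hv : v ∈ rg (laOp r P r)) {f : Circle → Cn n}
    (hf : (fun l => f l - polyLoop r n v l) ∈ loops (Cn n) (Set.Ici (r : ℤ))) :
    (fun l => star (prodLoop P r l) (f l)) ∈ loops (Cn n) (Set.Ici 0) := by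
  obtain ⟨u, hu⟩ := hv
  have hu' : laOp r P r u = v := hu
  have h1 := Submodule.sub_mem _ hf (prodLoop_polyLoop P r u)
  have h2 := star_mem_loops (T := Set.Icc (-(r : ℤ)) 0) (fun k hk => by
    simp only [Set.mem_Icc] at hk ⊢; omega) (prodLoop_mem P r)
  have h3 := apply_mem_loops (U := Set.Ici 0) (fun j hj k hk => by
    simp only [Set.mem_Icc, Set.mem_Ici] at hj hk ⊢; omega) h2 h1
  convert Submodule.add_mem _ h3 (polyLoop_mem u) using 1
  ext1 l
  have h4 : star (prodLoop P r l) (prodLoop P r l (polyLoop r n u l)) = polyLoop r n u l := by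
    rw [← clm_mul_apply, (Unitary.mem_iff.1 (prodLoop_unitary hp hs r l)).1]
    rfl
  rw [Pi.add_apply, Pi.sub_apply, map_sub, map_sub, map_sub, h4, hu']
  abel

end PolyLoop

/-! ### Wirtinger derivatives -/

section SecondDerivatives

variable {F : Type*} [NormedAddCommGroup F] [NormedSpace ℝ F]

theorem fderiv_fderiv_apply {f : ℂ → F} {w : ℂ} (hf : ContDiffAt ℝ ∞ f w) (a b : ℂ) :
    fderiv ℝ (fun z => fderiv ℝ f z a) w b = fderiv ℝ (fderiv ℝ f) w b a := by
  have h : DifferentiableAt ℝ (fderiv ℝ f) w :=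
    (hf.fderiv_right (m := 1) (by norm_cast)).differentiableAt (by norm_num)
  rw [fderiv_clm_apply h (differentiableAt_const a)]
  simp

theorem contDiffAt_fderiv_apply {f : ℂ → F} {w : ℂ} (hf : ContDiffAt ℝ ∞ f w) (a : ℂ) :
    ContDiffAt ℝ ∞ (fun z => fderiv ℝ f z a) w :=
  (hf.fderiv_right (m := ∞) (by simp)).clm_apply contDiffAt_const

end SecondDerivatives

section Wirtinger

variable {F : Type*} [NormedAddCommGroup F] [NormedSpace ℂ F] [NormedSpace ℝ F]

/-- `∂f/∂z` for functions with values in a complex normed space. -/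
def wirtinger (f : ℂ → F) (w : ℂ) : F :=
  (1 / 2 : ℂ) • (fderiv ℝ f w 1 - Complex.I • fderiv ℝ f w Complex.I)

/-- `∂f/∂z̄` for functions with values in a complex normed space. -/
def wirtingerBar (f : ℂ → F) (w : ℂ) : F :=
  (1 / 2 : ℂ) • (fderiv ℝ f w 1 + Complex.I • fderiv ℝ f w Complex.I)

theorem fderiv_one_eq (f : ℂ → F) (w : ℂ) :
    fderiv ℝ f w 1 = wirtinger f w + wirtingerBar f w := by
  simp only [wirtinger, wirtingerBar, smul_add, smul_sub]
  module

theorem fderiv_I_eq (f : ℂ → F) (w : ℂ) :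
    fderiv ℝ f w Complex.I = Complex.I • (wirtinger f w - wirtingerBar f w) := by
  have h : Complex.I * Complex.I = -1 := Complex.I_mul_I
  simp only [wirtinger, wirtingerBar, smul_add, smul_sub, smul_smul]
  match_scalars
  · linear_combination h
  · ring

theorem wirtinger_congr {f g : ℂ → F} {w : ℂ} (h : f =ᶠ[𝓝 w] g) :
    wirtinger f w = wirtinger g w := by
  rw [wirtinger, h.fderiv_eq, wirtinger]

theorem wirtingerBar_congr {f g : ℂ → F} {w : ℂ} (h : f =ᶠ[𝓝 w] g) :
    wirtingerBar f w = wirtingerBar g w := by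
  rw [wirtingerBar, h.fderiv_eq, wirtingerBar]

theorem wirtinger_const (c : F) (w : ℂ) : wirtinger (fun _ => c) w = 0 := by
  simp [wirtinger]

theorem wirtingerBar_const (c : F) (w : ℂ) : wirtingerBar (fun _ => c) w = 0 := by
  simp [wirtingerBar]

section Scalar

variable [IsScalarTower ℝ ℂ F]

theorem fderiv_of_analyticAt {f : ℂ → F} {w : ℂ} (hf : AnalyticAt ℂ f w) (h : ℂ) :
    fderiv ℝ f w h = h • deriv f w := by
  have h1 := (hf.differentiableAt.hasDerivAt.hasFDerivAt.restrictScalars ℝ).fderiv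
  rw [h1]
  simp

theorem wirtinger_of_analyticAt {f : ℂ → F} {w : ℂ} (hf : AnalyticAt ℂ f w) :
    wirtinger f w = deriv f w := by
  rw [wirtinger, fderiv_of_analyticAt hf, fderiv_of_analyticAt hf, smul_smul, Complex.I_mul_I]
  module

theorem wirtingerBar_of_analyticAt {f : ℂ → F} {w : ℂ} (hf : AnalyticAt ℂ f w) :
    wirtingerBar f w = 0 := by
  rw [wirtingerBar, fderiv_of_analyticAt hf, fderiv_of_analyticAt hf, smul_smul, Complex.I_mul_I]
  module

end Scalar

theorem fderiv_sum_smul [SMulCommClass ℝ ℂ F] {k : ℕ} {T : ℕ → ℂ → F} {w : ℂ}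
    (hT : ∀ j, DifferentiableAt ℝ (T j) w) (c : ℕ → ℂ) (h : ℂ) :
    fderiv ℝ (fun z => ∑ j ∈ Finset.range k, c j • T j z) w h =
      ∑ j ∈ Finset.range k, c j • fderiv ℝ (T j) w h := by
  have h1 : HasFDerivAt (fun z => ∑ j ∈ Finset.range k, c j • T j z)
      (∑ j ∈ Finset.range k, c j • fderiv ℝ (T j) w) w :=
    HasFDerivAt.fun_sum fun j _ => (hT j).hasFDerivAt.const_smul (c j)
  rw [h1.fderiv]
  simp [_root_.sum_apply]

theorem wirtinger_sum_smul [SMulCommClass ℝ ℂ F] {k : ℕ} {T : ℕ → ℂ → F} {w : ℂ}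
    (hT : ∀ j, DifferentiableAt ℝ (T j) w) (c : ℕ → ℂ) :
    wirtinger (fun z => ∑ j ∈ Finset.range k, c j • T j z) w =
      ∑ j ∈ Finset.range k, c j • wirtinger (T j) w := by
  simp only [wirtinger, fderiv_sum_smul hT]
  rw [Finset.smul_sum, ← Finset.sum_sub_distrib, Finset.smul_sum]
  refine Finset.sum_congr rfl fun j _ => ?_
  module

theorem wirtingerBar_sum_smul [SMulCommClass ℝ ℂ F] {k : ℕ} {T : ℕ → ℂ → F} {w : ℂ}
    (hT : ∀ j, DifferentiableAt ℝ (T j) w) (c : ℕ → ℂ) :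
    wirtingerBar (fun z => ∑ j ∈ Finset.range k, c j • T j z) w =
      ∑ j ∈ Finset.range k, c j • wirtingerBar (T j) w := by
  simp only [wirtingerBar, fderiv_sum_smul hT]
  rw [Finset.smul_sum, ← Finset.sum_add_distrib, Finset.smul_sum]
  refine Finset.sum_congr rfl fun j _ => ?_
  module

theorem wirtinger_const_smul [SMulCommClass ℝ ℂ F] {f : ℂ → F} {w : ℂ}
    (hf : DifferentiableAt ℝ f w) (c : ℂ) :
    wirtinger (fun z => c • f z) w = c • wirtinger f w := by
  have h1 : fderiv ℝ (fun z => c • f z) w = c • fderiv ℝ f w :=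
    (hf.hasFDerivAt.const_smul c).fderiv
  rw [wirtinger, h1, wirtinger]
  simp only [_root_.smul_apply]
  module

theorem wirtingerBar_const_smul [SMulCommClass ℝ ℂ F] {f : ℂ → F} {w : ℂ}
    (hf : DifferentiableAt ℝ f w) (c : ℂ) :
    wirtingerBar (fun z => c • f z) w = c • wirtingerBar f w := by
  have h1 : fderiv ℝ (fun z => c • f z) w = c • fderiv ℝ f w :=
    (hf.hasFDerivAt.const_smul c).fderiv
  rw [wirtingerBar, h1, wirtingerBar]
  simp only [_root_.smul_apply]
  module

/-- Wirtinger derivatives commute with continuous linear maps. -/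
theorem wirtinger_clm {G : Type*} [NormedAddCommGroup G] [NormedSpace ℂ G] [NormedSpace ℝ G]
    [IsScalarTower ℝ ℂ F] [IsScalarTower ℝ ℂ G] (L : F →L[ℂ] G) {f : ℂ → F} {w : ℂ}
    (hf : DifferentiableAt ℝ f w) :
    wirtinger (fun z => L (f z)) w = L (wirtinger f w) ∧
      wirtingerBar (fun z => L (f z)) w = L (wirtingerBar f w) := by
  have h1 : fderiv ℝ (fun z => L (f z)) w = (L.restrictScalars ℝ) ∘L fderiv ℝ f w :=
    ((L.restrictScalars ℝ).hasFDerivAt.comp w hf.hasFDerivAt).fderiv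
  constructor
  · rw [wirtinger, h1, wirtinger]
    simp
  · rw [wirtingerBar, h1, wirtingerBar]
    simp

/-- `∂ ∂̄ = ∂̄ ∂`. -/
theorem wirtinger_comm [SMulCommClass ℝ ℂ F] {f : ℂ → F} {w : ℂ} (hf : ContDiffAt ℝ ∞ f w) :
    wirtinger (wirtingerBar f) w = wirtingerBar (wirtinger f) w := by
  have hd : ∀ a, DifferentiableAt ℝ (fun z => fderiv ℝ f z a) w := fun a =>
    (contDiffAt_fderiv_apply hf a).differentiableAt (by simp)
  have hsym : fderiv ℝ (fderiv ℝ f) w 1 Complex.I = fderiv ℝ (fderiv ℝ f) w Complex.I 1 :=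
    (hf.isSymmSndFDerivAt (by
      rw [minSmoothness_of_isRCLikeNormedField]; exact WithTop.coe_le_coe.2 le_top)).eq 1 Complex.I
  have hbar : ∀ b, fderiv ℝ (wirtingerBar f) w b = (1 / 2 : ℂ) •
      (fderiv ℝ (fderiv ℝ f) w b 1 + Complex.I • fderiv ℝ (fderiv ℝ f) w b Complex.I) := by
    intro b
    have h := (((hd 1).hasFDerivAt.add ((hd Complex.I).hasFDerivAt.const_smul
      Complex.I)).const_smul (1 / 2 : ℂ)).fderiv
    change fderiv ℝ (wirtingerBar f) w = _ at h
    rw [h, ← fderiv_fderiv_apply hf, ← fderiv_fderiv_apply hf]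
    rfl
  have hz : ∀ b, fderiv ℝ (wirtinger f) w b = (1 / 2 : ℂ) •
      (fderiv ℝ (fderiv ℝ f) w b 1 - Complex.I • fderiv ℝ (fderiv ℝ f) w b Complex.I) := by
    intro b
    have h := (((hd 1).hasFDerivAt.sub ((hd Complex.I).hasFDerivAt.const_smul
      Complex.I)).const_smul (1 / 2 : ℂ)).fderiv
    change fderiv ℝ (wirtinger f) w = _ at h
    rw [h, ← fderiv_fderiv_apply hf, ← fderiv_fderiv_apply hf]
    rfl
  rw [wirtinger, wirtingerBar, hbar, hbar, hz, hz, hsym]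
  simp only [smul_add, smul_sub]
  module

end Wirtinger

section WirtingerMul

variable {A : Type*} [NormedRing A] [NormedAlgebra ℂ A]

theorem wirtinger_mul {f g : ℂ → A} {w : ℂ} (hf : DifferentiableAt ℝ f w)
    (hg : DifferentiableAt ℝ g w) :
    wirtinger (fun z => f z * g z) w = f w * wirtinger g w + wirtinger f w * g w := by
  have h : ∀ a, fderiv ℝ (fun z => f z * g z) w a =
      f w * fderiv ℝ g w a + fderiv ℝ f w a * g w := by
    intro a
    have h := (hf.hasFDerivAt.mul' hg.hasFDerivAt).fderiv
    change fderiv ℝ (fun z => f z * g z) w = _ at h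
    rw [h]
    rfl
  simp only [wirtinger, h, smul_add, smul_sub, mul_sub, sub_mul, mul_smul_comm, smul_mul_assoc]
  abel

theorem wirtingerBar_mul {f g : ℂ → A} {w : ℂ} (hf : DifferentiableAt ℝ f w)
    (hg : DifferentiableAt ℝ g w) :
    wirtingerBar (fun z => f z * g z) w = f w * wirtingerBar g w + wirtingerBar f w * g w := by
  have h : ∀ a, fderiv ℝ (fun z => f z * g z) w a =
      f w * fderiv ℝ g w a + fderiv ℝ f w a * g w := by
    intro a
    have h := (hf.hasFDerivAt.mul' hg.hasFDerivAt).fderiv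
    change fderiv ℝ (fun z => f z * g z) w = _ at h
    rw [h]
    rfl
  simp only [wirtingerBar, h, smul_add, mul_add, add_mul, mul_smul_comm, smul_mul_assoc]
  abel

end WirtingerMul

section WirtingerStar

variable {n : ℕ}

theorem contDiffAt_star {f : ℂ → EndCn n} {w : ℂ} (hf : ContDiffAt ℝ ∞ f w) :
    ContDiffAt ℝ ∞ (fun z => star (f z)) w :=
  (starL' ℝ : EndCn n ≃L[ℝ] EndCn n).contDiff.contDiffAt.comp w hf

theorem wirtinger_star {f : ℂ → EndCn n} {w : ℂ} (hf : DifferentiableAt ℝ f w) :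
    wirtinger (fun z => star (f z)) w = star (wirtingerBar f w) := by
  have h : ∀ a, fderiv ℝ (fun z => star (f z)) w a = star (fderiv ℝ f w a) := by
    intro a
    have h := ((starL' ℝ : EndCn n ≃L[ℝ] EndCn n).hasFDerivAt.comp w hf.hasFDerivAt).fderiv
    change fderiv ℝ (fun z => star (f z)) w = _ at h
    rw [h]
    rfl
  rw [wirtinger, wirtingerBar, h, h, star_smul, endStar_add, star_smul]
  have h1 : star (1 / 2 : ℂ) = 1 / 2 := by simp
  have h2 : star Complex.I = -Complex.I := Complex.conj_I
  rw [h1, h2, neg_smul, ← sub_eq_add_neg]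

end WirtingerStar

/-! ### The extended solution -/

section Local

variable {r n : ℕ} {P : ℂ → ℕ → EndCn n} {w : ℂ}

theorem contDiffAt_laOp {i : ℕ} (hP : ∀ j < i, ContDiffAt ℝ ∞ (fun z => P z j) w) :
    ContDiffAt ℝ ∞ (fun z => laOp r (P z) i) w := by
  induction i with
  | zero => exact contDiffAt_const
  | succ i ih =>
    have hi := hP i (by omega)
    exact (ih fun j hj => hP j (by omega)).mul ((contDiffAt_diagOp hi).add
      (contDiffAt_const.mul (contDiffAt_diagOp (contDiffAt_const.sub hi))))

theorem contDiffAt_prodLoop {i : ℕ} (hP : ∀ j < i, ContDiffAt ℝ ∞ (fun z => P z j) w)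
    (l : Circle) : ContDiffAt ℝ ∞ (fun z => prodLoop (P z) i l) w := by
  induction i with
  | zero => simpa [prodLoop] using contDiffAt_const
  | succ i ih =>
    have hi := hP i (by omega)
    simp only [prodLoop_succ]
    exact (ih fun j hj => hP j (by omega)).mul (hi.add ((contDiffAt_const.sub hi).const_smul (l : ℂ)))

/-- The first column of `laOp` consists of the coefficients of the loop. -/
theorem coord_laOp_constL (Q : ℕ → EndCn n) (i : ℕ) (c : Cn n) {m : ℕ} (hm : m < r) :
    coord (laOp r Q i (constL r n c)) m = loopCoeff Q i m c := by
  rw [coord_laOp _ _ _ hm, Finset.sum_eq_single_of_mem m (Finset.self_mem_range_succ m)]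
  · rw [Nat.sub_self, coord_constL _ (by omega), if_pos rfl]
  · intro k hk hkm
    have := Finset.mem_range.1 hk
    rw [coord_constL _ (by omega), if_neg (by omega), map_zero]

/-- A loop of degree at most one in `λ` that vanishes at `λ = 1` is a multiple of `1 - λ`. -/
theorem eq_smul_of_mem_loops {F : Type*} [AddCommGroup F] [Module ℂ F] {f : Circle → F}
    (hf : f ∈ loops F (Set.Ici 0 ∩ Set.Iic 1)) (h1 : f 1 = 0) :
    ∃ b : F, ∀ l, f l = (1 - (l : ℂ)) • b := by
  have key : ∃ x y : F, ∀ l, f l = x + (l : ℂ) • y := by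
    clear h1
    induction hf using loops_induction with
    | hzero => exact ⟨0, 0, fun l => by simp⟩
    | hadd f g _ _ hf hg =>
      obtain ⟨x, y, h⟩ := hf
      obtain ⟨x', y', h'⟩ := hg
      refine ⟨x + x', y + y', fun l => ?_⟩
      change f l + g l = _
      rw [h, h', smul_add]
      abel
    | hmono k hk x =>
      obtain ⟨h0, h1⟩ := hk
      simp only [Set.mem_Ici, Set.mem_Iic] at h0 h1
      obtain rfl | rfl : k = 0 ∨ k = 1 := by omega
      · exact ⟨x, 0, fun l => by simp⟩
      · exact ⟨0, x, fun l => by simp⟩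
  obtain ⟨x, y, h⟩ := key
  refine ⟨x, fun l => ?_⟩
  have h2 := h 1
  rw [h1, Circle.coe_one, one_smul] at h2
  rw [h, eq_neg_of_add_eq_zero_right h2.symm, sub_smul, one_smul, smul_neg, ← sub_eq_add_neg]

/-- Holomorphy of the bundle `laOp(ℂʳⁿ)` and its invariance under `λ ∂_z` make `Φ⁻¹ ∂̄Φ` and
`λ Φ⁻¹ ∂Φ` polynomial in `λ`. Since `Φ` is unitary, these are minus the adjoints of `Φ⁻¹ ∂Φ` and
`λ⁻¹ Φ⁻¹ ∂̄Φ`, so `Φ⁻¹ ∂̄Φ` has degree at most one in `λ`. -/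
theorem exists_wirtinger_prodLoop (hp : ∀ z j, P z j * P z j = P z j)
    (hs : ∀ z j, star (P z j) = P z j) (hP : ∀ j < r, ContDiffAt ℝ ∞ (fun z => P z j) w)
    {E : ℂ → OpV r n} (hE : AnalyticAt ℂ E w) (hidem : ∀ᶠ z in 𝓝 w, E z * E z = E z)
    (hrg : ∀ᶠ z in 𝓝 w, rg (laOp r (P z) r) = rg (E z))
    (hNE : E w * (Nop r n * deriv E w * E w) = Nop r n * deriv E w * E w) :
    ∃ A : EndCn n, ∀ l : Circle,
      wirtinger (fun z => prodLoop (P z) r l) w = (1 - (l : ℂ)⁻¹) • (prodLoop (P w) r l * A) ∧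
      wirtingerBar (fun z => prodLoop (P z) r l) w =
        (1 - (l : ℂ)) • (prodLoop (P w) r l * -star A) := by
  set S : ℂ → OpV r n := fun z => laOp r (P z) r with hSdef
  set T : ℕ → ℂ → EndCn n := fun k z => loopCoeff (P z) r k with hTdef
  set Φ : Circle → ℂ → EndCn n := fun l z => prodLoop (P z) r l with hΦdef
  have hSd : DifferentiableAt ℝ S w := (contDiffAt_laOp hP).differentiableAt (by simp)
  have hTd : ∀ k, DifferentiableAt ℝ (T k) w := fun k =>
    (contDiffAt_loopCoeff hP k).differentiableAt (by simp)
  have hΦd : ∀ l, DifferentiableAt ℝ (Φ l) w := fun l =>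
    (contDiffAt_prodLoop hP l).differentiableAt (by simp)
  have hEd : DifferentiableAt ℝ E w :=
    (hE.contDiffAt.restrict_scalars ℝ : ContDiffAt ℝ 1 E w).differentiableAt (by simp)
  have hES : S =ᶠ[𝓝 w] fun z => E z * S z := by
    filter_upwards [hidem, hrg] with z h1 h2
    ext1 v
    have h3 : S z v ∈ rg (E z) := by rw [← h2]; exact ⟨v, rfl⟩
    obtain ⟨u, hu⟩ := h3
    change S z v = E z (S z v)
    rw [← hu]
    change E z u = E z (E z u)
    rw [← clm_mul_apply, h1]
  have hbar : wirtingerBar S w = E w * wirtingerBar S w := by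
    conv_lhs => rw [wirtingerBar_congr hES, wirtingerBar_mul hEd hSd,
      wirtingerBar_of_analyticAt hE, zero_mul, add_zero]
  have hz : wirtinger S w = E w * wirtinger S w + deriv E w * (E w * S w) := by
    conv_lhs => rw [wirtinger_congr hES, wirtinger_mul hEd hSd, wirtinger_of_analyticAt hE,
      hES.self_of_nhds]
  have hrgw : rg (S w) = rg (E w) := hrg.self_of_nhds
  have hNrg : ∀ y ∈ rg (S w), Nop r n y ∈ rg (S w) := by
    rintro _ ⟨u, rfl⟩
    refine ⟨Nop r n u, ?_⟩
    change (laOp r (P w) r * Nop r n) u = (Nop r n * laOp r (P w) r) u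
    rw [(commute_Nop_laOp (P w) r).eq]
  have hbar_mem : ∀ v, wirtingerBar S w v ∈ rg (S w) := by
    intro v
    rw [hrgw, hbar]
    exact ⟨_, rfl⟩
  have hz_mem : ∀ v, Nop r n (wirtinger S w v) ∈ rg (S w) := by
    intro v
    rw [hz, _root_.add_apply, map_add]
    refine Submodule.add_mem _ (hNrg _ ?_) ?_
    · rw [hrgw]; exact ⟨_, rfl⟩
    · have h1 : Nop r n ((deriv E w * (E w * S w)) v) =
          (E w * (Nop r n * deriv E w * E w)) (S w v) := by
        rw [hNE]; rfl
      rw [h1, hrgw]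
      exact ⟨_, rfl⟩
  -- the coefficients of the loop are the components of `laOp`
  have hcoord : ∀ c, ∀ m < r, coord (wirtinger S w (constL r n c)) m = wirtinger (T m) w c ∧
      coord (wirtingerBar S w (constL r n c)) m = wirtingerBar (T m) w c := by
    intro c m hm
    let L1 : OpV r n →L[ℂ] Cn n :=
      (coordL r n m) ∘L (ContinuousLinearMap.apply ℂ (Crn r n) (constL r n c))
    let L2 : EndCn n →L[ℂ] Cn n := ContinuousLinearMap.apply ℂ (Cn n) c
    have h0 : (fun z => L1 (S z)) = fun z => L2 (T m z) :=
      funext fun z => coord_laOp_constL (P z) r c hm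
    have h1 := wirtinger_clm L1 hSd
    have h2 := wirtinger_clm L2 (hTd m)
    rw [h0] at h1
    exact ⟨h1.1.symm.trans h2.1, h1.2.symm.trans h2.2⟩
  have hΦsum : ∀ l : Circle, Φ l = fun z => ∑ k ∈ Finset.range (r + 1), (l : ℂ) ^ k • T k z :=
    fun l => funext fun z => prodLoop_eq_sum (P z) r l
  have hΦz : ∀ (l : Circle) c, wirtinger (Φ l) w c =
      polyLoop r n (wirtinger S w (constL r n c)) l + (l : ℂ) ^ r • wirtinger (T r) w c := by
    intro l c
    rw [hΦsum, wirtinger_sum_smul hTd, _root_.sum_apply, Finset.sum_range_succ, polyLoop_apply]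
    congr 1
    exact Finset.sum_congr rfl fun m hm => by
      rw [(hcoord c m (Finset.mem_range.1 hm)).1]; rfl
  have hΦbar : ∀ (l : Circle) c, wirtingerBar (Φ l) w c =
      polyLoop r n (wirtingerBar S w (constL r n c)) l + (l : ℂ) ^ r • wirtingerBar (T r) w c := by
    intro l c
    rw [hΦsum, wirtingerBar_sum_smul hTd, _root_.sum_apply, Finset.sum_range_succ, polyLoop_apply]
    congr 1
    exact Finset.sum_congr rfl fun m hm => by
      rw [(hcoord c m (Finset.mem_range.1 hm)).2]; rfl
  have hU : ∀ z l, Φ l z ∈ unitary (EndCn n) := fun z l => prodLoop_unitary (hp z) (hs z) r l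
  let C : Circle → EndCn n := fun l => star (Φ l w) * wirtingerBar (Φ l) w
  let D : Circle → EndCn n := fun l => star (Φ l w) * wirtinger (Φ l) w
  -- `C = Φ⁻¹ ∂̄Φ` has exponents `≥ 0` and `D = Φ⁻¹ ∂Φ` has exponents `≥ -1`; as `D = -C*`, those of
  -- `C` are `≤ 1`
  have hC0 : C ∈ loops (EndCn n) (Set.Ici 0) := by
    refine mem_loops_of_apply fun c => ?_
    refine star_prodLoop_apply_mem (hp w) (hs w) (hbar_mem (constL r n c))
      (f := fun l => wirtingerBar (Φ l) w c) ?_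
    simp only [hΦbar, add_sub_cancel_left]
    exact monomialLoop_pow_mem (by simp) _
  have hD0 : (fun l : Circle => (l : ℂ) ^ (1 : ℤ) • D l) ∈ loops (EndCn n) (Set.Ici 0) := by
    refine mem_loops_of_apply fun c => ?_
    have h1 := star_prodLoop_apply_mem (hp w) (hs w) (hz_mem (constL r n c))
      (f := fun l => (l : ℂ) • wirtinger (Φ l) w c) (by
        have h2 := Submodule.add_mem _ (polyLoop_Nop (wirtinger S w (constL r n c)))
          (monomialLoop_pow_mem (S := Set.Ici (r : ℤ)) (k := r + 1) (by simp)
            (wirtinger (T r) w c))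
        convert h2 using 1
        ext1 l
        rw [Pi.add_apply, hΦz, smul_add, smul_smul, pow_succ']
        abel)
    convert h1 using 2 with l
    rw [zpow_one, map_smul]
    rfl
  have hD1 : D ∈ loops (EndCn n) (Set.Ici (-1)) := by
    have h := zpow_smul_mem_loops (T := Set.Ici (-1)) (-1) (fun k hk => by
      simp only [Set.mem_Ici] at hk ⊢; omega) hD0
    convert h using 1
    ext1 l
    rw [smul_smul, ← zpow_add₀ l.coe_ne_zero]
    simp
  have hDC : ∀ l, D l = -star (C l) := by
    intro l
    have h1 : wirtinger (fun z => star (Φ l z) * Φ l z) w = 0 := by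
      have h2 : (fun z => star (Φ l z) * Φ l z) = fun _ => 1 :=
        funext fun z => (Unitary.mem_iff.1 (hU z l)).1
      rw [h2, wirtinger_const]
    have h3 : DifferentiableAt ℝ (fun z => star (Φ l z)) w :=
      (contDiffAt_star (contDiffAt_prodLoop hP l)).differentiableAt (by simp)
    rw [wirtinger_mul h3 (hΦd l), wirtinger_star (hΦd l)] at h1
    rw [eq_neg_iff_add_eq_zero, star_mul, star_star]
    exact h1
  have hC1 : C ∈ loops (EndCn n) (Set.Iic 1) := by
    have h := Submodule.neg_mem _ (star_mem_loops (T := Set.Iic 1) (fun k hk => by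
      simp only [Set.mem_Ici, Set.mem_Iic] at hk ⊢; omega) hD1)
    convert h using 1
    ext1 l
    have h2 : star (D l) = -C l := by
      rw [hDC]
      exact (star_neg (star (C l))).trans (by rw [star_star])
    rw [Pi.neg_apply, h2]
    exact (neg_neg (C l)).symm
  have hone : C 1 = 0 := by
    have h2 : Φ 1 = fun _ => 1 := funext fun z => prodLoop_one (P z) r
    change star (Φ 1 w) * wirtingerBar (Φ 1) w = 0
    rw [h2, wirtingerBar_const]
    exact mul_zero _
  obtain ⟨b, hb⟩ := eq_smul_of_mem_loops (mem_loops_inter hC0 hC1) hone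
  have hcancel : ∀ l (x : EndCn n), Φ l w * (star (Φ l w) * x) = x := by
    intro l x
    rw [← mul_assoc, (Unitary.mem_iff.1 (hU w l)).2]
    exact one_mul x
  refine ⟨-star b, fun l => ⟨?_, ?_⟩⟩
  · have h1 : D l = (1 - (l : ℂ)⁻¹) • -star b := by
      rw [hDC, hb, star_smul, smul_neg, star_sub, star_one, star_coe_circle, Circle.coe_inv]
    change wirtinger (Φ l) w = _ • (Φ l w * _)
    rw [← mul_smul_comm, ← h1]
    exact (hcancel l _).symm
  · have h1 : star (-star b) = -b := (star_neg (star b)).trans (by rw [star_star])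
    have h2 : -star (-star b) = b := by rw [h1]; exact neg_neg b
    change wirtingerBar (Φ l) w = _ • (Φ l w * _)
    rw [h2, ← mul_smul_comm, ← hb]
    exact (hcancel l _).symm

end Local

/-! ### Zero curvature and harmonicity -/

section ZeroCurvature

variable {n : ℕ} {w : ℂ}

/-- The integrability condition `∂∂̄Φ_λ = ∂̄∂Φ_λ` of the equations of an extended solution. -/
theorem zero_curvature {Φ A B : ℂ → EndCn n} {s t : ℂ} (hΦ : ContDiffAt ℝ ∞ Φ w)
    (hA : DifferentiableAt ℝ A w) (hB : DifferentiableAt ℝ B w)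
    (hU : Φ w ∈ unitary (EndCn n))
    (hz : ∀ᶠ z in 𝓝 w, wirtinger Φ z = s • (Φ z * A z))
    (hbar : ∀ᶠ z in 𝓝 w, wirtingerBar Φ z = t • (Φ z * B z)) :
    s • wirtingerBar A w + (s * t) • (B w * A w) =
      t • wirtinger B w + (s * t) • (A w * B w) := by
  have hΦd : DifferentiableAt ℝ Φ w := hΦ.differentiableAt (by simp)
  have h1 := wirtinger_comm hΦ
  rw [wirtinger_congr (g := fun z => t • (Φ z * B z)) hbar,
    wirtingerBar_congr (g := fun z => s • (Φ z * A z)) hz,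
    wirtinger_const_smul (f := fun z => Φ z * B z) (hΦd.mul hB),
    wirtingerBar_const_smul (f := fun z => Φ z * A z) (hΦd.mul hA), wirtinger_mul hΦd hB,
    wirtingerBar_mul hΦd hA, hz.self_of_nhds, hbar.self_of_nhds] at h1
  have h2 := congrArg (fun x => star (Φ w) * x) h1
  have hc : ∀ x, star (Φ w) * (Φ w * x) = x := by
    intro x
    rw [← mul_assoc, (Unitary.mem_iff.1 hU).1]
    exact one_mul x
  simp only [mul_add, smul_add, mul_smul_comm, smul_mul_assoc, mul_assoc, hc, smul_smul] at h2
  rw [← h2, mul_comm t s]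

/-- Comparing the zero curvature equations at `λ = -1` and `λ = i` gives `∂̄A_z + ∂A_z̄ = 0`. -/
theorem wirtingerBar_add_wirtinger_eq_zero {Φ : Circle → ℂ → EndCn n} {A B : ℂ → EndCn n}
    (hΦ : ∀ l, ContDiffAt ℝ ∞ (Φ l) w)
    (hA : DifferentiableAt ℝ A w) (hB : DifferentiableAt ℝ B w)
    (hU : ∀ l, Φ l w ∈ unitary (EndCn n))
    (hz : ∀ l : Circle, ∀ᶠ z in 𝓝 w, wirtinger (Φ l) z = (1 - (l : ℂ)⁻¹) • (Φ l z * A z))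
    (hbar : ∀ l : Circle, ∀ᶠ z in 𝓝 w, wirtingerBar (Φ l) z = (1 - (l : ℂ)) • (Φ l z * B z)) :
    wirtingerBar A w + wirtinger B w = 0 := by
  obtain ⟨i, hi⟩ : ∃ i : Circle, (i : ℂ) = Complex.I :=
    ⟨Circle.exp (Real.pi / 2), by rw [Circle.coe_exp]; push_cast; exact Complex.exp_pi_div_two_mul_I⟩
  have h1 := zero_curvature (hΦ (-1)) hA hB (hU _) (hz (-1)) (hbar (-1))
  have h2 := zero_curvature (hΦ i) hA hB (hU _) (hz i) (hbar i)
  rw [hi] at h2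
  have hI : (Complex.I)⁻¹ = -Complex.I := Complex.inv_I
  have hI2 : Complex.I * Complex.I = -1 := Complex.I_mul_I
  have e1 : (1 - ((-1 : Circle) : ℂ)⁻¹) = 2 := by
    rw [Circle.coe_neg, Circle.coe_one]; norm_num
  have e2 : (1 - ((-1 : Circle) : ℂ)) = 2 := by
    rw [Circle.coe_neg, Circle.coe_one]; norm_num
  have e3 : (1 - (Complex.I)⁻¹) * (1 - Complex.I) = 2 := by
    rw [hI]; linear_combination -hI2
  rw [e1, e2] at h1
  rw [e3, hI, sub_neg_eq_add] at h2
  generalize wirtingerBar A w = u at *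
  generalize wirtinger B w = v at *
  generalize B w * A w = x at *
  generalize A w * B w = y at *
  have h3 : (2 * Complex.I) • (u + v) = 0 := by
    have h4 : (2 * Complex.I) • (u + v) =
        (2 : ℂ) • (((1 + Complex.I) • u + (2 : ℂ) • x) - ((1 - Complex.I) • v + (2 : ℂ) • y)) -
        (((2 : ℂ) • u + (2 * 2 : ℂ) • x) - ((2 : ℂ) • v + (2 * 2 : ℂ) • y)) := by
      module
    have h5 := sub_eq_zero.2 h1
    have h6 := sub_eq_zero.2 h2
    rw [h4, h5, h6, smul_zero]
    exact sub_zero 0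
  exact (smul_eq_zero.1 h3).resolve_left (by simp)

theorem contDiffAt_wirtinger {f : ℂ → EndCn n} (hf : ContDiffAt ℝ ∞ f w) :
    ContDiffAt ℝ ∞ (wirtinger f) w ∧ ContDiffAt ℝ ∞ (wirtingerBar f) w :=
  ⟨((contDiffAt_fderiv_apply hf 1).sub
      ((contDiffAt_fderiv_apply hf Complex.I).const_smul Complex.I)).const_smul (1 / 2 : ℂ),
    ((contDiffAt_fderiv_apply hf 1).add
      ((contDiffAt_fderiv_apply hf Complex.I).const_smul Complex.I)).const_smul (1 / 2 : ℂ)⟩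

theorem contDiffAt_Az {φ : ℂ → EndCn n} (hφ : ContDiffAt ℝ ∞ φ w) :
    ContDiffAt ℝ ∞ (Az φ) w ∧ ContDiffAt ℝ ∞ (Azbar φ) w :=
  ⟨((contDiffAt_star hφ).mul (contDiffAt_wirtinger hφ).1).const_smul (1 / 2 : ℂ),
    ((contDiffAt_star hφ).mul (contDiffAt_wirtinger hφ).2).const_smul (1 / 2 : ℂ)⟩

/-- The harmonic map equation in terms of `A_z` and `A_z̄`. -/
theorem harmonic_equation {φ : ℂ → EndCn n} (hφ : ContDiffAt ℝ ∞ φ w)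
    (h : wirtingerBar (Az φ) w + wirtinger (Azbar φ) w = 0) :
    fderiv ℝ (fun u => star (φ u) * fderiv ℝ φ u 1) w 1 +
      fderiv ℝ (fun u => star (φ u) * fderiv ℝ φ u Complex.I) w Complex.I = 0 := by
  have hA : DifferentiableAt ℝ (Az φ) w := (contDiffAt_Az hφ).1.differentiableAt (by simp)
  have hB : DifferentiableAt ℝ (Azbar φ) w := (contDiffAt_Az hφ).2.differentiableAt (by simp)
  have e1 : (fun u => star (φ u) * fderiv ℝ φ u 1) =
      fun u => (2 : ℂ) • (Az φ u + Azbar φ u) := by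
    funext u
    change _ = (2 : ℂ) • ((1 / 2 : ℂ) • (star (φ u) * wirtinger φ u) +
      (1 / 2 : ℂ) • (star (φ u) * wirtingerBar φ u))
    rw [fderiv_one_eq, mul_add]
    module
  have e2 : (fun u => star (φ u) * fderiv ℝ φ u Complex.I) =
      fun u => (2 * Complex.I) • (Az φ u - Azbar φ u) := by
    funext u
    change _ = (2 * Complex.I) • ((1 / 2 : ℂ) • (star (φ u) * wirtinger φ u) -
      (1 / 2 : ℂ) • (star (φ u) * wirtingerBar φ u))
    rw [fderiv_I_eq, mul_smul_comm, mul_sub]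
    module
  have h1 : fderiv ℝ (fun u => (2 : ℂ) • (Az φ u + Azbar φ u)) w 1 =
      (2 : ℂ) • (fderiv ℝ (Az φ) w 1 + fderiv ℝ (Azbar φ) w 1) := by
    have := ((hA.hasFDerivAt.add hB.hasFDerivAt).const_smul (2 : ℂ)).fderiv
    change fderiv ℝ (fun u => (2 : ℂ) • (Az φ u + Azbar φ u)) w = _ at this
    rw [this]
    rfl
  have h2 : fderiv ℝ (fun u => (2 * Complex.I) • (Az φ u - Azbar φ u)) w Complex.I =
      (2 * Complex.I) • (fderiv ℝ (Az φ) w Complex.I - fderiv ℝ (Azbar φ) w Complex.I) := by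
    have := ((hA.hasFDerivAt.sub hB.hasFDerivAt).const_smul (2 * Complex.I)).fderiv
    change fderiv ℝ (fun u => (2 * Complex.I) • (Az φ u - Azbar φ u)) w = _ at this
    rw [this]
    rfl
  have h3 : (4 : ℂ) • (wirtingerBar (Az φ) w + wirtinger (Azbar φ) w) = 0 := by
    rw [h]
    exact smul_zero (A := EndCn n) (4 : ℂ)
  rw [e1, e2, h1, h2, ← h3, wirtinger, wirtingerBar]
  module

end ZeroCurvature

section Smooth

variable {M : Type*} [TopologicalSpace M] [ChartedSpace ℂ M] {n : ℕ}

theorem SmoothFam.isSmooth {f : M → EndCn n} (hf : SmoothFam f) : IsSmooth f := by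
  intro p
  rw [contMDiffAt_iff]
  have h := hf (chartAt ℂ p) (chart_mem_atlas ℂ p) (chartAt ℂ p p) (mem_chart_target ℂ p)
  constructor
  · have h1 := h.continuousAt.comp ((chartAt ℂ p).continuousAt (mem_chart_source ℂ p))
    refine h1.congr ?_
    filter_upwards [(chartAt ℂ p).open_source.mem_nhds (mem_chart_source ℂ p)] with q hq
    simp only [Function.comp_apply, (chartAt ℂ p).left_inv hq]
  · change ContDiffWithinAt ℝ ∞ (f ∘ (chartAt ℂ p).symm) (Set.range id) (chartAt ℂ p p)
    exact h.contDiffWithinAt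

theorem IsSmooth.contDiffAt {f : M → EndCn n} (hf : IsSmooth f) (p : M) :
    ContDiffAt ℝ ∞ (f ∘ (chartAt ℂ p).symm) (chartAt ℂ p p) := by
  have h := (contMDiffAt_iff.1 (hf p)).2
  change ContDiffWithinAt ℝ ∞ (f ∘ (chartAt ℂ p).symm) (Set.range id) (chartAt ℂ p p) at h
  rw [Set.range_id] at h
  exact contDiffWithinAt_univ.1 h

end Smooth

section Extended

variable {M : Type*} [TopologicalSpace M] [ChartedSpace ℂ M] {r n : ℕ}

theorem unitonProj_star (B : M → Submodule ℂ (Crn r n)) (q : M) (j : ℕ) :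
    star (unitonProj B q j) = unitonProj B q j :=
  star_proj _

theorem unitonProduct_eq (B : M → Submodule ℂ (Crn r n)) (l : Circle) (p : M) :
    unitonProduct B l p = prodLoop (unitonProj B p) r l := by
  simp only [unitonProduct, prodLoop, projPerp_eq]
  rfl

/-- `φ = φ_0 Φ_{-1}`. -/
theorem harmonicMap_eq (φ₀ : unitary (EndCn n)) (B : M → Submodule ℂ (Crn r n)) (p : M) :
    harmonicMap φ₀ B p = φ₀ * unitonProduct B (-1) p := by
  have h : ∀ f g : EndCn n, f - g = f + (-1 : ℂ) • g := fun f g => by module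
  simp only [harmonicMap, unitonProduct, Circle.coe_neg, Circle.coe_one, h]

variable [T2Space M] [ConnectedSpace M] [IsManifold 𝓘(ℂ) ω M]

/-- `Φ` is an extended solution and `φ` is harmonic: the equations of `exists_wirtinger_prodLoop`,
with the constant `A` identified as `A_z`. -/
theorem isExtendedSolution_unitonProduct (φ₀ : unitary (EndCn n))
    {B X : M → Submodule ℂ (Crn r n)} (hB : IsHolomorphicSubbundle B)
    (hX : IsHolomorphicSubbundle X) (hBX : ∀ p, X p = (B p).map (HtoL r n)) :
    IsExtendedSolution (harmonicMap φ₀ B) (unitonProduct B) := by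
  have hsm := (smoothFam_and_range_muOp hB le_rfl).1
  have hU : ∀ l p, unitonProduct B l p ∈ unitary (EndCn n) := fun l p => by
    rw [unitonProduct_eq]
    exact prodLoop_unitary (unitonProj_mul_self B p) (unitonProj_star B p) r l
  have hΦs : ∀ l, SmoothFam (unitonProduct B l) := by
    intro l e he w hw
    have h : unitonProduct B l ∘ e.symm = fun z => prodLoop (unitonProj B (e.symm z)) r l :=
      funext fun z => unitonProduct_eq B l _
    rw [h]
    exact contDiffAt_prodLoop (fun j hj => hsm j hj e he w hw) l
  have hφ : ∀ e : OpenPartialHomeomorph M ℂ, harmonicMap φ₀ B ∘ e.symm =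
      fun z => (φ₀ : EndCn n) * (unitonProduct B (-1) ∘ e.symm) z := fun e =>
    funext fun z => harmonicMap_eq φ₀ B _
  have hφs : SmoothFam (harmonicMap φ₀ B) := by
    intro e he w hw
    rw [hφ]
    exact contDiffAt_const.mul (hΦs (-1) e he w hw)
  have hφU : ∀ p, harmonicMap φ₀ B p ∈ unitary (EndCn n) := fun p => by
    rw [harmonicMap_eq]
    exact mul_mem φ₀.2 (hU _ _)
  have key : ∀ e ∈ atlas ℂ M, ∀ w ∈ e.target, ∀ l : Circle,
      wirtinger (unitonProduct B l ∘ e.symm) w = (1 - (l : ℂ)⁻¹) •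
        (unitonProduct B l (e.symm w) * Az (harmonicMap φ₀ B ∘ e.symm) w) ∧
      wirtingerBar (unitonProduct B l ∘ e.symm) w = (1 - (l : ℂ)) •
        (unitonProduct B l (e.symm w) * Azbar (harmonicMap φ₀ B ∘ e.symm) w) := by
    intro e he w hw
    obtain ⟨E, hE, hidem, hrg, hNE⟩ := exists_projection_model hX he hw
    obtain ⟨A, hA⟩ := exists_wirtinger_prodLoop (P := fun z => unitonProj B (e.symm z)) (w := w)
      (fun z => unitonProj_mul_self B _) (fun z => unitonProj_star B _)
      (fun j hj => hsm j hj e he w hw) hE hidem (by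
        filter_upwards [hrg] with z hz
        rw [← modelBundle_eq_range hB hX hBX, modelBundle_eq_model hX]
        exact hz) hNE.self_of_nhds
    simp only [← unitonProduct_eq] at hA
    replace hA : ∀ l : Circle,
        wirtinger (unitonProduct B l ∘ e.symm) w =
          (1 - (l : ℂ)⁻¹) • (unitonProduct B l (e.symm w) * A) ∧
        wirtingerBar (unitonProduct B l ∘ e.symm) w =
          (1 - (l : ℂ)) • (unitonProduct B l (e.symm w) * -star A) := hA
    have hd := (hΦs (-1) e he w hw).differentiableAt (by simp)
    -- at `λ = -1` the equations identify the constant `A` with `A_z`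
    have hstar : ∀ x, star (harmonicMap φ₀ B (e.symm w)) *
        ((φ₀ : EndCn n) * ((2 : ℂ) • (unitonProduct B (-1) (e.symm w) * x))) = (2 : ℂ) • x := by
      intro x
      rw [mul_smul_comm, mul_smul_comm, ← mul_assoc (φ₀ : EndCn n), ← harmonicMap_eq, ← mul_assoc,
        (Unitary.mem_iff.1 (hφU _)).1]
      congr 1
    have e1 : (1 - ((-1 : Circle) : ℂ)⁻¹) = 2 := by
      rw [Circle.coe_neg, Circle.coe_one]; norm_num
    have e2 : (1 - ((-1 : Circle) : ℂ)) = 2 := by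
      rw [Circle.coe_neg, Circle.coe_one]; norm_num
    obtain ⟨h1, h2⟩ := hA (-1)
    rw [e1] at h1
    rw [e2] at h2
    have hAz : Az (harmonicMap φ₀ B ∘ e.symm) w = A := by
      change (1 / 2 : ℂ) • (star (harmonicMap φ₀ B (e.symm w)) *
        wirtinger (harmonicMap φ₀ B ∘ e.symm) w) = A
      rw [hφ, wirtinger_mul (differentiableAt_const _) hd, wirtinger_const, zero_mul, add_zero]
      change (1 / 2 : ℂ) • (_ * (_ * wirtinger (unitonProduct B (-1) ∘ e.symm) w)) = A
      rw [h1, hstar]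
      module
    have hAzbar : Azbar (harmonicMap φ₀ B ∘ e.symm) w = -star A := by
      change (1 / 2 : ℂ) • (star (harmonicMap φ₀ B (e.symm w)) *
        wirtingerBar (harmonicMap φ₀ B ∘ e.symm) w) = _
      rw [hφ, wirtingerBar_mul (differentiableAt_const _) hd, wirtingerBar_const, zero_mul,
        add_zero]
      change (1 / 2 : ℂ) • (_ * (_ * wirtingerBar (unitonProduct B (-1) ∘ e.symm) w)) = _
      rw [h2, hstar]
      module
    rw [hAz, hAzbar]
    exact hA
  refine ⟨⟨hφU, hφs.isSmooth, fun e he w hw => ?_⟩, hU, fun l => (hΦs l).isSmooth, fun p => ?_,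
    fun l e he w hw => (key e he w hw l).1, fun l e he w hw => (key e he w hw l).2⟩
  · refine harmonic_equation (φ := harmonicMap φ₀ B ∘ e.symm) (hφs e he w hw) ?_
    have hA := contDiffAt_Az (hφs e he w hw)
    refine wirtingerBar_add_wirtinger_eq_zero (fun l => hΦs l e he w hw)
      (hA.1.differentiableAt (by simp)) (hA.2.differentiableAt (by simp)) (fun l => hU l _) ?_ ?_
    · intro l
      filter_upwards [eventually_target hw] with z hz using (key e he z hz l).1
    · intro l
      filter_upwards [eventually_target hw] with z hz using (key e he z hz l).2
  · rw [unitonProduct_eq, prodLoop_one]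

end Extended

/-! ### Fourier coefficients -/

section Fourier

open MeasureTheory AddCircle

variable {r n : ℕ}

/-- The Haar probability measure on `ℝ/ℤ`. -/
local notation "μH" => (haarAddCircle : Measure UnitAddCircle)

theorem fourier_eq_toCircle_zpow (k : ℤ) (t : UnitAddCircle) :
    fourier k t = (toCircle t : ℂ) ^ k := by
  rw [fourier_apply, toCircle_zsmul, Circle.coe_zpow]

/-- Pointwise application of a Laurent polynomial loop of operators preserves `Lᵖ`. -/
theorem memLp_loop_apply {p : ENNReal} {A : Circle → EndCn n} {S : Set ℤ}
    (hA : A ∈ loops (EndCn n) S) {g : UnitAddCircle → Cn n} (hg : MemLp g p μH) :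
    MemLp (fun t => A (toCircle t) (g t)) p μH := by
  induction hA using loops_induction with
  | hzero => exact MemLp.zero'
  | hadd f h _ _ hf hh => exact hf.add hh
  | hmono k hk T =>
    have h1 : MemLp (fun t => T (g t)) p μH := T.comp_memLp' hg
    refine h1.of_le (f := fun t => ((toCircle t : ℂ) ^ k • T) (g t)) ?_ ?_
    · have h2 := (fourier (T := 1) k).continuous.aestronglyMeasurable (μ := μH)
      refine (h2.smul h1.aestronglyMeasurable).congr (Eventually.of_forall fun t => ?_)
      simp only [Pi.smul_apply', fourier_eq_toCircle_zpow]
      rfl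
    · refine Eventually.of_forall fun t => ?_
      rw [_root_.smul_apply, norm_smul, norm_zpow, Circle.norm_coe, one_zpow, one_mul]

theorem fourierCoeff_add {f g : UnitAddCircle → Cn n} (hf : Integrable f μH)
    (hg : Integrable g μH) (m : ℤ) :
    fourierCoeff (fun t => f t + g t) m = fourierCoeff f m + fourierCoeff g m :=
  congrFun (fourierCoeff.add hf hg) m

theorem fourierCoeff_sub {f g : UnitAddCircle → Cn n} (hf : Integrable f μH)
    (hg : Integrable g μH) (m : ℤ) :
    fourierCoeff (fun t => f t - g t) m = fourierCoeff f m - fourierCoeff g m := by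
  simp only [fourierCoeff, smul_sub]
  exact integral_sub (hf.fourier_smul _) (hg.fourier_smul _)

theorem fourierCoeff_zpow_smul_clm (T : EndCn n) {g : UnitAddCircle → Cn n}
    (hg : Integrable g μH) (k m : ℤ) :
    fourierCoeff (fun t => ((toCircle t : ℂ) ^ k • T) (g t)) m = T (fourierCoeff g (m - k)) := by
  rw [fourierCoeff, fourierCoeff, ← ContinuousLinearMap.integral_comp_comm T (hg.fourier_smul _)]
  refine integral_congr_ae (Eventually.of_forall fun t => ?_)
  change fourier (-m) t • ((toCircle t : ℂ) ^ k • T (g t)) = T (fourier (-(m - k)) t • g t)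
  rw [map_smul, smul_smul, ← fourier_eq_toCircle_zpow, ← fourier_add,
    show -m + k = -(m - k) by ring]

/-- A loop with exponents `≥ a` maps functions with coefficients in degrees `≥ b` to functions with
coefficients in degrees `≥ a + b`. -/
theorem fourierCoeff_loop_apply_eq_zero {a b : ℤ} {A : Circle → EndCn n}
    (hA : A ∈ loops (EndCn n) (Set.Ici a)) {g : UnitAddCircle → Cn n} (hg : Integrable g μH)
    (hb : ∀ m < b, fourierCoeff g m = 0) {m : ℤ} (hm : m < a + b) :
    fourierCoeff (fun t => A (toCircle t) (g t)) m = 0 := by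
  induction hA using loops_induction with
  | hzero => simp [fourierCoeff]
  | hadd f h hf hh hf' hh' =>
    have h1 := memLp_loop_apply hf (memLp_one_iff_integrable.2 hg)
    have h2 := memLp_loop_apply hh (memLp_one_iff_integrable.2 hg)
    have h3 := fourierCoeff_add (memLp_one_iff_integrable.1 h1) (memLp_one_iff_integrable.1 h2) m
    rw [hf', hh', add_zero] at h3
    exact h3
  | hmono k hk T =>
    have hk' : a ≤ k := hk
    rw [fourierCoeff_zpow_smul_clm T hg, hb _ (by omega), map_zero]

theorem fourierCoeff_monomial (k : ℤ) (x : Cn n) (m : ℤ) :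
    fourierCoeff (fun t : UnitAddCircle => (toCircle t : ℂ) ^ k • x) m =
      if m = k then x else 0 := by
  have h : fourierCoeff (fun t : UnitAddCircle => (toCircle t : ℂ) ^ k • x) m =
      fourierCoeff (fourier (T := 1) k) m • x := by
    rw [fourierCoeff, fourierCoeff, ← integral_smul_const]
    refine integral_congr_ae (Eventually.of_forall fun t => ?_)
    change fourier (-m) t • (toCircle t : ℂ) ^ k • x = (fourier (-m) t • fourier k t) • x
    rw [smul_assoc, fourier_eq_toCircle_zpow k]
  rw [h, fourierCoeff_fourier, Pi.single_apply]
  split_ifs <;> simp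

theorem integrable_loop {f : Circle → Cn n} {S : Set ℤ} (hf : f ∈ loops (Cn n) S) :
    Integrable (fun t => f (toCircle t)) μH := by
  induction hf using loops_induction with
  | hzero => exact integrable_zero _ _ _
  | hadd f g _ _ hf hg => exact hf.add hg
  | hmono k hk x =>
    have h : Continuous fun t : UnitAddCircle => fourier k t • x :=
      (fourier k).continuous.smul continuous_const
    simp only [fourier_eq_toCircle_zpow] at h
    exact h.integrable_of_hasCompactSupport (HasCompactSupport.of_compactSpace _)

theorem fourierCoeff_loop_eq_zero {f : Circle → Cn n} {S : Set ℤ} (hf : f ∈ loops (Cn n) S)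
    {m : ℤ} (hm : m ∉ S) : fourierCoeff (fun t : UnitAddCircle => f (toCircle t)) m = 0 := by
  induction hf using loops_induction with
  | hzero => simp [fourierCoeff]
  | hadd f g hf hg hf' hg' =>
    rw [fourierCoeff_add (integrable_loop hf) (integrable_loop hg), hf', hg', add_zero]
  | hmono k hk x =>
    rw [fourierCoeff_monomial, if_neg (by rintro rfl; exact hm hk)]

theorem fourierCoeff_polyLoop (v : Crn r n) {i : ℕ} (hi : i < r) :
    fourierCoeff (fun t : UnitAddCircle => polyLoop r n v (toCircle t)) i = coord v i := by
  have h1 : (fun l => polyLoop r n v l - (l : ℂ) ^ (i : ℤ) • coord v i) ∈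
      loops (Cn n) {(i : ℤ)}ᶜ := by
    have h2 : (fun l => polyLoop r n v l - (l : ℂ) ^ (i : ℤ) • coord v i) =
        ∑ m ∈ (Finset.range r).erase i, fun l : Circle => (l : ℂ) ^ m • coord v m := by
      ext1 l
      rw [polyLoop_apply, ← Finset.add_sum_erase _ _ (Finset.mem_range.2 hi), zpow_natCast,
        add_sub_cancel_left, Finset.sum_apply]
    rw [h2]
    refine Submodule.sum_mem _ fun m hm => monomialLoop_pow_mem ?_ _
    simpa using (Finset.mem_erase.1 hm).1
  have h3 := fourierCoeff_loop_eq_zero h1 (m := i) (by simp)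
  rw [fourierCoeff_sub (integrable_loop (polyLoop_mem v))
    (integrable_loop (monomialLoop_mem (Set.mem_univ (i : ℤ)) (coord v i))),
    fourierCoeff_monomial, if_pos rfl] at h3
  exact sub_eq_zero.1 h3

/-- Subtracting from `f ∈ H₊` the polynomial loop of its first `r` coefficients leaves an element
of `λʳ H₊`. -/
theorem fourierCoeff_sub_polyLoop {f : UnitAddCircle → Cn n} (hf : Integrable f μH)
    (h0 : ∀ m < 0, fourierCoeff f m = 0) {v : Crn r n}
    (hv : ∀ i : Fin r, v i = fourierCoeff f (i : ℤ)) {m : ℤ} (hm : m < r) :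
    fourierCoeff (fun t => f t - polyLoop r n v (toCircle t)) m = 0 := by
  rw [fourierCoeff_sub hf (integrable_loop (polyLoop_mem v))]
  rcases lt_or_ge m 0 with h | h
  · rw [h0 m h, fourierCoeff_loop_eq_zero (polyLoop_mem v) (by simpa using h), sub_zero]
  · lift m to ℕ using h
    have hm' : m < r := by exact_mod_cast hm
    rw [fourierCoeff_polyLoop v hm', coord_of_lt v hm', hv ⟨m, hm'⟩, sub_self]

theorem fourierCoeff_eq_of_ae {f a b c : UnitAddCircle → Cn n} {m : ℤ}
    (h : f =ᵐ[μH] fun t => a t + b t + c t) (ha : Integrable a μH) (hb : Integrable b μH)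
    (hc : Integrable c μH) (ha0 : fourierCoeff a m = 0) (hb0 : fourierCoeff b m = 0) :
    fourierCoeff f m = fourierCoeff c m := by
  have hab : Integrable (fun t => a t + b t) μH := ha.add hb
  rw [fourierCoeff_congr_ae h, fourierCoeff_add hab hc, fourierCoeff_add ha hb, ha0, hb0, add_zero,
    zero_add]

theorem hilbertH_integrable (f : HilbertH n) : Integrable (f : UnitAddCircle → Cn n) μH :=
  (Lp.memLp f).integrable (by norm_num)

/-- `Φ(H₊)` consists of the `f ∈ H₊` whose first `r` coefficients form a vector of the range of
`laOp`. -/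
theorem loopImage_prodLoop {P : ℕ → EndCn n} (hp : ∀ j, P j * P j = P j)
    (hs : ∀ j, star (P j) = P j) :
    loopImage (prodLoop P r) = cosetSpace (rg (laOp r P r)) := by
  have hΦ0 : prodLoop P r ∈ loops (EndCn n) (Set.Ici 0) :=
    loops_mono (fun k hk => hk.1) (prodLoop_mem P r)
  have hΦs : (fun l => star (prodLoop P r l)) ∈ loops (EndCn n) (Set.Ici (-(r : ℤ))) :=
    star_mem_loops (fun k hk => by simp only [Set.mem_Icc, Set.mem_Ici] at hk ⊢; omega)
      (prodLoop_mem P r)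
  ext f
  constructor
  · rintro ⟨g, hg, hfg⟩
    have hgi := hilbertH_integrable g
    let v : Crn r n := fun i => fourierCoeff (g : UnitAddCircle → Cn n) (i : ℤ)
    have hg0 := fun m (hm : m < (r : ℤ)) => fourierCoeff_sub_polyLoop (r := r) hgi hg
      (v := v) (fun i => rfl) hm
    have hgvi : Integrable (fun t => g t - polyLoop r n v (toCircle t)) μH :=
      hgi.sub (integrable_loop (polyLoop_mem v))
    have h1 := fun m (hm : m < (r : ℤ)) => fourierCoeff_loop_apply_eq_zero hΦ0 hgvi hg0
      (m := m) (by omega)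
    -- `f` and the polynomial loop of `laOp v` have the same coefficients in degrees below `r`
    have h2 : ∀ m < (r : ℤ), fourierCoeff (f : UnitAddCircle → Cn n) m =
        fourierCoeff (fun t : UnitAddCircle => polyLoop r n (laOp r P r v) (toCircle t)) m := by
      intro m hm
      have hρ := prodLoop_polyLoop P r v
      have i1 := memLp_loop_apply hΦ0 (memLp_one_iff_integrable.2 hgvi)
      have i2 := integrable_loop hρ
      have c2 := fourierCoeff_loop_eq_zero hρ (m := m) (by simpa using hm)
      have i3 := integrable_loop (polyLoop_mem (laOp r P r v))
      refine fourierCoeff_eq_of_ae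
        (a := fun t => prodLoop P r (toCircle t) (g t - polyLoop r n v (toCircle t)))
        (b := fun t => prodLoop P r (toCircle t) (polyLoop r n v (toCircle t)) -
          polyLoop r n (laOp r P r v) (toCircle t)) ?_
        (memLp_one_iff_integrable.1 i1) i2 i3 (h1 m hm) c2
      filter_upwards [hfg] with t ht
      rw [ht, map_sub]
      abel
    refine ⟨fun m hm => ?_, ⟨v, ?_⟩⟩
    · rw [h2 m (by omega), fourierCoeff_loop_eq_zero (polyLoop_mem _) (by simpa using hm)]
    · ext1 i
      rw [h2 i (by exact_mod_cast i.2), fourierCoeff_polyLoop _ i.2, coord_fin]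
      rfl
  · rintro ⟨hf, hfv⟩
    have hfi := hilbertH_integrable f
    set v : Crn r n := fun i => fourierCoeff (f : UnitAddCircle → Cn n) (i : ℤ) with hv
    have hf0 := fun m (hm : m < (r : ℤ)) => fourierCoeff_sub_polyLoop (r := r) hfi hf
      (v := v) (fun i => rfl) hm
    have hfvi : Integrable (fun t => f t - polyLoop r n v (toCircle t)) μH :=
      hfi.sub (integrable_loop (polyLoop_mem v))
    have hmem := memLp_loop_apply hΦs (Lp.memLp f)
    have hstar := star_prodLoop_apply_mem hp hs hfv (f := polyLoop r n v) (by
      simp only [sub_self]; exact Submodule.zero_mem _)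
    refine ⟨hmem.toLp, fun m hm => ?_, ?_⟩
    · rw [fourierCoeff_congr_ae hmem.coeFn_toLp]
      have h1 : (fun t => star (prodLoop P r (toCircle t)) (f t)) = fun t =>
          star (prodLoop P r (toCircle t)) (f t - polyLoop r n v (toCircle t)) +
          star (prodLoop P r (toCircle t)) (polyLoop r n v (toCircle t)) := by
        funext t
        rw [map_sub]
        abel
      have i1 := memLp_one_iff_integrable.1
        (memLp_loop_apply hΦs (memLp_one_iff_integrable.2 hfvi))
      rw [h1, fourierCoeff_add i1 (integrable_loop hstar),
        fourierCoeff_loop_eq_zero hstar (by simpa using hm), add_zero]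
      exact fourierCoeff_loop_apply_eq_zero hΦs hfvi hf0 (by omega)
    · filter_upwards [hmem.coeFn_toLp] with t ht
      rw [ht, ← clm_mul_apply, (Unitary.mem_iff.1 (prodLoop_unitary hp hs r _)).2]
      rfl

end Fourier

/-! ### Uniqueness of extended solutions of type one -/

/-- Stated in an abstract algebra, where `neg_add_cancel` applies; on `EndCn n` the operations come
from continuous linear maps. -/
theorem smul_mul_neg_add {A : Type*} [Ring A] [Algebra ℂ A] (s : ℂ) (a b c : A) :
    s • (a * (-b * c)) + s • (a * b * c) = 0 := by
  rw [mul_assoc, neg_mul, mul_neg, smul_neg, neg_add_cancel]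

section Uniqueness

variable {n : ℕ}

theorem differentiableAt_star {f : ℂ → EndCn n} {w : ℂ} (hf : DifferentiableAt ℝ f w) :
    DifferentiableAt ℝ (fun z => star (f z)) w :=
  (starL' ℝ : EndCn n ≃L[ℝ] EndCn n).differentiableAt.comp w hf

theorem wirtingerBar_star {f : ℂ → EndCn n} {w : ℂ} (hf : DifferentiableAt ℝ f w) :
    wirtingerBar (fun z => star (f z)) w = star (wirtinger f w) := by
  have h := wirtinger_star (differentiableAt_star hf)
  simp only [star_star] at h
  rw [h, star_star]

theorem fderiv_eq_zero_of_wirtinger {f : ℂ → EndCn n} {w : ℂ} (h1 : wirtinger f w = 0)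
    (h2 : wirtingerBar f w = 0) : fderiv ℝ f w = 0 := by
  have e1 : fderiv ℝ f w 1 = 0 := by rw [fderiv_one_eq, h1, h2]; exact add_zero 0
  have e2 : fderiv ℝ f w Complex.I = 0 := by
    rw [fderiv_I_eq, h1, h2]
    exact (congrArg _ (sub_zero (0 : EndCn n))).trans (smul_zero (A := EndCn n) Complex.I)
  refine ContinuousLinearMap.ext fun h => ?_
  have h3 : h = h.re • (1 : ℂ) + h.im • Complex.I := by
    simp [Complex.re_add_im]
  rw [h3, map_add, map_smul, map_smul, e1, e2, _root_.zero_apply]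
  module

/-- `A_z̄` is minus the adjoint of `A_z`, by differentiating `φ* φ = 1`. -/
theorem star_Azbar {φ : ℂ → EndCn n} {w : ℂ} (hd : DifferentiableAt ℝ φ w)
    (hU : ∀ z, φ z ∈ unitary (EndCn n)) : star (Azbar φ w) = -Az φ w := by
  have h1 : wirtinger (fun z => star (φ z) * φ z) w = 0 := by
    have h2 : (fun z => star (φ z) * φ z) = fun _ => 1 :=
      funext fun z => (Unitary.mem_iff.1 (hU z)).1
    rw [h2, wirtinger_const]
  rw [wirtinger_mul (differentiableAt_star hd) hd, wirtinger_star hd] at h1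
  have h2 := eq_neg_of_add_eq_zero_right h1
  change star ((1 / 2 : ℂ) • (star (φ w) * wirtingerBar φ w)) =
    -((1 / 2 : ℂ) • (star (φ w) * wirtinger φ w))
  have h3 : star (1 / 2 : ℂ) = 1 / 2 := by simp
  rw [star_smul, h3, star_mul, star_star, h2, smul_neg]

variable {M : Type*} [TopologicalSpace M] [ChartedSpace ℂ M]

/-- Two extended solutions for the same harmonic map differ by a loop that is constant on `M`. -/
theorem IsExtendedSolution.mul_star_const [ConnectedSpace M] {φ : M → EndCn n}
    {Φ Ψ : Circle → M → EndCn n} (hΦ : IsExtendedSolution φ Φ) (hΨ : IsExtendedSolution φ Ψ)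
    (l : Circle) (p q : M) : Φ l p * star (Ψ l p) = Φ l q * star (Ψ l q) := by
  have hloc : IsLocallyConstant fun p => Φ l p * star (Ψ l p) := by
    rw [IsLocallyConstant.iff_eventually_eq]
    intro p
    set e := chartAt ℂ p with he
    have hea : e ∈ atlas ℂ M := chart_mem_atlas ℂ p
    have hw : e p ∈ e.target := mem_chart_target ℂ p
    have ev : ∀ {f : M → EndCn n}, IsSmooth f →
        ∀ᶠ z in 𝓝 (e p), DifferentiableAt ℝ (f ∘ e.symm) z := fun {f} hf => by
      have h1 : ContDiffAt ℝ 1 (f ∘ e.symm) (e p) := (hf.contDiffAt p).of_le (by simp)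
      exact (h1.eventually (by simp)).mono fun z hz => hz.differentiableAt (by simp)
    let g : ℂ → EndCn n := fun z => (Φ l ∘ e.symm) z * star ((Ψ l ∘ e.symm) z)
    have hg : ∀ᶠ z in 𝓝 (e p), DifferentiableAt ℝ g z ∧ fderiv ℝ g z = 0 := by
      filter_upwards [ev hΦ.harmonic.2.1, ev (hΦ.smooth l), ev (hΨ.smooth l),
        eventually_target hw] with z h0 h1 h2 hz
      have hU : ∀ z, (φ ∘ e.symm) z ∈ _root_.unitary (EndCn n) := fun z => hΦ.harmonic.1 _
      have hB := star_Azbar h0 hU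
      have hA : star (Az (φ ∘ e.symm) z) = -Azbar (φ ∘ e.symm) z := by
        have h4 := congrArg star hB
        rw [star_star] at h4
        rw [h4]
        exact ((congrArg Neg.neg (star_neg (Az (φ ∘ e.symm) z))).trans (neg_neg _)).symm
      have hl : star (1 - (l : ℂ)) = 1 - (l : ℂ)⁻¹ := by
        rw [star_sub, star_one, star_coe_circle, Circle.coe_inv]
      have hl' : star (1 - (l : ℂ)⁻¹) = 1 - (l : ℂ) := by rw [← hl, star_star]
      have e1 : wirtinger (Φ l ∘ e.symm) z = _ := hΦ.eq_dz l e hea z hz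
      have e2 : wirtingerBar (Φ l ∘ e.symm) z = _ := hΦ.eq_dzbar l e hea z hz
      have e3 : wirtinger (Ψ l ∘ e.symm) z = _ := hΨ.eq_dz l e hea z hz
      have e4 : wirtingerBar (Ψ l ∘ e.symm) z = _ := hΨ.eq_dzbar l e hea z hz
      have h3 := differentiableAt_star h2
      refine ⟨h1.mul h3, fderiv_eq_zero_of_wirtinger ?_ ?_⟩
      · rw [wirtinger_mul h1 h3, wirtinger_star h2, e1, e4, star_smul, star_mul, hB, hl,
          mul_smul_comm, smul_mul_assoc]
        exact smul_mul_neg_add (A := EndCn n) _ _ _ _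
      · rw [wirtingerBar_mul h1 h3, wirtingerBar_star h2, e2, e3, star_smul, star_mul, hA, hl',
          mul_smul_comm, smul_mul_assoc]
        exact smul_mul_neg_add (A := EndCn n) _ _ _ _
    obtain ⟨ε, hε, hball⟩ := Metric.eventually_nhds_iff_ball.1 hg
    have hconst : ∀ᶠ z in 𝓝 (e p), g z = g (e p) := by
      filter_upwards [Metric.ball_mem_nhds _ hε] with z hz
      exact Metric.isOpen_ball.is_const_of_fderiv_eq_zero (convex_ball _ _).isPreconnected
        (fun x hx => (hball x hx).1.differentiableWithinAt) (fun x hx => (hball x hx).2) hz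
        (Metric.mem_ball_self hε)
    have h6 := (eventually_nhds_chart e hw
      (fun q => Φ l q * star (Ψ l q) = Φ l p * star (Ψ l p))).1 (by
        filter_upwards [hconst] with z hz
        have h7 : g (e p) = Φ l p * star (Ψ l p) := by
          change Φ l (e.symm (e p)) * star (Ψ l (e.symm (e p))) = _
          rw [e.left_inv (mem_chart_source ℂ p)]
        rw [← h7, ← hz]
        rfl)
    rwa [e.left_inv (mem_chart_source ℂ p)] at h6
  exact hloc.apply_eq_of_preconnectedSpace p q

end Uniqueness

section Laurent

variable {n : ℕ}

/-- The lowest term of a Laurent polynomial loop can be split off. -/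
theorem exists_leading_coeff {F : Type*} [AddCommGroup F] [Module ℂ F] {f : Circle → F} {a : ℤ}
    (hf : f ∈ loops F (Set.Ici a)) :
    ∃ c : F, (fun l => f l - (l : ℂ) ^ a • c) ∈ loops F (Set.Ici (a + 1)) := by
  induction hf using loops_induction with
  | hzero =>
    refine ⟨0, ?_⟩
    convert Submodule.zero_mem (loops F (Set.Ici (a + 1))) using 1
    ext1 l
    simp
  | hadd f g _ _ hf hg =>
    obtain ⟨c, hc⟩ := hf
    obtain ⟨d, hd⟩ := hg
    refine ⟨c + d, ?_⟩
    convert Submodule.add_mem _ hc hd using 1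
    ext1 l
    simp only [Pi.add_apply, smul_add]
    abel
  | hmono k hk x =>
    have hk' : a ≤ k := hk
    rcases hk'.eq_or_lt with rfl | h
    · exact ⟨x, by simp only [sub_self]; exact Submodule.zero_mem _⟩
    · refine ⟨0, ?_⟩
      simpa using monomialLoop_mem (S := Set.Ici (a + 1)) (k := k) (by simpa using h) x

theorem exists_lower_bound {F : Type*} [AddCommGroup F] [Module ℂ F] {f : Circle → F}
    {S : Set ℤ} (hf : f ∈ loops F S) : ∃ m : ℕ, f ∈ loops F (Set.Ici (-(m : ℤ))) := by
  induction hf using loops_induction with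
  | hzero => exact ⟨0, Submodule.zero_mem _⟩
  | hadd f g _ _ hf hg =>
    obtain ⟨a, ha⟩ := hf
    obtain ⟨b, hb⟩ := hg
    refine ⟨max a b, Submodule.add_mem _ (loops_mono ?_ ha) (loops_mono ?_ hb)⟩ <;>
    · intro k hk
      simp only [Set.mem_Ici] at hk ⊢
      push_cast
      omega
  | hmono k hk x => exact ⟨k.natAbs, monomialLoop_mem (by simp only [Set.mem_Ici]; omega) x⟩

theorem eq_zero_of_mem_loops_empty {F : Type*} [AddCommGroup F] [Module ℂ F] {f : Circle → F}
    (h : f ∈ loops F ∅) : f = 0 := by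
  induction h using loops_induction with
  | hzero => rfl
  | hadd f g _ _ hf hg => rw [hf, hg]; funext l; exact add_zero 0
  | hmono k hk => exact absurd hk (Set.notMem_empty k)

theorem eq_zero_of_monomial_mem {F : Type*} [AddCommGroup F] [Module ℂ F] {a : ℤ} {c : F}
    (h : (fun l : Circle => (l : ℂ) ^ a • c) ∈ loops F (Set.Ici (a + 1))) : c = 0 := by
  have h1 := mem_loops_inter (monomialLoop_mem (Set.mem_singleton a) c) h
  have h2 : ({a} : Set ℤ) ∩ Set.Ici (a + 1) = ∅ := by
    ext k
    simp only [Set.mem_inter_iff, Set.mem_singleton_iff, Set.mem_Ici, Set.mem_empty_iff_false,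
      iff_false]
    omega
  rw [h2] at h1
  have h3 := congrFun (eq_zero_of_mem_loops_empty h1) 1
  simpa using h3

variable {M : Type*}

/-- A polynomial expansion has no negative exponents, and `T_0` is its constant term. -/
theorem HasExpansion.mem_loops [TopologicalSpace M] [ChartedSpace ℂ M] {Φ : Circle → M → EndCn n}
    {d : ℕ} {T : ℕ → M → EndCn n} (h : HasExpansion Φ d T) (p : M) :
    (fun l => Φ l p) ∈ loops (EndCn n) (Set.Ici 0) ∧
      (fun l => Φ l p - T 0 p) ∈ loops (EndCn n) (Set.Ici 1) := by
  have h1 : (fun l => Φ l p - T 0 p) ∈ loops (EndCn n) (Set.Ici 1) := by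
    have h2 : (fun l => Φ l p - T 0 p) =
        ∑ k ∈ Finset.range d, fun l : Circle => (l : ℂ) ^ (k + 1) • T (k + 1) p := by
      ext1 l
      rw [h, Finset.sum_range_succ', Finset.sum_apply, pow_zero, one_smul]
      exact add_sub_cancel_right _ _
    rw [h2]
    exact Submodule.sum_mem _ fun k _ => monomialLoop_pow_mem (by simp) _
  refine ⟨?_, h1⟩
  convert Submodule.add_mem _ (loops_mono (T := Set.Ici 0) (fun k hk => by
    simp only [Set.mem_Ici] at hk ⊢; omega) h1) (const_mem_loops (Set.mem_Ici.2 le_rfl) (T 0 p))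
    using 1
  ext1 l
  exact (sub_add_cancel _ _).symm

/-- If a constant loop `γ` carries a family of polynomial loops with full constant terms to
polynomial loops, then `γ` is polynomial: its lowest coefficient kills the constant terms. -/
theorem mem_loops_Ici_of_full [TopologicalSpace M] [ChartedSpace ℂ M] {γ : Circle → EndCn n}
    {S : Set ℤ} (hγ : γ ∈ loops (EndCn n) S) {Φ Ψ : Circle → M → EndCn n}
    (hΦ : ∀ p, (fun l => Φ l p) ∈ loops (EndCn n) (Set.Ici 0))
    (hγΨ : ∀ l p, Φ l p = γ l * Ψ l p) {T : M → EndCn n}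
    (hΨ : ∀ p, (fun l => Ψ l p - T p) ∈ loops (EndCn n) (Set.Ici 1))
    (hfull : IsFull fun p => LinearMap.range (T p : Cn n →ₗ[ℂ] Cn n)) :
    γ ∈ loops (EndCn n) (Set.Ici 0) := by
  obtain ⟨m, hm⟩ := exists_lower_bound hγ
  clear hγ
  induction m with
  | zero => simpa using hm
  | succ m ih =>
    refine ih ?_
    obtain ⟨c, hc⟩ := exists_leading_coeff hm
    have ha : (-((m + 1 : ℕ) : ℤ) + 1) = -(m : ℤ) := by push_cast; ring
    have hcT : ∀ p, c * T p = 0 := by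
      intro p
      refine eq_zero_of_monomial_mem (a := -((m + 1 : ℕ) : ℤ)) ?_
      have h1 := mul_mem_loops (U := Set.Ici (-((m + 1 : ℕ) : ℤ) + 1)) (fun j hj k hk => by
        simp only [Set.mem_Ici] at hj hk ⊢; omega) hm (hΨ p)
      have h2 := mul_mem_loops (U := Set.Ici (-((m + 1 : ℕ) : ℤ) + 1)) (fun j hj k hk => by
        simp only [Set.mem_Ici] at hj hk ⊢; omega) hc
        (const_mem_loops (S := Set.Ici 0) (Set.mem_Ici.2 le_rfl) (T p))
      have h3 := loops_mono (T := Set.Ici (-((m + 1 : ℕ) : ℤ) + 1)) (fun k hk => by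
        simp only [Set.mem_Ici] at hk ⊢; omega) (hΦ p)
      convert Submodule.sub_mem _ (Submodule.sub_mem _ h3 h1) h2 using 1
      ext1 l
      simp only [Pi.sub_apply, hγΨ, mul_sub, sub_mul, smul_mul_assoc]
      abel
    have hc0 : c = 0 := by
      have h1 := hfull (LinearMap.ker (c : Cn n →ₗ[ℂ] Cn n)) (fun p => by
        rintro _ ⟨x, rfl⟩
        exact DFunLike.congr_fun (hcT p) x)
      ext1 x
      have hx : x ∈ LinearMap.ker (c : Cn n →ₗ[ℂ] Cn n) := h1 ▸ Submodule.mem_top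
      exact hx
    rw [hc0, ha] at hc
    convert hc using 1
    ext1 l
    have h4 : (l : ℂ) ^ (-((m + 1 : ℕ) : ℤ)) • (0 : EndCn n) = 0 := smul_zero (A := EndCn n) ((l : ℂ) ^ _)
    rw [h4]
    exact (sub_zero _).symm

/-- A harmonic map has at most one polynomial extended solution of type one. -/
theorem IsExtendedSolution.eq_of_isTypeOne [TopologicalSpace M] [ChartedSpace ℂ M]
    [ConnectedSpace M] {φ : M → EndCn n} {Φ Ψ : Circle → M → EndCn n}
    (hΦ : IsExtendedSolution φ Φ) (hΨ : IsExtendedSolution φ Ψ) (hΦ1 : IsTypeOne Φ)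
    (hΨ1 : IsTypeOne Ψ) : Φ = Ψ := by
  obtain ⟨d, T, hT, hTfull⟩ := hΦ1
  obtain ⟨d', T', hT', hTfull'⟩ := hΨ1
  obtain ⟨p₀⟩ := (inferInstance : Nonempty M)
  let γ : Circle → EndCn n := fun l => Φ l p₀ * star (Ψ l p₀)
  have h1 : ∀ l p, Φ l p = γ l * Ψ l p := by
    intro l p
    have h : γ l = Φ l p * star (Ψ l p) := hΦ.mul_star_const hΨ l p₀ p
    rw [h, mul_assoc, (Unitary.mem_iff.1 (hΨ.unitary l p)).1]
    exact (mul_one _).symm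
  have h2 : ∀ l p, Ψ l p = star (γ l) * Φ l p := by
    intro l p
    have h : γ l = Φ l p * star (Ψ l p) := hΦ.mul_star_const hΨ l p₀ p
    rw [h, star_mul, star_star, mul_assoc, (Unitary.mem_iff.1 (hΦ.unitary l p)).1]
    exact (mul_one _).symm
  have hγ : γ ∈ loops (EndCn n) Set.univ :=
    mul_mem_loops (fun _ _ _ _ => Set.mem_univ _) (hT.mem_loops p₀).1
      (star_mem_loops (T := Set.univ) (fun _ _ => Set.mem_univ _) (hT'.mem_loops p₀).1)
  have hγ' : (fun l => star (γ l)) ∈ loops (EndCn n) Set.univ :=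
    star_mem_loops (fun _ _ => Set.mem_univ _) hγ
  have h3 := mem_loops_Ici_of_full hγ (fun p => (hT.mem_loops p).1) h1
    (fun p => (hT'.mem_loops p).2) hTfull'
  have h4 := mem_loops_Ici_of_full hγ' (fun p => (hT'.mem_loops p).1) h2
    (fun p => (hT.mem_loops p).2) hTfull
  have h5 := star_mem_loops (T := Set.Iic 0) (fun k hk => by
    simp only [Set.mem_Ici, Set.mem_Iic] at hk ⊢; omega) h4
  simp only [star_star] at h5
  have h6 := mem_loops_inter h3 h5
  have h7 : Set.Ici (0 : ℤ) ∩ Set.Iic 0 = {0} := by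
    rw [Set.Ici_inter_Iic, Set.Icc_self]
  rw [h7] at h6
  have hone : γ 1 = 1 := by
    change Φ 1 p₀ * star (Ψ 1 p₀) = 1
    rw [hΦ.one, hΨ.one, star_one]
    exact one_mul 1
  funext l p
  rw [h1, eq_const_of_mem_loops h6 l, hone]
  exact one_mul _

end Laurent

/-! ### Extended solutions of type one -/

section TypeOne

variable {M : Type*} [TopologicalSpace M] [ChartedSpace ℂ M] {r n : ℕ}

theorem hasExpansion_unitonProduct (B : M → Submodule ℂ (Crn r n)) :
    HasExpansion (unitonProduct B) r fun k p => loopCoeff (unitonProj B p) r k := by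
  intro l p
  rw [unitonProduct_eq, prodLoop_eq_sum]

/-- The constant term `T_0` is determined by the loop, so type one does not depend on the choice of
an expansion. -/
theorem HasExpansion.constant_term_eq {Φ : Circle → M → EndCn n} {d d' : ℕ}
    {T T' : ℕ → M → EndCn n} (h : HasExpansion Φ d T) (h' : HasExpansion Φ d' T') : T 0 = T' 0 := by
  funext p
  have h1 := Submodule.sub_mem _ (h'.mem_loops p).2 (h.mem_loops p).2
  refine sub_eq_zero.1 (eq_zero_of_monomial_mem (a := 0) ?_)
  have h2 : (fun l : Circle => (l : ℂ) ^ (0 : ℤ) • (T 0 p - T' 0 p)) =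
      (fun l => Φ l p - T' 0 p) - fun l => Φ l p - T 0 p := by
    ext1 l
    rw [zpow_zero, one_smul]
    exact (sub_sub_sub_cancel_left _ _ _).symm
  rw [h2]
  exact h1

/-- The constant terms of `∑ λʲ B_{(j)} + λⁱ H₊` are the values `H_0` of sections of `B`. -/
theorem map_coordL_rawModel (B : M → Submodule ℂ (Crn r n)) {i : ℕ} (hi : 1 ≤ i) (q : M) :
    (rawModel B i q).map (coordL r n 0 : Crn r n →ₗ[ℂ] Cn n) =
      (jetSpan B 0 q).map (coordL r n 0 : Crn r n →ₗ[ℂ] Cn n) := by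
  have hz : ∀ k v, 1 ≤ k → coordL r n 0 ((Nop r n ^ k) v) = 0 := by
    intro k v hk
    rw [coordL_apply, coord_Nop_pow, if_neg (by omega)]
  apply le_antisymm
  · rw [rawModel, Submodule.map_sup, Submodule.map_iSup]
    refine sup_le (iSup_le fun j => ?_) ?_
    · rintro _ ⟨_, ⟨v, hv, rfl⟩, rfl⟩
      rcases Nat.eq_zero_or_pos (j : ℕ) with h | h
      · rw [h] at hv ⊢
        exact ⟨v, hv, rfl⟩
      · have h1 : coordL r n 0 ((Nop r n ^ (j : ℕ)) v) = 0 := hz _ _ h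
        change coordL r n 0 ((Nop r n ^ (j : ℕ)) v) ∈ _
        rw [h1]
        exact Submodule.zero_mem _
    · rintro _ ⟨_, ⟨v, rfl⟩, rfl⟩
      change coordL r n 0 ((Nop r n ^ i) v) ∈ _
      rw [hz _ _ hi]
      exact Submodule.zero_mem _
  · refine Submodule.map_mono ?_
    have h := nmap_jetSpan_le_rawModel B (Nat.zero_le i) q
    intro v hv
    exact h ⟨v, hv, rfl⟩

theorem fill_const_le {A : Submodule ℂ (Cn n)} {β : M → Submodule ℂ (Cn n)} {p : M}
    (h : ∀ᶠ q in 𝓝[≠] p, β q ≤ A) : fill β p ≤ A := by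
  rintro v ⟨σ, hσ, hv⟩
  have := neBot_punctured M p
  refine (Submodule.closed_of_finiteDimensional A).mem_of_tendsto hv ?_
  filter_upwards [h, hσ] with q h1 h2 using h1 h2

variable [T2Space M] [ConnectedSpace M] [IsManifold 𝓘(ℂ) ω M]

/-- A constant subspace contains all constant terms of `model B i` if and only if, generically, it
contains the values `H_0` of the sections of `B`; filling in holes does not matter, as `A` is
closed. -/
theorem map_coordL_model_le_iff {B : M → Submodule ℂ (Crn r n)} (hB : IsHolomorphicSubbundle B)
    {i : ℕ} (hi : 1 ≤ i) (A : Submodule ℂ (Cn n)) :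
    (∀ p, (model B i p).map (coordL r n 0 : Crn r n →ₗ[ℂ] Cn n) ≤ A) ↔
      ∀ p, ∀ᶠ q in 𝓝[≠] p, (jetSpan B 0 q).map (coordL r n 0 : Crn r n →ₗ[ℂ] Cn n) ≤ A := by
  constructor
  · intro h p
    filter_upwards [(genFam_rawModel hB i).fill_eq p] with q hq
    rw [← map_coordL_rawModel B hi, ← hq]
    exact h q
  · intro h p
    refine (map_fill_le (coordL r n 0) _ p).trans (fill_const_le ?_)
    filter_upwards [h p] with q hq
    rw [map_coordL_rawModel B hi]
    exact hq

/-- `α_1` and the constant term of `Φ` span the same constant subspaces: away from a discrete set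
both are the space of values `H_0 = L_0`. -/
theorem isFull_range_iff {B X : M → Submodule ℂ (Crn r n)} (hr : 1 ≤ r)
    (hB : IsHolomorphicSubbundle B) (hX : IsHolomorphicSubbundle X)
    (hBX : ∀ p, X p = (B p).map (HtoL r n)) :
    IsFull (fun p => LinearMap.range (loopCoeff (unitonProj B p) r 0 : Cn n →ₗ[ℂ] Cn n)) ↔
      IsFull (uniton B 0) := by
  have h1 : ∀ p, LinearMap.range (loopCoeff (unitonProj B p) r 0 : Cn n →ₗ[ℂ] Cn n) =
      (model X r p).map (coordL r n 0 : Crn r n →ₗ[ℂ] Cn n) := by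
    intro p
    rw [← modelBundle_eq_model hX, modelBundle_eq_range hB hX hBX]
    apply le_antisymm
    · rintro _ ⟨c, rfl⟩
      exact ⟨_, ⟨constL r n c, rfl⟩, coord_laOp_constL _ r c (by omega)⟩
    · rintro _ ⟨_, ⟨v, rfl⟩, rfl⟩
      refine ⟨coord v 0, ?_⟩
      have h := coord_laOp (unitonProj B p) r v (m := 0) (by omega)
      simp only [Nat.zero_add, Finset.sum_range_one, Nat.sub_zero] at h
      exact h.symm
  have h2 : ∀ p, uniton B 0 p = (model B 1 p).map (coordL r n 0 : Crn r n →ₗ[ℂ] Cn n) := fun p =>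
    uniton_eq_map_Rop hB (by omega) (fun j hj => absurd hj (Nat.not_lt_zero j))
      (smoothFam_and_range_muOp hB (Nat.zero_le r)).2 p
  have h3 : ∀ q, (jetSpan X 0 q).map (coordL r n 0 : Crn r n →ₗ[ℂ] Cn n) =
      (jetSpan B 0 q).map (coordL r n 0 : Crn r n →ₗ[ℂ] Cn n) := by
    intro q
    have h4 : jetSpan X 0 q = (jetSpan B 0 q).map (HtoL r n) :=
      jetSpan_map_equiv (HtoLe r n) hBX 0 q
    rw [h4, ← Submodule.map_comp]
    congr 1
    refine LinearMap.ext fun v => ?_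
    change coord (HtoL r n v) 0 = coord v 0
    rw [coord_HtoL _ (by omega)]
    simp
  refine forall_congr' fun A => ?_
  simp only [h1, h2]
  rw [map_coordL_model_le_iff hX hr, map_coordL_model_le_iff hB le_rfl]
  simp only [h3]

theorem isTypeOne_unitonProduct_iff {B X : M → Submodule ℂ (Crn r n)} (hr : 1 ≤ r)
    (hB : IsHolomorphicSubbundle B) (hX : IsHolomorphicSubbundle X)
    (hBX : ∀ p, X p = (B p).map (HtoL r n)) :
    IsTypeOne (unitonProduct B) ↔ IsFull (uniton B 0) := by
  rw [← isFull_range_iff hr hB hX hBX]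
  constructor
  · rintro ⟨d, T, hT, hfull⟩
    rw [hT.constant_term_eq (hasExpansion_unitonProduct B)] at hfull
    exact hfull
  · intro h
    exact ⟨r, _, hasExpansion_unitonProduct B, h⟩

theorem loopImage_unitonProduct {B X : M → Submodule ℂ (Crn r n)}
    (hB : IsHolomorphicSubbundle B) (hX : IsHolomorphicSubbundle X)
    (hBX : ∀ p, X p = (B p).map (HtoL r n)) (p : M) :
    loopImage (fun l => unitonProduct B l p) = cosetSpace (modelBundle X p) := by
  have h : (fun l => unitonProduct B l p) = prodLoop (unitonProj B p) r :=
    funext fun l => unitonProduct_eq B l p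
  rw [h, modelBundle_eq_range hB hX hBX]
  exact loopImage_prodLoop (unitonProj_mul_self B p) (unitonProj_star B p)

end TypeOne

end GrassModel

end

theorem mainTheorem6 {M : Type*} [TopologicalSpace M] [T2Space M] [ConnectedSpace M]
    [ChartedSpace ℂ M] [IsManifold 𝓘(ℂ) ω M]
    (n r : ℕ) (hr : 1 ≤ r)
    (φ₀ : unitary (GrassModel.EndCn n))
    (B X : M → Submodule ℂ (GrassModel.Crn r n))
    (hB : GrassModel.IsHolomorphicSubbundle B) (hX : GrassModel.IsHolomorphicSubbundle X)
    (hBX : ∀ p, X p = (B p).map (GrassModel.HtoL r n)) :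
    (∀ i < r, GrassModel.IsSmooth fun p => GrassModel.proj (GrassModel.uniton B i p)) ∧
    GrassModel.IsHolomorphicSubbundle (GrassModel.modelBundle X) ∧
    GrassModel.IsExtendedSolution (GrassModel.harmonicMap φ₀ B) (GrassModel.unitonProduct B) ∧
    (∀ p, GrassModel.loopImage (fun l => GrassModel.unitonProduct B l p) =
      GrassModel.cosetSpace (GrassModel.modelBundle X p)) ∧
    (GrassModel.IsTypeOne (GrassModel.unitonProduct B) ↔
      GrassModel.IsFull (GrassModel.uniton B 0)) ∧
    (GrassModel.IsFull (GrassModel.uniton B 0) →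
      GrassModel.IsGrassmannianModel (GrassModel.harmonicMap φ₀ B)
        (GrassModel.modelBundle X)) := by
  have hext := GrassModel.isExtendedSolution_unitonProduct φ₀ hB hX hBX
  have himage := GrassModel.loopImage_unitonProduct hB hX hBX
  have htype := GrassModel.isTypeOne_unitonProduct_iff hr hB hX hBX
  refine ⟨fun i hi => ((GrassModel.smoothFam_and_range_muOp hB le_rfl).1 i hi).isSmooth, ?_, hext,
    himage, htype, fun hfull => ⟨⟨_, ⟨hext, htype.2 hfull⟩, fun Ψ hΨ => ?_⟩, fun Ψ hΨ hΨ1 p => ?_⟩⟩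
  · rw [GrassModel.modelBundle_eq_model hX]
    exact (GrassModel.genFam_rawModel hX r).holFam_fill.isHolomorphicSubbundle
  · exact hΨ.1.eq_of_isTypeOne hext hΨ.2 (htype.2 hfull)
  · rw [hΨ.eq_of_isTypeOne hext hΨ1 (htype.2 hfull)]
    exact himage p
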